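/- Let $\lambda>0$ and $\alpha>0$. Let $\Omega\subset\mathbb R^2$ be a Lebesgue measurable set with $|\Omega|=\pi$ and finite perimeter $P(\Omega)<\infty$. Let $\partial^*\Omega$ be its (De Giorgi) reduced boundary, $\nu(y)$ the measure-theoretic outward unit normal of $\Omega$ at $y\in\partial^*\Omega$, and $\mathcal H^1$ the one-dimensional Hausdorff measure. Put $$F_{\lambda,\alpha}(\Omega):=P(\Omega)-\frac{\lambda^2}{4\pi}\int_\Omega\int_{\mathbb R^2\setminus\Omega}\frac{e^{-\lambda\alpha|x-y|}}{|x-y|}\,d^2y\,d^2x .$$ For a unit vector $\nu=(\nu_1,\nu_2)$ let $H_-^0(\nu):=\{x\in\mathbb R^2:\nu\cdot x<0\}$, $\nu^\perp:=(-\nu_2,\nu_1)$ and $R_\nu:=e_2\otimes\nu-e_1\otimes\nu^\perp$ (the rotation that takes $\nu$ to $e_2$), and let $A_\lambda:=\lambda\,e_1\otimes e_1+\lambda^2\,e_2\otimes e_2$. Write $\Delta$ for the symmetric difference of sets and $z=(z_1,z_2)$. Then all the integrals above and below are finite, and $$\begin{aligned} F_{\lambda,\alpha}(\Omega) &=\Big(1-\frac1{2\pi\alpha^2}\Big)P(\Omega)+\frac1{4\pi\alpha}\int_{\partial^*\Omega}\int_{H_-^0(\nu(y))\,\Delta\,\lambda(\Omega-y)}\Big|\nu(y)\cdot\frac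 z{|z|}\Big|\frac{e^{-\alpha|z|}}{|z|}\,d^2z\,d\mathcal H^1(y)\\ &=\Big(1-\frac1{2\pi\alpha^2}\Big)P(\Omega)+\frac1{4\pi\alpha\lambda^2}\int_{\partial^*\Omega}\int_{H_-^0(e_2)\,\Delta\,A_\lambda R_{\nu(y)}(\Omega-y)}|z_2|\,\frac{e^{-\alpha\sqrt{z_1^2+z_2^2/\lambda^2}}}{z_1^2+z_2^2/\lambda^2}\,d^2z\,d\mathcal H^1(y). \end{aligned}$$ In particular, $$F_{\lambda,\alpha}(\Omega)\ge\Big(1-\frac1{2\pi\alpha^2}\Big)P(\Omega).$$ -/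

import Mathlib

open MeasureTheory Filter Topology
open scoped ENNReal symmDiff

noncomputable section

namespace ScreenedPerimeter

/-- The Euclidean plane `ℝ²`, with the Euclidean norm and Lebesgue measure `volume`. -/
abbrev Plane : Type := EuclideanSpace ℝ (Fin 2)

/-- The standard basis vectors of the plane. -/
def e₁ : Plane := !₂[1, 0]

def e₂ : Plane := !₂[0, 1]

/-- The divergence of a vector field. -/
def divergence (T : Plane → Plane) (x : Plane) : ℝ :=
  (fderiv ℝ T x e₁) 0 + (fderiv ℝ T x e₂) 1

/-- Test vector fields: continuously differentiable with compact support. -/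
def IsTestField (T : Plane → Plane) : Prop :=
  ContDiff ℝ 1 T ∧ HasCompactSupport T

/-- The perimeter
`P(Ω) = sup {∫_Ω div T : T ∈ C_c¹(ℝ²; ℝ²), |T| ≤ 1}`, an extended nonnegative number. -/
def perimeter (Ω : Set Plane) : ℝ≥0∞ :=
  ⨆ T ∈ {T : Plane → Plane | IsTestField T ∧ ∀ x, ‖T x‖ ≤ 1},
    ENNReal.ofReal (∫ x in Ω, divergence T x)

/-- The admissible class: Lebesgue measurable sets of measure `m` and finite perimeter. -/
def admissible (m : ℝ) : Set (Set Plane) :=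
  {Ω | NullMeasurableSet Ω volume ∧ volume Ω = ENNReal.ofReal m ∧ perimeter Ω < ∞}

/-- `(μ, σ)` is the polar decomposition of the Gauss–Green measure `-Dχ_Ω`: `μ` is a Radon
measure, `|σ| = 1` holds `μ`-almost everywhere, and `∫_Ω div T = ∫ T ⋅ σ dμ` for all test
fields `T`. By uniqueness in the Riesz theorem, `μ` (which is `|Dχ_Ω|`) is determined by `Ω`,
and so is `σ` up to `μ`-null sets. -/
def IsGaussGreenPolar (Ω : Set Plane) (μ : Measure Plane) (σ : Plane → Plane) : Prop :=
  IsLocallyFiniteMeasure μ ∧ Measurable σ ∧ (∀ᵐ x ∂μ, ‖σ x‖ = 1) ∧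
    ∀ T : Plane → Plane, IsTestField T →
      ∫ x in Ω, divergence T x = ∫ x, inner ℝ (T x) (σ x) ∂μ

/-- `ν` is the measure-theoretic outward unit normal of `Ω` at `y`, in the sense of De Giorgi:
`y` lies in the support of `μ = |Dχ_Ω|`, and the averages `-Dχ_Ω(B_r(y)) / |Dχ_Ω|(B_r(y))`
converge, as `r ↓ 0`, to the unit vector `ν`. -/
def IsOutwardNormal (Ω : Set Plane) (y ν : Plane) : Prop :=
  ∃ (μ : Measure Plane) (σ : Plane → Plane), IsGaussGreenPolar Ω μ σ ∧
    (∀ r : ℝ, 0 < r → 0 < μ (Metric.ball y r)) ∧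
    Tendsto (fun r : ℝ => ⨍ x in Metric.ball y r, σ x ∂μ) (𝓝[>] 0) (𝓝 ν) ∧
    ‖ν‖ = 1

/-- The reduced boundary `∂*Ω`. -/
def reducedBoundary (Ω : Set Plane) : Set Plane :=
  {y | ∃ ν, IsOutwardNormal Ω y ν}

open Classical in
/-- The outward unit normal `ν(y)` of `Ω` at a point `y` of the reduced boundary
(and `0` at all other points). -/
def outwardNormal (Ω : Set Plane) (y : Plane) : Plane :=
  if h : ∃ ν, IsOutwardNormal Ω y ν then h.choose else 0

/-- The open half-plane `H₋⁰(ν) = {x : ν ⋅ x < 0}`. -/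
def halfPlane (ν : Plane) : Set Plane := {x | inner ℝ ν x < 0}

/-- The counter-clockwise rotation by 90 degrees, `ν^⊥ = (-ν₂, ν₁)`. -/
def perp (ν : Plane) : Plane := !₂[-ν 1, ν 0]

/-- `R_ν = e₂ ⊗ ν - e₁ ⊗ ν^⊥`; for a unit vector `ν`, the rotation that takes `ν` to `e₂`. -/
def rotate (ν x : Plane) : Plane :=
  inner ℝ ν x • e₂ - inner ℝ (perp ν) x • e₁

/-- `A_λ = λ e₁ ⊗ e₁ + λ² e₂ ⊗ e₂`. -/
def dilate (lam : ℝ) (x : Plane) : Plane :=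
  (lam * inner ℝ e₁ x) • e₁ + (lam ^ 2 * inner ℝ e₂ x) • e₂

/-- The double integral
`∫_Ω ∫_{Ωᶜ} e^{-λα|x-y|} / |x-y| dy dx` of a nonnegative function. -/
def nonlocalTerm (lam α : ℝ) (Ω : Set Plane) : ℝ≥0∞ :=
  ∫⁻ x in Ω, ∫⁻ y in Ωᶜ, ENNReal.ofReal (Real.exp (-(lam * α * ‖x - y‖)) / ‖x - y‖)

/-- The energy
`F_{λ,α}(Ω) = P(Ω) - λ²/(4π) ∫_Ω ∫_{Ωᶜ} e^{-λα|x-y|} / |x-y| dy dx`. -/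
def energy (lam α : ℝ) (Ω : Set Plane) : ℝ :=
  (perimeter Ω).toReal - lam ^ 2 / (4 * Real.pi) * (nonlocalTerm lam α Ω).toReal

/-- `∫_{∂*Ω} ∫_{H₋⁰(ν(y)) Δ λ(Ω - y)} |ν(y) ⋅ z/|z|| e^{-α|z|} / |z| dz dℋ¹(y)`. -/
def boundaryBulk (lam α : ℝ) (Ω : Set Plane) : ℝ≥0∞ :=
  ∫⁻ y in reducedBoundary Ω,
    (∫⁻ z in halfPlane (outwardNormal Ω y) ∆ ((fun x => lam • (x - y)) '' Ω),
      ENNReal.ofReal (|inner ℝ (outwardNormal Ω y) (‖z‖⁻¹ • z)| *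
        (Real.exp (-(α * ‖z‖)) / ‖z‖))) ∂Measure.hausdorffMeasure 1

/-- `∫_{∂*Ω} ∫_{H₋⁰(e₂) Δ A_λ R_{ν(y)}(Ω - y)}
|z₂| e^{-α √(z₁² + z₂²/λ²)} / (z₁² + z₂²/λ²) dz dℋ¹(y)`. -/
def anisotropicBoundaryBulk (lam α : ℝ) (Ω : Set Plane) : ℝ≥0∞ :=
  ∫⁻ y in reducedBoundary Ω,
    (∫⁻ z in halfPlane e₂ ∆
        ((fun x => dilate lam (rotate (outwardNormal Ω y) (x - y))) '' Ω),
      ENNReal.ofReal (|z 1| *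
        (Real.exp (-(α * √((z 0) ^ 2 + (z 1) ^ 2 / lam ^ 2))) /
          ((z 0) ^ 2 + (z 1) ^ 2 / lam ^ 2)))) ∂Measure.hausdorffMeasure 1

end ScreenedPerimeter

end

/-!
Write `κ = λα`. In the variable `h = y - x` the nonlocal term is the integral of the screened kernel
`e^{-κ|h|} / |h|` against `|Ω \ (Ω - h)|`. By the Gauss–Green formula, the derivative of
`t ↦ |Ω \ (Ω - t h)|` is an integral over the boundary, and integrating the kernel along rays turns
the nonlocal term into the integral, with respect to the polar measure `|Dχ_Ω|` with density `σ`,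
of the convolution of `χ_Ω` with `(σ(y) ⋅ z) e^{-κ|z|} / (κ|z|²)`. If `Ω - y` is replaced by the
half-plane `H₋⁰(σ(y))`, this convolution has absolute value `2/κ²`, which accounts for the term
`P(Ω) / (2πα²)`; the error is the integral over the symmetric difference, on all of which it has
the same sign.

It remains to identify `|Dχ_Ω|` with `ℋ¹` on `∂*Ω`. At a point of `∂*Ω` the averages of `σ`
converge to a unit vector `ν`, so the excess of `σ` over `ν` in small balls is small compared with
their `|Dχ_Ω|`-mass. Translating `Ω` along `ν` then bounds the mass of sets of small diameter from
above, and the mass of small balls from below; covering theorems turn these density estimates into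
an equality of measures. The two integral representations follow by the linear changes of variables
`z ↦ λz` and `z ↦ A_λ R_ν z`.
-/

noncomputable section

namespace ScreenedPerimeter

section CharacteristicFunction

variable {X : Type*} {A : Set X}

/-- The real-valued characteristic function of a set. -/
def chi (A : Set X) : X → ℝ := A.indicator 1

theorem chi_of_mem {x : X} (hx : x ∈ A) : chi A x = 1 := Set.indicator_of_mem hx _

theorem chi_of_notMem {x : X} (hx : x ∉ A) : chi A x = 0 := Set.indicator_of_notMem hx _

theorem chi_nonneg (A : Set X) (x : X) : 0 ≤ chi A x :=
  Set.indicator_nonneg (fun _ _ => zero_le_one) x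

theorem chi_le_one (A : Set X) (x : X) : chi A x ≤ 1 :=
  Set.indicator_le_self' (fun _ _ => zero_le_one) x

theorem abs_chi_le_one (A : Set X) (x : X) : |chi A x| ≤ 1 :=
  (abs_of_nonneg (chi_nonneg A x)).trans_le (chi_le_one A x)

variable [MeasurableSpace X] {m : Measure X}

theorem measurable_chi (hA : MeasurableSet A) : Measurable (chi A) :=
  measurable_one.indicator hA

theorem integrable_chi (hA : MeasurableSet A) (hfin : m A < ∞) : Integrable (chi A) m :=
  (integrable_indicator_iff hA).2 (integrableOn_const hfin.ne)

theorem integral_mul_chi (hA : MeasurableSet A) (f : X → ℝ) :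
    ∫ x, f x * chi A x ∂m = ∫ x in A, f x ∂m := by
  rw [← integral_indicator hA]
  congr 1 with x
  by_cases hx : x ∈ A <;> simp [chi, hx]

end CharacteristicFunction

section TestFunction

variable {E : Type*} [NormedAddCommGroup E] [NormedSpace ℝ E] {ψ : E → ℝ}

/-- Test functions: continuously differentiable real functions with compact support. -/
def IsTestFunction (ψ : E → ℝ) : Prop := ContDiff ℝ 1 ψ ∧ HasCompactSupport ψ

namespace IsTestFunction

theorem continuous (hψ : IsTestFunction ψ) : Continuous ψ := hψ.1.continuous

theorem differentiable (hψ : IsTestFunction ψ) : Differentiable ℝ ψ :=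
  hψ.1.differentiable one_ne_zero

theorem continuous_fderiv (hψ : IsTestFunction ψ) : Continuous (fderiv ℝ ψ) :=
  hψ.1.continuous_fderiv one_ne_zero

theorem integrable [MeasurableSpace E] [BorelSpace E] {m : Measure E}
    [IsFiniteMeasureOnCompacts m] (hψ : IsTestFunction ψ) : Integrable ψ m :=
  hψ.continuous.integrable_of_hasCompactSupport hψ.2

theorem translate (hψ : IsTestFunction ψ) (h : E) : IsTestFunction fun x => ψ (x - h) :=
  ⟨hψ.1.comp (contDiff_id.sub contDiff_const), hψ.2.comp_homeomorph (Homeomorph.subRight h)⟩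

theorem continuous_fderiv_translate (hψ : IsTestFunction ψ) (h : E) :
    Continuous fun p : ℝ × E => fderiv ℝ ψ (p.2 - p.1 • h) h :=
  (hψ.continuous_fderiv.comp (by fun_prop)).clm_apply continuous_const

theorem integrable_fderiv [MeasurableSpace E] [BorelSpace E] {m : Measure E}
    [IsFiniteMeasureOnCompacts m] (hψ : IsTestFunction ψ) (v : E) :
    Integrable (fun x => fderiv ℝ ψ x v) m :=
  (hψ.continuous_fderiv.clm_apply continuous_const).integrable_of_hasCompactSupport
    (hψ.2.fderiv_apply ℝ v)

theorem integral_fderiv_eq_zero [FiniteDimensional ℝ E] [MeasurableSpace E] [BorelSpace E]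
    {m : Measure E} [m.IsAddHaarMeasure] (hψ : IsTestFunction ψ) (v : E) :
    ∫ x, fderiv ℝ ψ x v ∂m = 0 := by
  simpa using integral_mul_fderiv_eq_neg_fderiv_mul_of_integrable (μ := m) (v := v)
    (f := fun _ => (1 : ℝ)) (g := ψ) (by simp) (by simpa using hψ.integrable_fderiv v)
    (by simpa using hψ.integrable) (by simp) fun x _ => hψ.differentiable x

theorem hasDerivAt_translate (hψ : IsTestFunction ψ) (x h : E) (t : ℝ) :
    HasDerivAt (fun t : ℝ => ψ (x - t • h)) (-fderiv ℝ ψ (x - t • h) h) t := by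
  have hline : HasDerivAt (fun t : ℝ => x - t • h) (-h) t := by
    simpa using ((hasDerivAt_id t).smul_const h).const_sub x
  rw [← map_neg]
  exact (hψ.differentiable (x - t • h)).hasFDerivAt.comp_hasDerivAt t hline

theorem sub_translate_eq_integral (hψ : IsTestFunction ψ) (x h : E) :
    ψ (x - h) - ψ x = -∫ t in (0 : ℝ)..1, fderiv ℝ ψ (x - t • h) h := by
  have hint : IntervalIntegrable (fun t : ℝ => -fderiv ℝ ψ (x - t • h) h) volume 0 1 :=
    ((hψ.continuous_fderiv_translate h).comp
      (Continuous.prodMk_left x)).neg.intervalIntegrable _ _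
  rw [← intervalIntegral.integral_neg, intervalIntegral.integral_eq_sub_of_hasDerivAt
    (fun t _ => hψ.hasDerivAt_translate x h t) hint, one_smul, zero_smul, sub_zero]

variable [MeasurableSpace E] [BorelSpace E] [SecondCountableTopology E] {m : Measure E}
  [IsFiniteMeasureOnCompacts m] [SFinite m]

theorem integrable_fderiv_translate (hψ : IsTestFunction ψ) (A : Set E) (h : E) :
    Integrable (Function.uncurry fun (t : ℝ) (x : E) => fderiv ℝ ψ (x - t • h) h)
      ((volume.restrict (Set.uIoc 0 1)).prod (m.restrict A)) := by
  set K : Set E := (fun p : ℝ × E => p.2 + p.1 • h) '' (Set.Icc 0 1 ×ˢ tsupport ψ)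
  have hKc : IsCompact K :=
    (isCompact_Icc.prod hψ.2.isCompact).image (by fun_prop)
  have hzero : ∀ p ∈ (Set.uIoc (0 : ℝ) 1 ×ˢ (Set.univ : Set E)) \ (Set.Icc 0 1 ×ˢ K),
      fderiv ℝ ψ (p.2 - p.1 • h) h = 0 := by
    rintro ⟨t, x⟩ ⟨⟨ht, -⟩, hp⟩
    rw [Set.uIoc_of_le zero_le_one] at ht
    have hx : x - t • h ∉ tsupport ψ := fun hx =>
      hp ⟨⟨ht.1.le, ht.2⟩, (t, x - t • h), ⟨⟨ht.1.le, ht.2⟩, hx⟩, sub_add_cancel _ _⟩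
    rw [fderiv_of_notMem_tsupport ℝ hx, zero_apply]
  have hint : IntegrableOn (fun p : ℝ × E => fderiv ℝ ψ (p.2 - p.1 • h) h)
      (Set.uIoc (0 : ℝ) 1 ×ˢ Set.univ) (volume.prod m) :=
    ((hψ.continuous_fderiv_translate h).continuousOn.integrableOn_compact
      (isCompact_Icc.prod hKc)).of_forall_sdiff_eq_zero
      (measurableSet_uIoc.prod MeasurableSet.univ) hzero
  rw [Measure.prod_restrict]
  exact hint.mono_set (Set.prod_mono_right (Set.subset_univ A))

theorem setIntegral_sub_translate (hψ : IsTestFunction ψ) (A : Set E) (h : E) :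
    ∫ x in A, (ψ (x - h) - ψ x) ∂m =
      -∫ t in (0 : ℝ)..1, ∫ x in A, fderiv ℝ ψ (x - t • h) h ∂m := by
  rw [intervalIntegral_integral_swap (hψ.integrable_fderiv_translate A h), ← integral_neg]
  simp only [hψ.sub_translate_eq_integral]

theorem integral_mul_chi_sub_chi [m.IsAddRightInvariant] (hψ : IsTestFunction ψ) {A : Set E}
    (hA : MeasurableSet A) (h : E) :
    ∫ x, ψ x * (chi A (x + h) - chi A x) ∂m =
      -∫ t in (0 : ℝ)..1, ∫ x in A, fderiv ℝ ψ (x - t • h) h ∂m := by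
  have hi : ∀ k : E, Integrable (fun x => ψ x * chi A (x + k)) m := fun k =>
    hψ.integrable.mul_bdd (c := 1)
      ((measurable_chi hA).comp (measurable_id.add_const k)).aestronglyMeasurable
      (Eventually.of_forall fun x => abs_chi_le_one _ _)
  have hshift : ∫ x, ψ x * chi A (x + h) ∂m = ∫ x in A, ψ (x - h) ∂m := by
    rw [← integral_mul_chi hA, ← integral_add_right_eq_self (fun x => ψ (x - h) * chi A x) h]
    simp only [add_sub_cancel_right]
  have h0 : Integrable (fun x => ψ x * chi A x) m := by simpa only [add_zero] using hi 0
  simp_rw [mul_sub]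
  rw [integral_sub (hi h) h0, hshift, integral_mul_chi hA, ← hψ.setIntegral_sub_translate,
    integral_sub (hψ.translate h).integrable.integrableOn hψ.integrable.integrableOn]

end IsTestFunction

end TestFunction

section Mollification

variable {E : Type*} [NormedAddCommGroup E] [InnerProductSpace ℝ E] [FiniteDimensional ℝ E]

/-- The bump function supported in the ball of radius `1 / (n + 1)` used for mollifying. -/
def mollifier (E : Type*) [NormedAddCommGroup E] (n : ℕ) : ContDiffBump (0 : E) where
  rIn := 1 / ((n : ℝ) + 1) / 2
  rOut := 1 / ((n : ℝ) + 1)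
  rIn_pos := by positivity
  rIn_lt_rOut := half_lt_self (by positivity)

/-- The bump function equal to `1` on the ball of radius `n + 1` used for truncating. -/
def cutoff (E : Type*) [NormedAddCommGroup E] (n : ℕ) : ContDiffBump (0 : E) where
  rIn := n + 1
  rOut := n + 2
  rIn_pos := by positivity
  rIn_lt_rOut := by linarith

theorem cutoff_eq_one {n : ℕ} {x : E} (hx : ‖x‖ ≤ n + 1) : cutoff E n x = 1 :=
  (cutoff E n).one_of_mem_closedBall (mem_closedBall_zero_iff.2 hx)

variable [MeasurableSpace E] [BorelSpace E] {g : E → ℝ} {M : ℝ}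

/-- The `n`-th smooth approximation of `g`: a mollification of `g` at scale `1 / (n + 1)`,
truncated to a ball of radius `n + 2`. -/
def mollification (g : E → ℝ) (n : ℕ) (x : E) : ℝ :=
  cutoff E n x * convolution ((mollifier E n).normed volume) g (.lsmul ℝ ℝ) volume x

theorem dist_convolution_mollifier_le (hg : Measurable g) {n : ℕ} {x : E} {c ε : ℝ} (hε : 0 ≤ ε)
    (hc : ∀ z ∈ Metric.ball x (1 / ((n : ℝ) + 1)), dist (g z) c ≤ ε) :
    dist (convolution ((mollifier E n).normed volume) g (.lsmul ℝ ℝ) volume x) c ≤ ε :=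
  dist_convolution_le hε (mollifier E n).support_normed_eq.subset (mollifier E n).nonneg_normed
    (mollifier E n).integral_normed hg.aestronglyMeasurable hc

theorem locallyIntegrable_of_abs_le (hg : Measurable g) (hM : ∀ x, |g x| ≤ M) :
    LocallyIntegrable g :=
  (locallyIntegrable_const M).mono hg.aestronglyMeasurable <| Eventually.of_forall fun x =>
    (hM x).trans (le_abs_self M)

theorem isTestFunction_mollification (hg : Measurable g) (hM : ∀ x, |g x| ≤ M) (n : ℕ) :
    IsTestFunction (mollification g n) :=
  ⟨(cutoff E n).contDiff.mul <| HasCompactSupport.contDiff_convolution_left _ (n := 1)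
      (mollifier E n).hasCompactSupport_normed (mollifier E n).contDiff_normed
      (locallyIntegrable_of_abs_le hg hM),
    (cutoff E n).hasCompactSupport.mul_right⟩

theorem abs_mollification_le (hg : Measurable g) (hM : ∀ x, |g x| ≤ M) (n : ℕ) (x : E) :
    |mollification g n x| ≤ M := by
  have hconv := dist_convolution_mollifier_le (n := n) (x := x) (c := 0) hg
    ((abs_nonneg _).trans (hM 0)) fun z _ => by simpa using hM z
  rw [dist_zero_right, Real.norm_eq_abs] at hconv
  rw [mollification, abs_mul, abs_of_nonneg (cutoff E n).nonneg]
  exact (mul_le_of_le_one_left (abs_nonneg _) (cutoff E n).le_one).trans hconv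

theorem mollification_nonneg (h0 : ∀ x, 0 ≤ g x) (n : ℕ) (x : E) : 0 ≤ mollification g n x :=
  mul_nonneg (cutoff E n).nonneg <|
    integral_nonneg fun z => mul_nonneg ((mollifier E n).nonneg_normed z) (h0 _)

theorem mollification_eq_zero (hg : Measurable g) {n : ℕ} {x : E}
    (h0 : ∀ z ∈ Metric.ball x (1 / ((n : ℝ) + 1)), g z = 0) : mollification g n x = 0 := by
  have hconv := dist_le_zero.1 <| dist_convolution_mollifier_le (n := n) (x := x) (c := 0) hg
    le_rfl fun z hz => by simp [h0 z hz]
  rw [mollification, hconv, mul_zero]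

theorem mollification_eq_const (hg : Measurable g) {n : ℕ} {x : E} {c : ℝ} (hx : ‖x‖ ≤ n + 1)
    (hc : ∀ z ∈ Metric.ball x (1 / ((n : ℝ) + 1)), g z = c) : mollification g n x = c := by
  have hconv := dist_le_zero.1 <| dist_convolution_mollifier_le (n := n) (x := x) (c := c) hg
    le_rfl fun z hz => by simp [hc z hz]
  rw [mollification, hconv, cutoff_eq_one hx, one_mul]

theorem ae_tendsto_mollification (hg : Measurable g) (hM : ∀ x, |g x| ≤ M) :
    ∀ᵐ x : E, Tendsto (fun n => mollification g n x) atTop (𝓝 (g x)) := by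
  filter_upwards [ContDiffBump.ae_convolution_tendsto_right_of_locallyIntegrable
    (μ := (volume : Measure E)) (φ := mollifier E) (l := atTop) (K := 2)
    tendsto_one_div_add_atTop_nhds_zero_nat
    (Eventually.of_forall fun n => by simp only [mollifier]; linarith)
    (locallyIntegrable_of_abs_le hg hM)] with x hx
  refine hx.congr' ?_
  filter_upwards [eventually_ge_atTop ⌈‖x‖⌉₊] with n hn
  have hxn : ‖x‖ ≤ n := (Nat.le_ceil _).trans (Nat.cast_le.2 hn)
  rw [mollification, cutoff_eq_one (hxn.trans (by linarith)), one_mul]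

theorem tendsto_integral_mollification_mul (hg : Measurable g) (hM : ∀ x, |g x| ≤ M) {f : E → ℝ}
    (hf : Integrable f) :
    Tendsto (fun n => ∫ x, mollification g n x * f x) atTop (𝓝 (∫ x, g x * f x)) := by
  refine tendsto_integral_of_dominated_convergence (fun x => M * ‖f x‖)
    (fun n => (isTestFunction_mollification hg hM n).continuous.aestronglyMeasurable.mul
      hf.aestronglyMeasurable) (hf.norm.const_mul M)
    (fun n => Eventually.of_forall fun x => ?_) ?_
  · rw [norm_mul]
    exact mul_le_mul_of_nonneg_right (abs_mollification_le hg hM n x) (norm_nonneg _)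
  · filter_upwards [ae_tendsto_mollification hg hM] with x hx using hx.mul_const _

theorem tendsto_integral_mollification_chi_mul {A : Set E} (hA : MeasurableSet A)
    (hAb : Bornology.IsBounded A) {f : E → ℝ} (hf : LocallyIntegrable f) :
    Tendsto (fun n => ∫ x, mollification (chi A) n x * f x) atTop (𝓝 (∫ x in A, f x)) := by
  obtain ⟨R, hR⟩ := hAb.subset_ball 0
  set B : Set E := Metric.closedBall 0 (R + 1)
  have hB : MeasurableSet B := Metric.isClosed_closedBall.measurableSet
  have hoff : ∀ (n : ℕ), ∀ x ∉ B, mollification (chi A) n x = 0 := fun n x hx =>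
    mollification_eq_zero (measurable_chi hA) fun z hz => chi_of_notMem fun hzA => hx <| by
      have hn : 1 / ((n : ℝ) + 1) ≤ 1 := div_le_one_of_le₀ (by simp) (by positivity)
      exact (dist_triangle_left x 0 z).trans
        (by linarith [Metric.mem_ball.1 hz, Metric.mem_ball.1 (hR hzA)])
  have hAB : A ⊆ B := hR.trans <|
    Metric.ball_subset_closedBall.trans (Metric.closedBall_subset_closedBall (by linarith))
  have hlim := tendsto_integral_mollification_mul (measurable_chi hA) (abs_chi_le_one A)
    ((integrable_indicator_iff hB).2 (hf.integrableOn_isCompact (isCompact_closedBall 0 (R + 1))))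
  convert hlim using 2
  · refine integral_congr_ae <| Eventually.of_forall fun x => ?_
    by_cases hx : x ∈ B
    · simp only [Set.indicator_of_mem hx]
    · simp only [hoff _ x hx, zero_mul]
  · rw [← integral_mul_chi hA]
    refine integral_congr_ae <| Eventually.of_forall fun x => ?_
    by_cases hx : x ∈ A
    · simp only [Set.indicator_of_mem (hAB hx), mul_comm]
    · simp only [chi_of_notMem hx, mul_zero, zero_mul]

end Mollification

section TestField

variable {T : Plane → Plane}

theorem smul_e₁_add_smul_e₂ (h : Plane) : h 0 • e₁ + h 1 • e₂ = h := by
  ext i; fin_cases i <;> simp [e₁, e₂]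

theorem divergence_smul_const {ψ : Plane → ℝ} (hψ : Differentiable ℝ ψ) (h x : Plane) :
    divergence (fun x => ψ x • h) x = fderiv ℝ ψ x h := by
  rw [divergence, ((hψ x).hasFDerivAt.smul_const h).fderiv]
  conv_rhs => rw [← smul_e₁_add_smul_e₂ h, map_add, map_smul, map_smul]
  simp only [ContinuousLinearMap.smulRight_apply, PiLp.smul_apply, smul_eq_mul]
  ring

theorem IsTestFunction.isTestField_smul_const {ψ : Plane → ℝ} (hψ : IsTestFunction ψ)
    (h : Plane) : IsTestField fun x => ψ x • h :=
  ⟨hψ.1.smul contDiff_const, hψ.2.smul_right⟩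

namespace IsTestField

theorem coord (hT : IsTestField T) (i : Fin 2) : IsTestFunction fun x => T x i :=
  ⟨(EuclideanSpace.proj (𝕜 := ℝ) i).contDiff.comp hT.1,
    hT.2.comp_left (g := fun y : Plane => y i) rfl⟩

theorem const_smul (hT : IsTestField T) (c : ℝ) : IsTestField (c • T) :=
  ⟨contDiff_const.smul hT.1, hT.2.smul_left (f := fun _ => c)⟩

theorem fderiv_coord (hT : IsTestField T) (i : Fin 2) (x v : Plane) :
    fderiv ℝ (fun x => T x i) x v = (fderiv ℝ T x v) i := by
  have hcomp := (EuclideanSpace.proj (𝕜 := ℝ) i : Plane →L[ℝ] ℝ).hasFDerivAt.comp x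
    (hT.1.differentiable one_ne_zero x).hasFDerivAt
  exact DFunLike.congr_fun hcomp.fderiv v

theorem divergence_eq (hT : IsTestField T) :
    divergence T = fun x => fderiv ℝ (fun x => T x 0) x e₁ + fderiv ℝ (fun x => T x 1) x e₂ := by
  simp only [hT.fderiv_coord]
  rfl

theorem integrable_divergence (hT : IsTestField T) : Integrable (divergence T) := by
  rw [hT.divergence_eq]
  exact ((hT.coord 0).integrable_fderiv e₁).add ((hT.coord 1).integrable_fderiv e₂)

theorem integral_divergence_eq_zero (hT : IsTestField T) : ∫ x, divergence T x = 0 := by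
  rw [hT.divergence_eq, integral_add ((hT.coord 0).integrable_fderiv e₁)
    ((hT.coord 1).integrable_fderiv e₂), (hT.coord 0).integral_fderiv_eq_zero,
    (hT.coord 1).integral_fderiv_eq_zero, add_zero]

theorem divergence_const_smul (hT : IsTestField T) (c : ℝ) (x : Plane) :
    divergence (c • T) x = c * divergence T x := by
  simp only [divergence, fderiv_const_smul (hT.1.differentiable one_ne_zero x),
    smul_apply, PiLp.smul_apply, smul_eq_mul]
  ring

theorem setIntegral_divergence_le {Ω : Set Plane} (hT : IsTestField T) (hP : perimeter Ω < ∞)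
    {C : ℝ} (hC : ∀ x, ‖T x‖ ≤ C) : ∫ x in Ω, divergence T x ≤ C * (perimeter Ω).toReal := by
  rcases ((norm_nonneg _).trans (hC 0)).eq_or_lt with rfl | hpos
  · have hT0 : T = 0 := funext fun x => norm_le_zero_iff.1 (hC x)
    simp [hT0, divergence]
  have hunit : ∀ x, ‖(C⁻¹ • T) x‖ ≤ 1 := fun x => by
    rw [Pi.smul_apply, norm_smul, norm_inv, Real.norm_of_nonneg hpos.le, inv_mul_le_iff₀ hpos,
      mul_one]
    exact hC x
  have hle : ENNReal.ofReal (∫ x in Ω, divergence (C⁻¹ • T) x) ≤ perimeter Ω :=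
    le_iSup₂_of_le (f := fun T _ => ENNReal.ofReal (∫ x in Ω, divergence T x)) (C⁻¹ • T)
      ⟨hT.const_smul C⁻¹, hunit⟩ le_rfl
  rw [ENNReal.ofReal_le_iff_le_toReal hP.ne] at hle
  simp only [hT.divergence_const_smul] at hle
  rwa [integral_const_mul, inv_mul_le_iff₀ hpos] at hle

end IsTestField

end TestField

section FinitePerimeter

variable {Ω : Set Plane} {M : ℝ}

theorem IsTestFunction.abs_setIntegral_fderiv_le {ψ : Plane → ℝ} (hψ : IsTestFunction ψ)
    (hP : perimeter Ω < ∞) (hM : ∀ x, |ψ x| ≤ M) (h : Plane) :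
    |∫ x in Ω, fderiv ℝ ψ x h| ≤ M * ‖h‖ * (perimeter Ω).toReal := by
  have hle : ∀ k : Plane, ∫ x in Ω, fderiv ℝ ψ x k ≤ M * ‖k‖ * (perimeter Ω).toReal := fun k => by
    simp_rw [← divergence_smul_const hψ.differentiable k]
    refine (hψ.isTestField_smul_const k).setIntegral_divergence_le hP fun x => ?_
    rw [norm_smul]
    exact mul_le_mul_of_nonneg_right (hM x) (norm_nonneg k)
  have hneg := hle (-h)
  simp only [map_neg, integral_neg, norm_neg] at hneg
  exact abs_le'.2 ⟨hle h, hneg⟩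

theorem IsTestFunction.abs_integral_mul_chi_sub_chi_le {ψ : Plane → ℝ} (hψ : IsTestFunction ψ)
    (hΩ : MeasurableSet Ω) (hP : perimeter Ω < ∞) (hM : ∀ x, |ψ x| ≤ M) (h : Plane) :
    |∫ x, ψ x * (chi Ω (x + h) - chi Ω x)| ≤ M * ‖h‖ * (perimeter Ω).toReal := by
  rw [hψ.integral_mul_chi_sub_chi hΩ, abs_neg, ← Real.norm_eq_abs]
  refine (intervalIntegral.norm_integral_le_of_norm_le_const
    (C := M * ‖h‖ * (perimeter Ω).toReal) fun t _ => ?_).trans (by simp)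
  simpa only [fderiv_comp_sub, Real.norm_eq_abs] using
    (hψ.translate (t • h)).abs_setIntegral_fderiv_le hP (fun x => hM _) h

theorem integrable_chi_sub_chi (hΩ : MeasurableSet Ω) (hfin : volume Ω < ∞) (h : Plane) :
    Integrable fun x => chi Ω (x + h) - chi Ω x :=
  ((integrable_chi hΩ hfin).comp_add_right h).sub (integrable_chi hΩ hfin)

theorem abs_integral_mul_chi_sub_chi_le (hΩ : MeasurableSet Ω) (hfin : volume Ω < ∞)
    (hP : perimeter Ω < ∞) {g : Plane → ℝ} (hg : Measurable g) (hM : ∀ x, |g x| ≤ M) (h : Plane) :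
    |∫ x, g x * (chi Ω (x + h) - chi Ω x)| ≤ M * ‖h‖ * (perimeter Ω).toReal :=
  le_of_tendsto
    (tendsto_integral_mollification_mul hg hM (integrable_chi_sub_chi hΩ hfin h)).abs
    (Eventually.of_forall fun n =>
      (isTestFunction_mollification hg hM n).abs_integral_mul_chi_sub_chi_le hΩ hP
        (abs_mollification_le hg hM n) h)

end FinitePerimeter

/-- The excess of the vector field `σ` over the constant `ν` in the region `U`: the `L¹` distance
of the two with respect to `μ`. -/
def excess (μ : Measure Plane) (σ : Plane → Plane) (ν : Plane) (U : Set Plane) : ℝ :=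
  ∫ x in U, ‖σ x - ν‖ ∂μ

namespace IsGaussGreenPolar

variable {Ω : Set Plane} {μ : Measure Plane} {σ : Plane → Plane}

theorem isLocallyFiniteMeasure (hpol : IsGaussGreenPolar Ω μ σ) : IsLocallyFiniteMeasure μ :=
  hpol.1

theorem measurable (hpol : IsGaussGreenPolar Ω μ σ) : Measurable σ := hpol.2.1

theorem ae_norm_eq_one (hpol : IsGaussGreenPolar Ω μ σ) : ∀ᵐ x ∂μ, ‖σ x‖ = 1 := hpol.2.2.1

theorem setIntegral_divergence (hpol : IsGaussGreenPolar Ω μ σ) {T : Plane → Plane}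
    (hT : IsTestField T) : ∫ x in Ω, divergence T x = ∫ x, inner ℝ (T x) (σ x) ∂μ :=
  hpol.2.2.2 T hT

theorem compl (hpol : IsGaussGreenPolar Ω μ σ) (hΩ : NullMeasurableSet Ω) :
    IsGaussGreenPolar Ωᶜ μ fun x => -σ x := by
  refine ⟨hpol.isLocallyFiniteMeasure, hpol.measurable.neg,
    by simpa only [norm_neg] using hpol.ae_norm_eq_one, fun T hT => ?_⟩
  have hsum := integral_add_compl₀ hΩ hT.integrable_divergence
  rw [hT.integral_divergence_eq_zero, hpol.setIntegral_divergence hT] at hsum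
  simp_rw [inner_neg_right, integral_neg]
  linarith

theorem setIntegral_fderiv (hpol : IsGaussGreenPolar Ω μ σ) {ψ : Plane → ℝ}
    (hψ : IsTestFunction ψ) (h : Plane) :
    ∫ x in Ω, fderiv ℝ ψ x h = ∫ x, ψ x * inner ℝ h (σ x) ∂μ := by
  simpa only [divergence_smul_const hψ.differentiable, real_inner_smul_left] using
    hpol.setIntegral_divergence (hψ.isTestField_smul_const h)

theorem setIntegral_fderiv_translate (hpol : IsGaussGreenPolar Ω μ σ) {ψ : Plane → ℝ}
    (hψ : IsTestFunction ψ) (h k : Plane) :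
    ∫ x in Ω, fderiv ℝ ψ (x - k) h = ∫ x, ψ (x - k) * inner ℝ h (σ x) ∂μ := by
  simpa only [fderiv_comp_sub] using hpol.setIntegral_fderiv (hψ.translate k) h

theorem integral_mul_chi_sub_chi (hpol : IsGaussGreenPolar Ω μ σ) (hΩ : MeasurableSet Ω)
    {ψ : Plane → ℝ} (hψ : IsTestFunction ψ) (h : Plane) :
    ∫ x, ψ x * (chi Ω (x + h) - chi Ω x) =
      -∫ t in (0 : ℝ)..1, ∫ x, ψ (x - t • h) * inner ℝ h (σ x) ∂μ := by
  simp only [hψ.integral_mul_chi_sub_chi hΩ, hpol.setIntegral_fderiv_translate hψ]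

theorem neg_integral_mul_chi_sub_chi_mem_Icc (hpol : IsGaussGreenPolar Ω μ σ)
    (hΩ : MeasurableSet Ω) {ψ : Plane → ℝ} (hψ : IsTestFunction ψ) (h : Plane) {a b : ℝ}
    (hab : ∀ t ∈ Set.Icc (0 : ℝ) 1, ∫ x, ψ (x - t • h) * inner ℝ h (σ x) ∂μ ∈ Set.Icc a b) :
    -∫ x, ψ x * (chi Ω (x + h) - chi Ω x) ∈ Set.Icc a b := by
  have hint : IntervalIntegrable (fun t : ℝ => ∫ x, ψ (x - t • h) * inner ℝ h (σ x) ∂μ)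
      volume 0 1 := by
    simp only [intervalIntegrable_iff, ← hpol.setIntegral_fderiv_translate hψ]
    exact (hψ.integrable_fderiv_translate Ω h).integral_prod_left
  rw [hpol.integral_mul_chi_sub_chi hΩ hψ, neg_neg]
  constructor
  · simpa using intervalIntegral.integral_mono_on zero_le_one
      (intervalIntegrable_const (c := a)) hint fun t ht => (hab t ht).1
  · simpa using intervalIntegral.integral_mono_on zero_le_one hint
      (intervalIntegrable_const (c := b)) fun t ht => (hab t ht).2

theorem integrableOn_norm_sub (hpol : IsGaussGreenPolar Ω μ σ) {U : Set Plane} (hU : μ U < ∞)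
    (ν : Plane) : IntegrableOn (fun x => ‖σ x - ν‖) U μ := by
  have : IsFiniteMeasure (μ.restrict U) := ⟨by simpa using hU⟩
  refine Integrable.of_bound (C := 1 + ‖ν‖)
    (hpol.measurable.sub_const ν).norm.aestronglyMeasurable ?_
  filter_upwards [ae_restrict_of_ae hpol.ae_norm_eq_one] with x hx
  rw [norm_norm, ← hx]
  exact norm_sub_le _ _

theorem integrable_mul_inner (hpol : IsGaussGreenPolar Ω μ σ) {f : Plane → ℝ}
    (hf : Integrable f μ) (h : Plane) : Integrable (fun x => f x * inner ℝ h (σ x)) μ := by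
  refine hf.mul_bdd (c := ‖h‖) (measurable_const.inner hpol.measurable).aestronglyMeasurable ?_
  filter_upwards [hpol.ae_norm_eq_one] with x hx
  simpa only [hx, mul_one] using norm_inner_le_norm (𝕜 := ℝ) h (σ x)

end IsGaussGreenPolar

theorem excess_nonneg (μ : Measure Plane) (σ : Plane → Plane) (ν : Plane) (U : Set Plane) :
    0 ≤ excess μ σ ν U :=
  integral_nonneg fun _ => norm_nonneg _

theorem IsGaussGreenPolar.excess_mono {Ω : Set Plane} {μ : Measure Plane} {σ : Plane → Plane}
    (hpol : IsGaussGreenPolar Ω μ σ) (ν : Plane) {U V : Set Plane} (hUV : U ⊆ V) (hV : μ V < ∞) :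
    excess μ σ ν U ≤ excess μ σ ν V :=
  setIntegral_mono_set (hpol.integrableOn_norm_sub hV ν)
    (Eventually.of_forall fun _ => norm_nonneg _) hUV.eventuallyLE

theorem volume_real_ball (x : Plane) {r : ℝ} (hr : 0 ≤ r) :
    volume.real (Metric.ball x r) = r ^ 2 * Real.pi := by
  rw [measureReal_def, EuclideanSpace.volume_ball_fin_two, ENNReal.toReal_mul, ENNReal.toReal_pow,
    ENNReal.toReal_ofReal hr, ENNReal.toReal_ofReal Real.pi_pos.le]

theorem measure_inter_lt_top_of_right {X : Type*} [MeasurableSpace X] {m : Measure X} {B : Set X}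
    (A : Set X) (hB : m B < ∞) : m (A ∩ B) < ∞ :=
  (measure_mono Set.inter_subset_right).trans_lt hB

theorem setIntegral_chi_sub_chi {E : Type*} [NormedAddCommGroup E] [MeasurableSpace E]
    [BorelSpace E] {m : Measure E} {A B : Set E} (hB : MeasurableSet B) (hA : m A < ∞) (h : E) :
    ∫ x in A, (chi B (x + h) - chi B x) ∂m =
      m.real (A ∩ (· + h) ⁻¹' B) - m.real (A ∩ B) := by
  have hshift : MeasurableSet ((· + h) ⁻¹' B) := (measurable_add_const h) hB
  have hfin : ∀ s, m.restrict A s < ∞ := fun s =>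
    (measure_mono (Set.subset_univ s)).trans_lt (by simpa using hA)
  have hint : ∀ {s : Set E}, MeasurableSet s → ∫ x in A, chi s x ∂m = m.real (A ∩ s) :=
    fun {s} hs => by
      rw [chi, integral_indicator_one hs, measureReal_restrict_apply hs, Set.inter_comm]
  rw [← hint hshift, ← hint hB]
  exact integral_sub (integrable_chi hshift (hfin _)) (integrable_chi hB (hfin _))

theorem norm_smul_le_of_mem_Icc {E : Type*} [NormedAddCommGroup E] [NormedSpace ℝ E] {t : ℝ}
    (ht : t ∈ Set.Icc (0 : ℝ) 1) (h : E) : ‖t • h‖ ≤ ‖h‖ := by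
  rw [norm_smul, Real.norm_of_nonneg ht.1]
  exact mul_le_of_le_one_left (norm_nonneg h) ht.2

theorem inner_sub_norm_mul_norm_sub_le_inner {E : Type*} [NormedAddCommGroup E]
    [InnerProductSpace ℝ E] (h ν s : E) : inner ℝ h ν - ‖h‖ * ‖s - ν‖ ≤ inner ℝ h s := by
  have hcs := neg_le_of_abs_le (abs_real_inner_le_norm h (s - ν))
  rw [inner_sub_right] at hcs
  linarith

namespace IsGaussGreenPolar

variable {Ω : Set Plane} {μ : Measure Plane} {σ : Plane → Plane} {y ν : Plane}

theorem measure_ball_lt_top (hpol : IsGaussGreenPolar Ω μ σ) (x : Plane) (r : ℝ) :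
    μ (Metric.ball x r) < ∞ :=
  have := hpol.isLocallyFiniteMeasure
  MeasureTheory.measure_ball_lt_top

theorem excess_ball_mono (hpol : IsGaussGreenPolar Ω μ σ) {s t : ℝ} (hst : s ≤ t) :
    excess μ σ ν (Metric.ball y s) ≤ excess μ σ ν (Metric.ball y t) :=
  hpol.excess_mono ν (Metric.ball_subset_ball hst) (hpol.measure_ball_lt_top y t)

theorem measureReal_ball_mono (hpol : IsGaussGreenPolar Ω μ σ) {s t : ℝ} (hst : s ≤ t) :
    μ.real (Metric.ball y s) ≤ μ.real (Metric.ball y t) :=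
  measureReal_mono (Metric.ball_subset_ball hst) (hpol.measure_ball_lt_top y t).ne

theorem integral_mul_inner_mem_Icc (hpol : IsGaussGreenPolar Ω μ σ) {U V : Set Plane}
    (hU : MeasurableSet U) (hUμ : μ U < ∞) (hV : MeasurableSet V) {φ : Plane → ℝ}
    (hφ : IsTestFunction φ) (h01 : ∀ x, φ x ∈ Set.Icc (0 : ℝ) 1) (hφU : ∀ x ∉ U, φ x = 0)
    (hφV : ∀ x ∈ V, φ x = 1) {h : Plane} (hν : 0 ≤ inner ℝ h ν) :
    ∫ x, φ x * inner ℝ h (σ x) ∂μ ∈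
      Set.Icc (inner ℝ h ν * μ.real V - ‖h‖ * excess μ σ ν U) (‖h‖ * μ.real U) := by
  have := hpol.isLocallyFiniteMeasure
  have hVU : V ⊆ U := fun x hx => by
    by_contra hxU
    exact zero_ne_one ((hφU x hxU).symm.trans (hφV x hx))
  have hVμ : μ V < ∞ := (measure_mono hVU).trans_lt hUμ
  have hφi := hpol.integrable_mul_inner (hφ.integrable (m := μ)) h
  have hVi : Integrable (fun x => V.indicator (fun _ => inner ℝ h ν) x) μ :=
    (integrable_indicator_iff hV).2 (integrableOn_const hVμ.ne)
  have hUi : Integrable (fun x => U.indicator (fun x => ‖h‖ * ‖σ x - ν‖) x) μ :=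
    (integrable_indicator_iff hU).2 ((hpol.integrableOn_norm_sub hUμ ν).const_mul _)
  have hlower : ∫ x, (V.indicator (fun _ => inner ℝ h ν) x -
      U.indicator (fun x => ‖h‖ * ‖σ x - ν‖) x) ∂μ ≤ ∫ x, φ x * inner ℝ h (σ x) ∂μ := by
    refine integral_mono (hVi.sub hUi) hφi fun x => ?_
    have hinner := inner_sub_norm_mul_norm_sub_le_inner h ν (σ x)
    have hnn : 0 ≤ ‖h‖ * ‖σ x - ν‖ := by positivity
    by_cases hxV : x ∈ V
    · simpa [hxV, hVU hxV, hφV x hxV] using hinner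
    by_cases hxU : x ∈ U
    · simp only [Set.indicator_of_notMem hxV, Set.indicator_of_mem hxU]
      nlinarith [(h01 x).1, (h01 x).2]
    · simp [hxV, hxU, hφU x hxU]
  have hupper : ∫ x, φ x * inner ℝ h (σ x) ∂μ ≤ ∫ x, U.indicator (fun _ => ‖h‖) x ∂μ := by
    refine integral_mono_ae hφi
      ((integrable_indicator_iff hU).2 (integrableOn_const hUμ.ne)) ?_
    filter_upwards [hpol.ae_norm_eq_one] with x hx
    have hinner := real_inner_le_norm h (σ x)
    rw [hx, mul_one] at hinner
    by_cases hxU : x ∈ U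
    · simp only [Set.indicator_of_mem hxU]
      nlinarith [(h01 x).1, (h01 x).2, norm_nonneg h]
    · simp [hxU, hφU x hxU]
  rw [integral_sub hVi hUi, integral_indicator hV, integral_indicator hU, setIntegral_const,
    integral_const_mul, smul_eq_mul, mul_comm (μ.real V)] at hlower
  rw [integral_indicator hU, setIntegral_const, smul_eq_mul, mul_comm (μ.real U)] at hupper
  exact ⟨hlower, hupper⟩

/-- The derivative of `t ↦ |A ∩ (Ω - t h)|` is a flux of `-h` through the part of the boundary
near `A + t h`; it is compared with the flux of the constant normal `ν`. -/
theorem volume_sub_volume_translate_mem_Icc (hpol : IsGaussGreenPolar Ω μ σ)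
    (hΩ : MeasurableSet Ω) {A U V : Set Plane} (hA : MeasurableSet A)
    (hAb : Bornology.IsBounded A) (hU : MeasurableSet U) (hUμ : μ U < ∞) (hV : MeasurableSet V)
    {h : Plane} (hν : 0 ≤ inner ℝ h ν) {δ : ℝ} (hδ : 0 < δ)
    (hAU : ∀ t ∈ Set.Icc (0 : ℝ) 1, ∀ x, ∀ z ∈ A, dist z (x - t • h) < δ → x ∈ U)
    (hVA : ∀ t ∈ Set.Icc (0 : ℝ) 1, ∀ x ∈ V, Metric.ball (x - t • h) δ ⊆ A) :
    volume.real (A ∩ Ω) - volume.real (A ∩ (· + h) ⁻¹' Ω) ∈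
      Set.Icc (inner ℝ h ν * μ.real V - ‖h‖ * excess μ σ ν U) (‖h‖ * μ.real U) := by
  have hchi : ∀ x, |chi Ω (x + h) - chi Ω x| ≤ 1 := fun x =>
    abs_sub_le_iff.2 ⟨by linarith [chi_le_one Ω (x + h), chi_nonneg Ω x],
      by linarith [chi_le_one Ω x, chi_nonneg Ω (x + h)]⟩
  have hlim := tendsto_integral_mollification_chi_mul hA hAb <| locallyIntegrable_of_abs_le
    (g := fun x => chi Ω (x + h) - chi Ω x)
    (((measurable_chi hΩ).comp (measurable_add_const h)).sub (measurable_chi hΩ)) hchi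
  rw [← neg_sub (volume.real (A ∩ (· + h) ⁻¹' Ω)),
    ← setIntegral_chi_sub_chi hΩ hAb.measure_lt_top]
  obtain ⟨R, hR⟩ := hAb.subset_closedBall 0
  refine isClosed_Icc.mem_of_tendsto hlim.neg ?_
  filter_upwards [tendsto_one_div_add_atTop_nhds_zero_nat.eventually (gt_mem_nhds hδ),
    eventually_ge_atTop ⌈R⌉₊] with n hn hnR
  have hψ := isTestFunction_mollification (measurable_chi hA) (abs_chi_le_one A) n
  refine hpol.neg_integral_mul_chi_sub_chi_mem_Icc hΩ hψ h fun t ht =>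
    hpol.integral_mul_inner_mem_Icc hU hUμ hV (hψ.translate (t • h)) (fun x => ?_) (fun x hx => ?_)
      (fun x hx => ?_) hν
  · exact ⟨mollification_nonneg (chi_nonneg A) n _, (le_abs_self _).trans
      (abs_mollification_le (measurable_chi hA) (abs_chi_le_one A) n _)⟩
  · exact mollification_eq_zero (measurable_chi hA) fun z hz =>
      chi_of_notMem fun hzA => hx (hAU t ht x z hzA ((Metric.mem_ball.1 hz).trans hn))
  · have hball := hVA t ht x hx
    have hcenter := mem_closedBall_zero_iff.1 (hR (hball (Metric.mem_ball_self hδ)))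
    refine mollification_eq_const (measurable_chi hA) ?_ fun z hz =>
      chi_of_mem (hball (Metric.ball_subset_ball hn.le hz))
    linarith [(Nat.le_ceil R).trans (Nat.cast_le.2 hnR)]

theorem measureReal_ball_le (hpol : IsGaussGreenPolar Ω μ σ) (hΩ : MeasurableSet Ω)
    (hν : ‖ν‖ = 1) (s : ℝ) {ρ : ℝ} (hρ : 0 < ρ) :
    ρ * (μ.real (Metric.ball y s) - excess μ σ ν (Metric.ball y (s + 3 * ρ))) ≤
      volume.real (Ω ∩ Metric.ball y (s + 3 * ρ)) := by
  have hnorm : ‖ρ • ν‖ = ρ := by rw [norm_smul, hν, mul_one, Real.norm_of_nonneg hρ.le]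
  have hinner : inner ℝ (ρ • ν) ν = ρ := by
    rw [real_inner_smul_left, real_inner_self_eq_norm_sq, hν, one_pow, mul_one]
  have hflux := (hpol.volume_sub_volume_translate_mem_Icc hΩ (ν := ν) (h := ρ • ν)
    (A := Metric.ball y (s + 3 / 2 * ρ)) (U := Metric.ball y (s + 3 * ρ)) (V := Metric.ball y s)
    measurableSet_ball Metric.isBounded_ball measurableSet_ball (hpol.measure_ball_lt_top _ _)
    measurableSet_ball (hinner.symm ▸ hρ.le) (half_pos hρ) (fun t ht x z hz hzx => ?_)
    fun t ht x hx z hz => ?_).1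
  · rw [hnorm, hinner, ← mul_sub, Set.inter_comm] at hflux
    have hle : volume.real (Ω ∩ Metric.ball y (s + 3 / 2 * ρ)) ≤
        volume.real (Ω ∩ Metric.ball y (s + 3 * ρ)) :=
      measureReal_mono (Set.inter_subset_inter_right _ (Metric.ball_subset_ball (by linarith)))
        (measure_inter_lt_top_of_right _ MeasureTheory.measure_ball_lt_top).ne
    linarith [measureReal_nonneg (μ := volume)
      (s := Metric.ball y (s + 3 / 2 * ρ) ∩ (· + ρ • ν) ⁻¹' Ω)]
  all_goals
    have hth : dist x (x - t • ρ • ν) ≤ ρ := by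
      rw [dist_self_sub_right]
      exact (norm_smul_le_of_mem_Icc ht _).trans_eq hnorm
  · rw [Metric.mem_ball] at hz ⊢
    linarith [dist_triangle4 x (x - t • ρ • ν) z y, dist_comm z (x - t • ρ • ν)]
  · rw [Metric.mem_ball] at hx hz ⊢
    linarith [dist_triangle4 z (x - t • ρ • ν) x y, dist_comm x (x - t • ρ • ν)]

theorem exists_measureReal_ball_le (hpol : IsGaussGreenPolar Ω μ σ) (hΩ : MeasurableSet Ω)
    (hν : ‖ν‖ = 1) {r : ℝ} (hr : 0 < r)
    (hE : ∀ s, 0 < s → s ≤ r →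
      excess μ σ ν (Metric.ball y s) ≤ μ.real (Metric.ball y s) / 8) :
    ∃ C : ℝ, 0 < C ∧ ∀ s, 0 < s → s ≤ r → μ.real (Metric.ball y s) ≤ C * s := by
  set C : ℝ := max (32 * Real.pi) (4 * μ.real (Metric.ball y r) / r)
  have hCpi : 32 * Real.pi ≤ C := le_max_left _ _
  have hCr : 4 * μ.real (Metric.ball y r) ≤ C * r := (div_le_iff₀ hr).1 (le_max_right _ _)
  have hC : 0 < C := lt_of_lt_of_le (by positivity) hCpi
  have hlarge : ∀ s ≤ r, r ≤ 4 * s → μ.real (Metric.ball y s) ≤ C * s := fun s hsr hrs => by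
    have hmono := hpol.measureReal_ball_mono (y := y) hsr
    nlinarith
  have hstep : ∀ s, 0 < s → 4 * s ≤ r → μ.real (Metric.ball y (4 * s)) ≤ C * (4 * s) →
      μ.real (Metric.ball y s) ≤ C * s := fun s hs hsr hle => by
    have hflux := hpol.measureReal_ball_le (y := y) hΩ hν s hs
    rw [show s + 3 * s = 4 * s by ring] at hflux
    have hvol : volume.real (Ω ∩ Metric.ball y (4 * s)) ≤ s * (16 * s * Real.pi) := by
      refine (measureReal_mono Set.inter_subset_right
        MeasureTheory.measure_ball_lt_top.ne).trans_eq ?_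
      rw [volume_real_ball y (by positivity)]
      ring
    have hdiff := le_of_mul_le_mul_left (hflux.trans hvol) hs
    have hex := hE (4 * s) (by positivity) hsr
    nlinarith
  have hpow : ∀ (n : ℕ) (s : ℝ), 0 < s → s ≤ r → r ≤ 4 ^ n * s →
      μ.real (Metric.ball y s) ≤ C * s := fun n => by
    induction n with
    | zero => exact fun s hs hsr hrs => hlarge s hsr (by linarith)
    | succ n ih =>
      intro s hs hsr hrs
      rcases le_total r (4 * s) with h4 | h4
      · exact hlarge s hsr h4
      · exact hstep s hs h4 (ih (4 * s) (by positivity) h4 (by rwa [← mul_assoc, ← pow_succ]))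
  refine ⟨C, hC, fun s hs hsr => ?_⟩
  obtain ⟨n, hn⟩ := pow_unbounded_of_one_lt (r / s) (by norm_num : (1 : ℝ) < 4)
  exact hpow n s hs hsr ((div_le_iff₀ hs).1 hn.le)

theorem volume_real_translate_le (hpol : IsGaussGreenPolar Ω μ σ) (hΩ : MeasurableSet Ω)
    {h : Plane} (hh : 0 ≤ inner ℝ h ν) {r R : ℝ} (hR : r + ‖h‖ < R) :
    volume.real ((Metric.ball y r \ Ω) ∩ (· + h) ⁻¹' Ω) ≤
      ‖h‖ * excess μ σ ν (Metric.ball y R) := by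
  have hflux := (hpol.volume_sub_volume_translate_mem_Icc hΩ (A := Metric.ball y r \ Ω)
    (U := Metric.ball y R) (V := ∅) (measurableSet_ball.diff hΩ)
    (Metric.isBounded_ball.subset Set.sdiff_subset) measurableSet_ball
    (hpol.measure_ball_lt_top _ _) MeasurableSet.empty hh (sub_pos.2 hR)
    (fun t ht x z hz hzx => ?_) fun _ _ _ hx => hx.elim).1
  · rw [Set.sdiff_inter_self, measureReal_empty, measureReal_empty, mul_zero] at hflux
    linarith
  · have hth : dist x (x - t • h) ≤ ‖h‖ := by
      rw [dist_self_sub_right]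
      exact norm_smul_le_of_mem_Icc ht h
    have hzy := Metric.mem_ball.1 hz.1
    rw [Metric.mem_ball]
    linarith [dist_triangle4 x (x - t • h) z y, dist_comm z (x - t • h)]

end IsGaussGreenPolar

/-- The half of the ball of radius `ρ` around the origin that lies on the side of `ν`. -/
def halfBall (ν : Plane) (ρ : ℝ) : Set Plane := {h ∈ Metric.ball 0 ρ | 0 ≤ inner ℝ h ν}

theorem measurableSet_halfBall (ν : Plane) (ρ : ℝ) : MeasurableSet (halfBall ν ρ) :=
  measurableSet_ball.inter
    (measurableSet_le measurable_const (by fun_prop : Measurable fun h : Plane => inner ℝ h ν))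

theorem volume_halfBall_lt_top (ν : Plane) (ρ : ℝ) : volume (halfBall ν ρ) < ∞ :=
  (measure_mono (Set.sep_subset _ _)).trans_lt measure_ball_lt_top

theorem sq_le_volume_real_halfBall (ν : Plane) {ρ : ℝ} (hρ : 0 ≤ ρ) :
    ρ ^ 2 ≤ volume.real (halfBall ν ρ) := by
  have hcover : Metric.ball (0 : Plane) ρ ⊆ halfBall ν ρ ∪ Neg.neg ⁻¹' halfBall ν ρ := fun x hx =>
    (le_total 0 (inner ℝ x ν)).imp (fun h => ⟨hx, h⟩)
      fun h => ⟨by simpa using hx, by simpa [inner_neg_left] using h⟩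
  have hneg : volume (Neg.neg ⁻¹' halfBall ν ρ) = volume (halfBall ν ρ) :=
    Measure.measure_preimage_neg volume _
  have hfin := volume_halfBall_lt_top ν ρ
  have hle := (measureReal_mono hcover
    (measure_union_lt_top hfin (hneg.trans_lt hfin)).ne).trans (measureReal_union_le _ _)
  rw [volume_real_ball 0 hρ, measureReal_def volume (Neg.neg ⁻¹' _), hneg, ← measureReal_def]
    at hle
  nlinarith [Real.pi_gt_three, sq_nonneg ρ]

/-- The pairs `(p, q)` with `p ∈ B \ Ω`, `q ∈ Ω` and `q - p ∈ D`: the segments with endpoints that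
enter `Ω` in a direction in `D`. -/
def crossingSet (Ω B D : Set Plane) : Set (Plane × Plane) :=
  {z | z.1 ∈ B \ Ω ∧ z.2 ∈ Ω ∧ z.2 - z.1 ∈ D}

theorem measurableSet_crossingSet {Ω B D : Set Plane} (hΩ : MeasurableSet Ω)
    (hB : MeasurableSet B) (hD : MeasurableSet D) : MeasurableSet (crossingSet Ω B D) :=
  (measurable_fst (hB.diff hΩ)).inter
    ((measurable_snd hΩ).inter ((measurable_snd.sub measurable_fst) hD))

theorem volume_mul_half_le_volume_crossingSet {Ω D : Set Plane} {y : Plane} {s ρ : ℝ}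
    (hΩ : MeasurableSet Ω) (hD : MeasurableSet D) (hDρ : D ⊆ Metric.ball 0 ρ) (hDfin : volume D < ∞)
    (hhalf : volume (Ω ∩ Metric.ball y (s + ρ)) ≤ volume D / 2) :
    volume (Ω ∩ Metric.ball y s) * (volume D / 2) ≤
      volume (crossingSet Ω (Metric.ball y (s + ρ)) D) := by
  rw [Measure.volume_eq_prod,
    Measure.prod_apply_symm (measurableSet_crossingSet hΩ measurableSet_ball hD), mul_comm,
    ← setLIntegral_const]
  refine (setLIntegral_mono' (hΩ.inter measurableSet_ball) fun q hq => ?_).trans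
    (setLIntegral_le_lintegral _ _)
  have hpre : volume ((q - ·) ⁻¹' D) = volume D :=
    (Measure.measurePreserving_sub_left volume q).measure_preimage hD.nullMeasurableSet
  have hsub : ((q - ·) ⁻¹' D) \ (Ω ∩ Metric.ball y (s + ρ)) ⊆
      (fun p => (p, q)) ⁻¹' crossingSet Ω (Metric.ball y (s + ρ)) D := fun p hp => by
    have hpq : dist p q < ρ := by
      simpa [dist_eq_norm, norm_sub_rev] using hDρ hp.1
    have hpy : p ∈ Metric.ball y (s + ρ) :=
      (dist_triangle p q y).trans_lt (by linarith [Metric.mem_ball.1 hq.2])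
    exact ⟨⟨hpy, fun hpΩ => hp.2 ⟨hpΩ, hpy⟩⟩, hq.1, hp.1⟩
  calc volume D / 2 = volume D - volume D / 2 := (ENNReal.sub_half hDfin.ne).symm
    _ ≤ volume ((q - ·) ⁻¹' D) - volume (Ω ∩ Metric.ball y (s + ρ)) := by
      rw [hpre]
      exact tsub_le_tsub_left hhalf _
    _ ≤ _ := le_measure_sdiff.trans (measure_mono hsub)

namespace IsGaussGreenPolar

variable {Ω : Set Plane} {μ : Measure Plane} {σ : Plane → Plane} {y ν : Plane}

theorem volume_crossingSet_le (hpol : IsGaussGreenPolar Ω μ σ) (hΩ : MeasurableSet Ω)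
    {r ρ R : ℝ} (hR : r + ρ ≤ R) :
    volume (crossingSet Ω (Metric.ball y r) (halfBall ν ρ)) ≤
      volume (halfBall ν ρ) * ENNReal.ofReal (ρ * excess μ σ ν (Metric.ball y R)) := by
  have hD := measurableSet_halfBall ν ρ
  have hW := measurableSet_crossingSet hΩ (measurableSet_ball (x := y) (ε := r)) hD
  have hshear := measurePreserving_prod_add (volume : Measure Plane) (volume : Measure Plane)
  rw [Measure.volume_eq_prod, ← hshear.measure_preimage hW.nullMeasurableSet,
    Measure.prod_apply_symm (hshear.measurable hW), mul_comm, ← lintegral_indicator_const hD]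
  refine lintegral_mono fun h => ?_
  by_cases hh : h ∈ halfBall ν ρ
  · have hhρ : ‖h‖ < ρ := mem_ball_zero_iff.1 hh.1
    have hsub : (fun x => (x, h)) ⁻¹' ((fun z : Plane × Plane => (z.1, z.1 + z.2)) ⁻¹'
        crossingSet Ω (Metric.ball y r) (halfBall ν ρ)) ⊆
        (Metric.ball y r \ Ω) ∩ (· + h) ⁻¹' Ω := fun x hx => ⟨hx.1, hx.2.1⟩
    have hfin : volume ((Metric.ball y r \ Ω) ∩ (· + h) ⁻¹' Ω) < ∞ :=
      (measure_mono (Set.inter_subset_left.trans Set.sdiff_subset)).trans_lt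
        MeasureTheory.measure_ball_lt_top
    rw [Set.indicator_of_mem hh]
    refine (measure_mono hsub).trans ?_
    rw [← ofReal_measureReal hfin.ne]
    refine ENNReal.ofReal_le_ofReal ((hpol.volume_real_translate_le hΩ hh.2
      (by linarith : r + ‖h‖ < R)).trans ?_)
    exact mul_le_mul_of_nonneg_right hhρ.le (excess_nonneg _ _ _ _)
  · rw [Set.indicator_of_notMem hh, nonpos_iff_eq_zero]
    refine measure_mono_null (t := ∅) (fun x hx => hh ?_) measure_empty
    simpa using hx.2.2

theorem volume_real_ball_le_of_small (hpol : IsGaussGreenPolar Ω μ σ) (hΩ : MeasurableSet Ω)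
    {s ρ : ℝ} (hρ : 0 < ρ) (hsmall : volume.real (Ω ∩ Metric.ball y (s + ρ)) ≤ ρ ^ 2 / 2) :
    volume.real (Ω ∩ Metric.ball y s) ≤ 2 * ρ * excess μ σ ν (Metric.ball y (s + 2 * ρ)) := by
  set D := halfBall ν ρ
  set G := Ω ∩ Metric.ball y s
  have hDfin : volume D < ∞ := volume_halfBall_lt_top ν ρ
  have hDρ : ρ ^ 2 ≤ volume.real D := sq_le_volume_real_halfBall ν hρ.le
  have hhalf : volume (Ω ∩ Metric.ball y (s + ρ)) ≤ volume D / 2 := by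
    rw [← ENNReal.toReal_le_toReal (measure_inter_lt_top_of_right Ω
      MeasureTheory.measure_ball_lt_top).ne (ENNReal.div_lt_top hDfin.ne two_ne_zero).ne,
      ENNReal.toReal_div, ENNReal.toReal_ofNat]
    exact hsmall.trans (by linarith [measureReal_def volume D])
  have hlower : volume G * (volume D / 2) ≤ volume (crossingSet Ω (Metric.ball y (s + ρ)) D) :=
    volume_mul_half_le_volume_crossingSet hΩ (measurableSet_halfBall ν ρ) (Set.sep_subset _ _)
      hDfin hhalf
  have hle := ENNReal.toReal_mono (ENNReal.mul_lt_top hDfin ENNReal.ofReal_lt_top).ne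
    (hlower.trans (hpol.volume_crossingSet_le hΩ (by linarith : s + ρ + ρ ≤ s + 2 * ρ)))
  rw [ENNReal.toReal_mul, ENNReal.toReal_mul, ENNReal.toReal_div, ENNReal.toReal_ofNat,
    ENNReal.toReal_ofReal (mul_nonneg hρ.le (excess_nonneg _ _ _ _)), ← measureReal_def,
    ← measureReal_def] at hle
  refine le_of_mul_le_mul_left ?_ (lt_of_lt_of_le (by positivity) hDρ : 0 < volume.real D)
  linarith

theorem measureReal_ball_le_half_of_small (hpol : IsGaussGreenPolar Ω μ σ) (hΩ : MeasurableSet Ω)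
    (hν : ‖ν‖ = 1) {u ρ ε : ℝ} (hρ : 0 < ρ) (hε : 6 * ε ≤ 1)
    (hex : excess μ σ ν (Metric.ball y (u + 6 * ρ)) ≤ ε * μ.real (Metric.ball y (u + 6 * ρ)))
    (hμ : 16 * ε * μ.real (Metric.ball y (u + 6 * ρ)) ≤ ρ)
    (hvol : volume.real (Ω ∩ Metric.ball y (u + 6 * ρ)) ≤ ρ ^ 2 / 2) :
    μ.real (Metric.ball y u) ≤ μ.real (Metric.ball y (u + 6 * ρ)) / 2 ∧
      volume.real (Ω ∩ Metric.ball y u) ≤ (ρ / 2) ^ 2 / 2 := by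
  set e := excess μ σ ν (Metric.ball y (u + 6 * ρ))
  have hvol' : ∀ a ≤ u + 6 * ρ, volume.real (Ω ∩ Metric.ball y a) ≤ ρ ^ 2 / 2 := fun a ha =>
    (measureReal_mono (Set.inter_subset_inter_right _ (Metric.ball_subset_ball ha))
      (measure_inter_lt_top_of_right _ MeasureTheory.measure_ball_lt_top).ne).trans hvol
  have hsmall : ∀ s, s + 2 * ρ ≤ u + 6 * ρ →
      volume.real (Ω ∩ Metric.ball y s) ≤ 2 * ρ * e := fun s hs =>
    (hpol.volume_real_ball_le_of_small hΩ hρ (hvol' _ (by linarith))).trans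
      (mul_le_mul_of_nonneg_left (hpol.excess_ball_mono hs) (by positivity))
  have hball : ρ * μ.real (Metric.ball y u) ≤ ρ * (3 * e) := by
    have hflux := hpol.measureReal_ball_le (y := y) hΩ hν u hρ
    have hmono : excess μ σ ν (Metric.ball y (u + 3 * ρ)) ≤ e :=
      hpol.excess_ball_mono (by linarith)
    nlinarith [hsmall (u + 3 * ρ) (by linarith)]
  constructor
  · have hμ0 : 0 ≤ μ.real (Metric.ball y (u + 6 * ρ)) := measureReal_nonneg
    have := le_of_mul_le_mul_left hball hρ
    nlinarith
  · nlinarith [hsmall u (by linarith)]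

theorem measureReal_ball_decay_of_small (hpol : IsGaussGreenPolar Ω μ σ) (hΩ : MeasurableSet Ω)
    (hν : ‖ν‖ = 1) {ε C s : ℝ} (hs : 0 < s) (hε : 0 ≤ ε) (hε6 : 6 * ε ≤ 1) (hεC : 384 * ε * C ≤ 1)
    (hE : ∀ u, 0 < u → u ≤ s →
      excess μ σ ν (Metric.ball y u) ≤ ε * μ.real (Metric.ball y u))
    (hM : μ.real (Metric.ball y s) ≤ C * s)
    (hvol : volume.real (Ω ∩ Metric.ball y s) ≤ (s / 24) ^ 2 / 2) (k : ℕ) :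
    μ.real (Metric.ball y (s / 2 + 12 * (s / 24 * (1 / 2) ^ k))) ≤
        (1 / 2) ^ k * μ.real (Metric.ball y s) ∧
      volume.real (Ω ∩ Metric.ball y (s / 2 + 12 * (s / 24 * (1 / 2) ^ k))) ≤
        (s / 24 * (1 / 2) ^ k) ^ 2 / 2 := by
  induction k with
  | zero =>
    rw [pow_zero, mul_one, show s / 2 + 12 * (s / 24) = s by ring, one_mul]
    exact ⟨le_rfl, hvol⟩
  | succ k ih =>
    set ρ := s / 24 * (1 / 2) ^ k with hρdef
    have hρ : 0 < ρ := by positivity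
    have hρs : ρ ≤ s / 24 :=
      mul_le_of_le_one_right (by positivity) (pow_le_one₀ (by norm_num) (by norm_num))
    have hsucc : s / 24 * (1 / 2) ^ (k + 1) = ρ / 2 := by rw [pow_succ, hρdef]; ring
    have hradius : s / 2 + 12 * ρ = s / 2 + 12 * (ρ / 2) + 6 * ρ := by ring
    have hμ : 16 * ε * μ.real (Metric.ball y (s / 2 + 12 * ρ)) ≤ ρ :=
      calc 16 * ε * μ.real (Metric.ball y (s / 2 + 12 * ρ))
          ≤ 16 * ε * ((1 / 2) ^ k * (C * s)) := by gcongr; exact ih.1.trans (by gcongr)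
        _ = 384 * ε * C * ρ := by rw [hρdef]; ring
        _ ≤ ρ := mul_le_of_le_one_left hρ.le hεC
    have hex := hE (s / 2 + 12 * ρ) (by positivity) (by linarith)
    rw [hradius] at ih hμ hex
    rw [hsucc]
    refine (hpol.measureReal_ball_le_half_of_small hΩ hν hρ hε6 hex hμ ih.2).imp_left
      fun hle => hle.trans ?_
    rw [pow_succ]
    linarith [ih.1]

theorem volume_real_inter_ball_ge (hpol : IsGaussGreenPolar Ω μ σ) (hΩ : MeasurableSet Ω)
    (hν : ‖ν‖ = 1) {ε C s : ℝ} (hs : 0 < s) (hε : 0 ≤ ε) (hε6 : 6 * ε ≤ 1)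
    (hεC : 384 * ε * C ≤ 1) (hpos : ∀ u, 0 < u → 0 < μ (Metric.ball y u))
    (hE : ∀ u, 0 < u → u ≤ s →
      excess μ σ ν (Metric.ball y u) ≤ ε * μ.real (Metric.ball y u))
    (hM : μ.real (Metric.ball y s) ≤ C * s) :
    s ^ 2 / 1152 ≤ volume.real (Ω ∩ Metric.ball y s) := by
  by_contra! hlt
  have hlim : Tendsto (fun k : ℕ => (1 / 2 : ℝ) ^ k * μ.real (Metric.ball y s)) atTop (𝓝 0) := by
    simpa using (tendsto_pow_atTop_nhds_zero_of_lt_one (r := (1 / 2 : ℝ)) (by norm_num)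
      (by norm_num)).mul_const (μ.real (Metric.ball y s))
  have hzero : μ.real (Metric.ball y (s / 2)) ≤ 0 := ge_of_tendsto' hlim fun k =>
    (hpol.measureReal_ball_mono (by linarith [show 0 ≤ s / 24 * (1 / 2) ^ k by positivity])).trans
      (hpol.measureReal_ball_decay_of_small hΩ hν hs hε hε6 hεC hE hM
        (hlt.le.trans_eq (by ring)) k).1
  exact hzero.not_gt (ENNReal.toReal_pos (hpos _ (half_pos hs)).ne'
    (hpol.measure_ball_lt_top _ _).ne)

theorem volume_real_upper_mul_le (hpol : IsGaussGreenPolar Ω μ σ) (hΩ : MeasurableSet Ω)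
    (hν : ‖ν‖ = 1) {r δ : ℝ} (hr : 0 < r) (hδ1 : δ ≤ 1) :
    volume.real (Ωᶜ ∩ Metric.ball y (δ * r)) *
      volume.real {x ∈ Ω ∩ Metric.ball y r | δ * r < inner ℝ (x - y) ν} ≤
      (2 * r) ^ 2 * Real.pi * (2 * r * excess μ σ ν (Metric.ball y (3 * r))) := by
  set N := Ωᶜ ∩ Metric.ball y (δ * r)
  set G := {x ∈ Ω ∩ Metric.ball y r | δ * r < inner ℝ (x - y) ν}
  have hδr : δ * r ≤ r := mul_le_of_le_one_left hr.le hδ1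
  have hsub : N ×ˢ G ⊆ crossingSet Ω (Metric.ball y r) (halfBall ν (2 * r)) := by
    rintro ⟨p, q⟩ ⟨⟨hpΩ, hp⟩, ⟨hqΩ, hq⟩, hqν⟩
    refine ⟨⟨Metric.ball_subset_ball hδr hp, hpΩ⟩, hqΩ, ?_, ?_⟩
    · rw [mem_ball_zero_iff, ← dist_eq_norm]
      linarith [dist_triangle_right q p y, Metric.mem_ball.1 hp, Metric.mem_ball.1 hq]
    · have hpν := real_inner_le_norm (p - y) ν
      rw [hν, mul_one, ← dist_eq_norm] at hpν
      rw [← sub_sub_sub_cancel_right q p y, inner_sub_left]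
      linarith [Metric.mem_ball.1 hp]
  have hvol : volume (halfBall ν (2 * r)) ≤ volume (Metric.ball (0 : Plane) (2 * r)) :=
    measure_mono (Set.sep_subset _ _)
  have hle : volume N * volume G ≤ volume (Metric.ball (0 : Plane) (2 * r)) *
      ENNReal.ofReal (2 * r * excess μ σ ν (Metric.ball y (3 * r))) := by
    rw [← Measure.prod_prod]
    exact (measure_mono hsub).trans <|
      (hpol.volume_crossingSet_le hΩ (by linarith : r + 2 * r ≤ 3 * r)).trans (by gcongr)
  have hreal := ENNReal.toReal_mono (ENNReal.mul_lt_top MeasureTheory.measure_ball_lt_top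
    ENNReal.ofReal_lt_top).ne hle
  rwa [ENNReal.toReal_mul, ENNReal.toReal_mul, ← measureReal_def, ← measureReal_def,
    ← measureReal_def, volume_real_ball 0 (by positivity),
    ENNReal.toReal_ofReal (mul_nonneg (by positivity) (excess_nonneg _ _ _ _))] at hreal

end IsGaussGreenPolar

section Frame

variable {ν : Plane}

theorem rotate_apply_zero (ν x : Plane) : rotate ν x 0 = ν 1 * x 0 - ν 0 * x 1 := by
  simp [rotate, e₁, e₂, perp, PiLp.inner_apply, Fin.sum_univ_two, mul_comm, sub_eq_add_neg,
    add_comm]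

theorem rotate_apply_one (ν x : Plane) : rotate ν x 1 = inner ℝ ν x := by simp [rotate, e₁, e₂]

theorem norm_sq_eq (x : Plane) : ‖x‖ ^ 2 = x 0 ^ 2 + x 1 ^ 2 := by
  rw [EuclideanSpace.real_norm_sq_eq, Fin.sum_univ_two]

theorem norm_rotate (hν : ‖ν‖ = 1) (x : Plane) : ‖rotate ν x‖ = ‖x‖ := by
  have hsq : ν 0 ^ 2 + ν 1 ^ 2 = 1 := by rw [← norm_sq_eq, hν, one_pow]
  have hinner : inner ℝ ν x = ν 0 * x 0 + ν 1 * x 1 := by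
    simp [PiLp.inner_apply, Fin.sum_univ_two, mul_comm]
  rw [← sq_eq_sq₀ (norm_nonneg _) (norm_nonneg _), norm_sq_eq, norm_sq_eq x, rotate_apply_zero,
    rotate_apply_one, hinner]
  linear_combination (x 0 ^ 2 + x 1 ^ 2) * hsq

/-- The rotation `R_ν` as a linear isometry. -/
def rotateEquiv (ν : Plane) (hν : ‖ν‖ = 1) : Plane ≃ₗᵢ[ℝ] Plane :=
  LinearIsometry.toLinearIsometryEquiv
    { toFun := rotate ν
      map_add' := fun x y => by
        simp only [rotate, inner_add_right]
        module
      map_smul' := fun c x => by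
        simp only [rotate, real_inner_smul_right, RingHom.id_apply]
        module
      norm_map' := norm_rotate hν } rfl

theorem measurePreserving_rotate_sub (hν : ‖ν‖ = 1) (y : Plane) :
    MeasurePreserving (fun x => rotate ν (x - y)) (volume : Measure Plane) volume :=
  (rotateEquiv ν hν).measurePreserving.comp (measurePreserving_sub_right volume y)

theorem abs_rotate_sub_le (hν : ‖ν‖ = 1) (x x' y : Plane) (i : Fin 2) :
    |rotate ν (x - y) i - rotate ν (x' - y) i| ≤ dist x x' := by
  have hsub := (rotateEquiv ν hν).map_sub (x - y) (x' - y)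
  rw [sub_sub_sub_cancel_right] at hsub
  rw [dist_eq_norm, ← (rotateEquiv ν hν).norm_map, hsub]
  exact PiLp.norm_apply_le (rotateEquiv ν hν (x - y) - rotateEquiv ν hν (x' - y)) i

theorem dist_le_abs_rotate_add (hν : ‖ν‖ = 1) (x y : Plane) :
    dist x y ≤ |rotate ν (x - y) 0| + |rotate ν (x - y) 1| := by
  rw [dist_eq_norm, ← norm_rotate hν (x - y)]
  refine le_of_sq_le_sq ?_ (by positivity)
  rw [norm_sq_eq, add_sq, sq_abs, sq_abs]
  nlinarith [mul_nonneg (abs_nonneg (rotate ν (x - y) 0)) (abs_nonneg (rotate ν (x - y) 1))]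

theorem rotate_self (ν : Plane) : rotate ν ν = ‖ν‖ ^ 2 • e₂ := by
  rw [rotate, real_inner_self_eq_norm_sq, sub_eq_self]
  simp [perp, PiLp.inner_apply, Fin.sum_univ_two, mul_comm]

theorem rotate_add_smul (hν : ‖ν‖ = 1) (x y : Plane) (c : ℝ) :
    rotate ν (x + c • ν - y) = rotate ν (x - y) + c • e₂ := by
  have hadd := (rotateEquiv ν hν).map_add (x - y) (c • ν)
  rw [(rotateEquiv ν hν).map_smul, ← add_sub_right_comm] at hadd
  refine hadd.trans ?_
  change _ + c • rotate ν ν = _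
  rw [rotate_self, hν, one_pow, one_smul]
  rfl

/-- The rectangle with sides `I` along `ν^⊥` and `J` along `ν`, in the frame with origin `y`. -/
def rect (y ν : Plane) (I J : Set ℝ) : Set Plane :=
  {x | rotate ν (x - y) 0 ∈ I ∧ rotate ν (x - y) 1 ∈ J}

theorem add_smul_mem_rect_iff (hν : ‖ν‖ = 1) {x y : Plane} {c : ℝ} {I J : Set ℝ} :
    x + c • ν ∈ rect y ν I J ↔ x ∈ rect y ν I ((· + c) ⁻¹' J) := by
  simp [rect, rotate_add_smul hν, e₂]

theorem mem_rect_of_dist_lt (hν : ‖ν‖ = 1) {x z y : Plane} {a b c d δ : ℝ}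
    (hx : x ∈ rect y ν (Set.Icc a b) (Set.Icc c d)) (hzx : dist z x < δ) :
    z ∈ rect y ν (Set.Ioo (a - δ) (b + δ)) (Set.Ioo (c - δ) (d + δ)) := by
  have hdist := fun i => abs_lt.1 ((abs_rotate_sub_le hν z x y i).trans_lt hzx)
  exact ⟨⟨by linarith [hx.1.1, hdist 0], by linarith [hx.1.2, hdist 0]⟩,
    by linarith [hx.2.1, hdist 1], by linarith [hx.2.2, hdist 1]⟩

theorem dist_add_smul_lt_of_mem_rect (hν : ‖ν‖ = 1) {z y : Plane} {a b c : ℝ} {J : Set ℝ}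
    (hz : z ∈ rect y ν (Set.Ioo (-a) a) ((· + c) ⁻¹' J)) (hJ : ∀ s ∈ J, |s| ≤ b) :
    dist (z + c • ν) y < a + b := by
  have hmem := (add_smul_mem_rect_iff hν).2 hz
  exact (dist_le_abs_rotate_add hν _ y).trans_lt
    (add_lt_add_of_lt_of_le (abs_lt.2 hmem.1) (hJ _ hmem.2))

theorem measurableSet_rect (hν : ‖ν‖ = 1) (y : Plane) {I J : Set ℝ} (hI : MeasurableSet I)
    (hJ : MeasurableSet J) : MeasurableSet (rect y ν I J) :=
  (measurePreserving_rotate_sub hν y).measurable <|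
    ((by fun_prop : Measurable fun x : Plane => x 0) hI).inter
      ((by fun_prop : Measurable fun x : Plane => x 1) hJ)

theorem volume_coord_rect {I J : Set ℝ} (hI : MeasurableSet I) (hJ : MeasurableSet J) :
    volume {x : Plane | x 0 ∈ I ∧ x 1 ∈ J} = volume I * volume J := by
  rw [← Measure.prod_prod, ← Measure.volume_eq_prod, ← ((volume_preserving_finTwoArrow ℝ).comp
    (PiLp.volume_preserving_ofLp (Fin 2))).measure_preimage (hI.prod hJ).nullMeasurableSet]
  rfl

theorem volume_rect (hν : ‖ν‖ = 1) (y : Plane) {I J : Set ℝ} (hI : MeasurableSet I)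
    (hJ : MeasurableSet J) : volume (rect y ν I J) = volume I * volume J := by
  rw [← volume_coord_rect hI hJ]
  exact (measurePreserving_rotate_sub hν y).measure_preimage
    (((by fun_prop : Measurable fun x : Plane => x 0) hI).inter
      ((by fun_prop : Measurable fun x : Plane => x 1) hJ)).nullMeasurableSet

theorem volume_real_rect (hν : ‖ν‖ = 1) (y : Plane) {I J : Set ℝ} (hI : MeasurableSet I)
    (hJ : MeasurableSet J) : volume.real (rect y ν I J) = volume.real I * volume.real J := by
  rw [measureReal_def, volume_rect hν y hI hJ, ENNReal.toReal_mul, ← measureReal_def,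
    ← measureReal_def]

theorem isBounded_rect (hν : ‖ν‖ = 1) (y : Plane) {I J : Set ℝ} (hI : Bornology.IsBounded I)
    (hJ : Bornology.IsBounded J) : Bornology.IsBounded (rect y ν I J) := by
  obtain ⟨A, hA⟩ := hI.exists_norm_le
  obtain ⟨B, hB⟩ := hJ.exists_norm_le
  exact (Metric.isBounded_closedBall (x := y) (r := A + B)).subset fun x hx =>
    (dist_le_abs_rotate_add hν x y).trans (add_le_add (hA _ hx.1) (hB _ hx.2))

theorem exists_subset_rect (hν : ‖ν‖ = 1) {S : Set Plane} {y : Plane} {d : ℝ} (hy : y ∈ S)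
    (hS : ∀ x ∈ S, ∀ x' ∈ S, dist x x' ≤ d) :
    ∃ a ∈ Set.Icc (-d) 0, S ⊆ rect y ν (Set.Icc a (a + d)) (Set.Icc (-d) d) := by
  have hdist : ∀ x ∈ S, ∀ x' ∈ S, ∀ i, |rotate ν (x - y) i - rotate ν (x' - y) i| ≤ d :=
    fun x hx x' hx' i => (abs_rotate_sub_le hν x x' y i).trans (hS x hx x' hx')
  have hzero : ∀ i, rotate ν (y - y) i = 0 := fun i => by simp [rotate]
  have hlow : ∀ x ∈ S, -d ≤ rotate ν (x - y) 0 := fun x hx => by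
    linarith [(abs_le.1 (hdist x hx y hy 0)).1, hzero 0]
  have : Nonempty S := ⟨⟨y, hy⟩⟩
  have hbdd : BddBelow (Set.range fun x : S => rotate ν (x - y) 0) :=
    ⟨-d, Set.forall_mem_range.2 fun x => hlow x x.2⟩
  have hinf : ∀ x ∈ S, ⨅ x : S, rotate ν (x - y) 0 ≤ rotate ν (x - y) 0 := fun x hx =>
    ciInf_le hbdd ⟨x, hx⟩
  refine ⟨⨅ x : S, rotate ν (x - y) 0, ⟨le_ciInf fun x => hlow x x.2, ?_⟩,
    fun x hx => ⟨⟨hinf x hx, ?_⟩, ?_⟩⟩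
  · exact (hinf y hy).trans_eq (hzero 0)
  · rw [← sub_le_iff_le_add]
    exact le_ciInf fun x' => by linarith [(abs_le.1 (hdist x hx x' x'.2 0)).2]
  · simpa only [hzero, sub_zero] using Set.mem_Icc.2 (abs_le.1 (hdist x hx y hy 1))

end Frame

theorem measureReal_le_of_forall_add_mem {E : Type*} [AddGroup E] [MeasurableSpace E]
    [MeasurableAdd E] {m : Measure E} [m.IsAddRightInvariant] {A C : Set E} (h : E)
    (hAC : ∀ x ∈ A, x + h ∈ C) (hC : m C ≠ ∞) : m.real A ≤ m.real C := by
  have hpre : m ((· + h) ⁻¹' C) = m C := measure_preimage_add_right m h C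
  exact (measureReal_mono hAC (hpre.trans_ne hC)).trans_eq (congrArg ENNReal.toReal hpre)

theorem volume_sub_volume_translate_rect_le {Ω : Set Plane} {ν : Plane} (hν : ‖ν‖ = 1) (y : Plane)
    {I : Set ℝ} (hI : Bornology.IsBounded I) {p q c : ℝ} (hc : 0 ≤ c) :
    volume.real (rect y ν I (Set.Ioo p q) ∩ Ω)
      - volume.real (rect y ν I (Set.Ioo p q) ∩ (· + c • ν) ⁻¹' Ω) ≤
    volume.real (rect y ν I (Set.Ioc p (p + c))) := by
  set A := rect y ν I (Set.Ioo p q)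
  set S := rect y ν I (Set.Ioc p (p + c))
  have hAfin : ∀ B, volume (A ∩ B) < ∞ := fun B => (measure_mono Set.inter_subset_left).trans_lt
    (isBounded_rect hν y hI (Metric.isBounded_Ioo _ _)).measure_lt_top
  have hSfin : volume S < ∞ := (isBounded_rect hν y hI (Metric.isBounded_Ioc _ _)).measure_lt_top
  have hcover : A ∩ Ω ⊆ S ∪ (A ∩ Ω) \ S := fun x hx => (em (x ∈ S)).imp_right fun h => ⟨hx, h⟩
  have hle := (measureReal_mono hcover (measure_union_lt_top hSfin
    ((measure_mono Set.sdiff_subset).trans_lt (hAfin Ω))).ne).trans (measureReal_union_le _ _)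
  have htrans : volume.real ((A ∩ Ω) \ S) ≤ volume.real (A ∩ (· + c • ν) ⁻¹' Ω) := by
    refine measureReal_le_of_forall_add_mem (-(c • ν)) (fun x hx => ⟨?_, ?_⟩) (hAfin _).ne
    · rw [← neg_smul, add_smul_mem_rect_iff hν]
      have hxS : p + c < rotate ν (x - y) 1 := not_le.1 fun h => hx.2 ⟨hx.1.1.1, hx.1.1.2.1, h⟩
      exact ⟨hx.1.1.1, by linarith, by linarith [hx.1.1.2.2]⟩
    · rw [Set.mem_preimage, neg_add_cancel_right]
      exact hx.1.2
  linarith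

theorem le_volume_sub_volume_translate {Ω : Set Plane} {ν : Plane} (hΩ : MeasurableSet Ω)
    (hν : ‖ν‖ = 1) {y : Plane} {a b c r : ℝ} (hb : 0 ≤ b) (hc : 0 ≤ c) (har : a + c ≤ r) :
    volume.real (rect y ν (Set.Ioo (-a) a) (Set.Ioo (b - c) (-b)))
      - volume.real {x ∈ Ω ∩ Metric.ball y r | b < inner ℝ (x - y) ν}
      - volume.real {x ∈ Ωᶜ ∩ Metric.ball y r | b < inner ℝ (x - y) (-ν)} ≤
    volume.real (rect y ν (Set.Ioo (-a) a) (Set.Ioo (b - c) (-b)) ∩ Ω)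
      - volume.real (rect y ν (Set.Ioo (-a) a) (Set.Ioo (b - c) (-b)) ∩ (· + c • ν) ⁻¹' Ω) := by
  set A := rect y ν (Set.Ioo (-a) a) (Set.Ioo (b - c) (-b))
  have hball : ∀ z ∈ A, ∀ s ∈ Set.Icc 0 c, z + s • ν ∈ Metric.ball y r := fun z hz s hs =>
    (dist_add_smul_lt_of_mem_rect hν (J := Set.Ioo (-c) c) (b := c)
      ⟨hz.1, by linarith [hz.2.1, hs.1], by linarith [hz.2.2, hs.2]⟩
      fun u hu => (abs_lt.2 hu).le).trans_le har
  have hfin : ∀ {p : Plane → Prop} {S : Set Plane}, volume {x ∈ S ∩ Metric.ball y r | p x} < ∞ :=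
    (measure_mono (Set.sep_subset _ _)).trans_lt
      (measure_inter_lt_top_of_right _ measure_ball_lt_top)
  have hinside : volume.real A = volume.real (A ∩ Ω) + volume.real (A \ Ω) :=
    (measureReal_inter_add_sdiff (μ := volume) hΩ (isBounded_rect hν y (Metric.isBounded_Ioo _ _)
      (Metric.isBounded_Ioo _ _)).measure_lt_top.ne).symm
  have hlower : volume.real (A \ Ω) ≤
      volume.real {x ∈ Ωᶜ ∩ Metric.ball y r | b < inner ℝ (x - y) (-ν)} := by
    refine measureReal_mono (fun x hx => ⟨⟨hx.2, ?_⟩, ?_⟩) hfin.ne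
    · simpa using hball x hx.1 0 ⟨le_rfl, hc⟩
    · rw [inner_neg_right, real_inner_comm, ← rotate_apply_one]
      linarith [hx.1.2.2]
  have hupper : volume.real (A ∩ (· + c • ν) ⁻¹' Ω) ≤
      volume.real {x ∈ Ω ∩ Metric.ball y r | b < inner ℝ (x - y) ν} := by
    refine measureReal_le_of_forall_add_mem (c • ν)
      (fun x hx => ⟨⟨hx.2, hball x hx.1 c ⟨hc, le_rfl⟩⟩, ?_⟩) hfin.ne
    rw [real_inner_comm, ← rotate_apply_one]
    have hmem : x + c • ν ∈ rect y ν Set.univ (Set.Ioi b) :=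
      (add_smul_mem_rect_iff hν).2 ⟨trivial, sub_lt_iff_lt_add.1 hx.1.2.1⟩
    exact hmem.2
  linarith

namespace IsGaussGreenPolar

variable {Ω : Set Plane} {μ : Measure Plane} {σ : Plane → Plane} {y ν : Plane}

theorem measureReal_rect_le (hpol : IsGaussGreenPolar Ω μ σ) (hΩ : MeasurableSet Ω)
    (hν : ‖ν‖ = 1) {d τ a : ℝ} (hd : 0 < d) (hτ : 0 < τ) (hτd : τ ≤ d)
    (ha : a ∈ Set.Icc (-d) 0) :
    μ.real (rect y ν (Set.Icc a (a + d)) (Set.Icc (-d) d)) ≤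
      d + 2 * τ + excess μ σ ν (Metric.ball y (8 * d)) := by
  set I := Set.Ioo (a - τ) (a + d + τ)
  set A := rect y ν I (Set.Ioo (-(2 * d) - τ) (d + τ))
  have hnorm : ‖d • ν‖ = d := by rw [norm_smul, hν, mul_one, Real.norm_of_nonneg hd.le]
  have hinner : inner ℝ (d • ν) ν = d := by
    rw [real_inner_smul_left, real_inner_self_eq_norm_sq, hν, one_pow, mul_one]
  have hshift : volume.real (A ∩ Ω) - volume.real (A ∩ (· + d • ν) ⁻¹' Ω) ≤
      (d + 2 * τ) * d := by
    refine (volume_sub_volume_translate_rect_le hν y (Metric.isBounded_Ioo _ _) hd.le).trans_eq ?_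
    rw [volume_real_rect hν y measurableSet_Ioo measurableSet_Ioc,
      Real.volume_real_Ioo_of_le (by linarith), Real.volume_real_Ioc_of_le (by linarith)]
    ring
  have hflux := (hpol.volume_sub_volume_translate_mem_Icc hΩ (A := A)
    (U := Metric.ball y (8 * d)) (V := rect y ν (Set.Icc a (a + d)) (Set.Icc (-d) d))
    (measurableSet_rect hν y measurableSet_Ioo measurableSet_Ioo)
    (isBounded_rect hν y (Metric.isBounded_Ioo _ _) (Metric.isBounded_Ioo _ _)) measurableSet_ball
    (hpol.measure_ball_lt_top _ _) (measurableSet_rect hν y measurableSet_Icc measurableSet_Icc)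
    (hinner.symm ▸ hd.le) hτ (fun t ht x z hz hzx => ?_) fun t ht x hx z hz => ?_).1
  · rw [hinner, hnorm, ← mul_sub] at hflux
    have hdiff := le_of_mul_le_mul_left ((hflux.trans hshift).trans_eq (mul_comm _ _)) hd
    linarith
  · have hth : dist x (x - t • d • ν) ≤ d := by
      rw [dist_self_sub_right]
      exact (norm_smul_le_of_mem_Icc ht _).trans_eq hnorm
    have hz0 : |rotate ν (z - y) 0| ≤ 2 * d :=
      abs_le.2 ⟨by linarith [hz.1.1, ha.1], by linarith [hz.1.2, ha.2]⟩
    have hz1 : |rotate ν (z - y) 1| ≤ 3 * d :=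
      abs_le.2 ⟨by linarith [hz.2.1], by linarith [hz.2.2]⟩
    rw [Metric.mem_ball]
    linarith [dist_le_abs_rotate_add hν z y, dist_triangle4 x (x - t • d • ν) z y,
      dist_comm z (x - t • d • ν)]
  · refine mem_rect_of_dist_lt hν (x := x - t • d • ν) (c := -(2 * d)) ?_ hz
    rw [sub_eq_add_neg, smul_smul, ← neg_smul, add_smul_mem_rect_iff hν]
    have htd := mul_le_of_le_one_left hd.le ht.2
    have htd0 := mul_nonneg ht.1 hd.le
    exact ⟨hx.1, by linarith [hx.2.1], by linarith [hx.2.2]⟩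

theorem measureReal_ball_ge (hpol : IsGaussGreenPolar Ω μ σ) (hΩ : MeasurableSet Ω)
    (hν : ‖ν‖ = 1) {r κ δ : ℝ} (hr : 0 < r) (hκ : 0 < κ) (hκ1 : 2 * κ ≤ 1) (hδ : 0 < δ)
    (hδκ : 2 * δ ≤ κ) :
    2 * (1 - 2 * κ) * (κ - 2 * δ) * r ^ 2
      - volume.real {x ∈ Ω ∩ Metric.ball y r | δ * r < inner ℝ (x - y) ν}
      - volume.real {x ∈ Ωᶜ ∩ Metric.ball y r | δ * r < inner ℝ (x - y) (-ν)} ≤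
      κ * r * μ.real (Metric.ball y r) := by
  set A := rect y ν (Set.Ioo (-((1 - 2 * κ) * r)) ((1 - 2 * κ) * r))
    (Set.Ioo (δ * r - κ * r) (-(δ * r)))
  have hκr : 0 < κ * r := mul_pos hκ hr
  have hδr : 0 < δ * r := mul_pos hδ hr
  have hδκr : 2 * (δ * r) ≤ κ * r := by nlinarith
  have hκr1 : 2 * (κ * r) ≤ r := by nlinarith
  have hnorm : ‖(κ * r) • ν‖ = κ * r := by
    rw [norm_smul, hν, mul_one, Real.norm_of_nonneg hκr.le]
  have hinner : 0 ≤ inner ℝ ((κ * r) • ν) ν := by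
    rw [real_inner_smul_left]
    exact mul_nonneg hκr.le real_inner_self_nonneg
  have hAvol : volume.real A = 2 * (1 - 2 * κ) * (κ - 2 * δ) * r ^ 2 := by
    rw [volume_real_rect hν y measurableSet_Ioo measurableSet_Ioo,
      Real.volume_real_Ioo_of_le (by linarith), Real.volume_real_Ioo_of_le (by linarith)]
    ring
  have hflux := (hpol.volume_sub_volume_translate_mem_Icc hΩ (A := A) (U := Metric.ball y r)
    (V := ∅) (measurableSet_rect hν y measurableSet_Ioo measurableSet_Ioo)
    (isBounded_rect hν y (Metric.isBounded_Ioo _ _) (Metric.isBounded_Ioo _ _))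
    measurableSet_ball (hpol.measure_ball_lt_top _ _) MeasurableSet.empty hinner hκr
    (fun t ht x z hz hzx => ?_) fun _ _ _ hx => hx.elim).2
  · rw [hnorm] at hflux
    rw [← hAvol]
    exact (le_volume_sub_volume_translate hΩ hν hδr.le hκr.le (by linarith)).trans hflux
  · have htκ := mul_le_of_le_one_left hκr.le ht.2
    have htκ0 := mul_nonneg ht.1 hκr.le
    have hz' := dist_add_smul_lt_of_mem_rect hν (c := t * (κ * r)) (J := Set.Icc (-(κ * r)) (κ * r))
      ⟨hz.1, by linarith [hz.2.1], by linarith [hz.2.2]⟩ fun _ => abs_le.2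
    rw [dist_sub_eq_dist_add_right, smul_smul, dist_comm] at hzx
    rw [Metric.mem_ball]
    linarith [dist_triangle x (z + (t * (κ * r)) • ν) y]

end IsGaussGreenPolar

theorem eventually_nhdsGT_zero_forall_le {p : ℝ → Prop} (h : ∀ᶠ s in 𝓝[>] (0 : ℝ), p s) :
    ∀ᶠ s in 𝓝[>] (0 : ℝ), ∀ u, 0 < u → u ≤ s → p u := by
  obtain ⟨r, hr, hsub⟩ := mem_nhdsGT_iff_exists_Ioc_subset.1 h
  filter_upwards [Ioc_mem_nhdsGT hr] with s hs u hu hus using hsub ⟨hu, hus.trans hs.2⟩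

theorem eventually_nhdsGT_zero_mul {p : ℝ → Prop} (h : ∀ᶠ s in 𝓝[>] (0 : ℝ), p s) {c : ℝ}
    (hc : 0 < c) : ∀ᶠ s in 𝓝[>] (0 : ℝ), p (c * s) := by
  obtain ⟨r, hr, hsub⟩ := mem_nhdsGT_iff_exists_Ioc_subset.1 h
  filter_upwards [Ioc_mem_nhdsGT (div_pos hr hc)] with s hs
  exact hsub ⟨mul_pos hc hs.1, (le_div_iff₀' hc).1 hs.2⟩

/-- `ν` is the De Giorgi normal at `y` of the vector measure `σ μ`: the point `y` lies in the
support of `μ`, and the averages of `σ` over small balls around `y` converge to the unit vector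
`ν`. -/
structure IsNormalAt (μ : Measure Plane) (σ : Plane → Plane) (y ν : Plane) : Prop where
  measure_ball_pos : ∀ r : ℝ, 0 < r → 0 < μ (Metric.ball y r)
  tendsto_average : Tendsto (fun r : ℝ => ⨍ x in Metric.ball y r, σ x ∂μ) (𝓝[>] 0) (𝓝 ν)
  norm_eq_one : ‖ν‖ = 1

variable {Ω : Set Plane} {μ : Measure Plane} {σ : Plane → Plane} {y ν : Plane}

namespace IsGaussGreenPolar

theorem integrableOn (hpol : IsGaussGreenPolar Ω μ σ) {U : Set Plane} (hU : μ U < ∞) :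
    IntegrableOn σ U μ := by
  have : IsFiniteMeasure (μ.restrict U) := ⟨by simpa using hU⟩
  refine Integrable.of_bound (C := 1) hpol.measurable.aestronglyMeasurable ?_
  filter_upwards [ae_restrict_of_ae hpol.ae_norm_eq_one] with x hx using hx.le

-- Integrate `‖σ - ν‖ ≤ ε / 2 + ‖σ - ν‖² / (2 ε)`, where `‖σ - ν‖² = 2 - 2 ⟪ν, σ⟫`.
theorem excess_le (hpol : IsGaussGreenPolar Ω μ σ) (hν : ‖ν‖ = 1) {U : Set Plane} (hU : μ U < ∞)
    {ε : ℝ} (hε : 0 < ε) :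
    excess μ σ ν U ≤ ε / 2 * μ.real U + (μ.real U - ∫ x in U, inner ℝ ν (σ x) ∂μ) / ε := by
  have hconst : ∀ c : ℝ, IntegrableOn (fun _ => c) U μ := fun c => integrableOn_const hU.ne
  have hinner : IntegrableOn (fun x => inner ℝ ν (σ x)) U μ := (hpol.integrableOn hU).const_inner ν
  have hdefect : IntegrableOn (fun x => (1 - inner ℝ ν (σ x)) / ε) U μ :=
    ((hconst 1).sub hinner).div_const ε
  calc excess μ σ ν U ≤ ∫ x in U, (ε / 2 + (1 - inner ℝ ν (σ x)) / ε) ∂μ := by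
        refine integral_mono_ae (hpol.integrableOn_norm_sub hU ν) ((hconst _).add hdefect) ?_
        filter_upwards [ae_restrict_of_ae hpol.ae_norm_eq_one] with x hx
        have hsq : 1 - inner ℝ ν (σ x) = ‖σ x - ν‖ ^ 2 / 2 := by
          rw [norm_sub_sq_real, hx, hν, real_inner_comm]
          ring
        have hgap : ε / 2 + ‖σ x - ν‖ ^ 2 / 2 / ε - ‖σ x - ν‖ =
            (ε - ‖σ x - ν‖) ^ 2 / (2 * ε) := by
          field_simp
          ring
        simp only [hsq]
        exact sub_nonneg.1 (hgap ▸ by positivity)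
    _ = _ := by
        rw [integral_add (hconst _) hdefect, integral_div, integral_div,
          integral_sub (hconst 1) hinner]
        simp only [integral_const, measureReal_restrict_apply_univ, smul_eq_mul, mul_one]
        ring

end IsGaussGreenPolar

namespace IsNormalAt

theorem neg (hn : IsNormalAt μ σ y ν) : IsNormalAt μ (fun x => -σ x) y (-ν) where
  measure_ball_pos := hn.measure_ball_pos
  tendsto_average := by
    simpa only [setAverage_eq, integral_neg, smul_neg] using hn.tendsto_average.neg
  norm_eq_one := (norm_neg ν).trans hn.norm_eq_one

theorem eventually_excess_le (hn : IsNormalAt μ σ y ν) (hpol : IsGaussGreenPolar Ω μ σ) {ε : ℝ}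
    (hε : 0 < ε) :
    ∀ᶠ s in 𝓝[>] (0 : ℝ),
      excess μ σ ν (Metric.ball y s) ≤ ε * μ.real (Metric.ball y s) := by
  have htend : Tendsto (fun r : ℝ => inner ℝ ν (⨍ x in Metric.ball y r, σ x ∂μ)) (𝓝[>] 0)
      (𝓝 1) := by
    have h := (tendsto_const_nhds (x := ν)).inner (𝕜 := ℝ) hn.tendsto_average
    rwa [real_inner_self_eq_norm_sq, hn.norm_eq_one, one_pow] at h
  have hlt : 1 - ε ^ 2 / 2 < 1 := by linarith [pow_pos hε 2]
  filter_upwards [htend.eventually (lt_mem_nhds hlt), self_mem_nhdsWithin] with s hs hs0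
  have hfin : μ (Metric.ball y s) < ∞ := hpol.measure_ball_lt_top y s
  have hpos : 0 < μ.real (Metric.ball y s) :=
    ENNReal.toReal_pos (hn.measure_ball_pos s hs0).ne' hfin.ne
  rw [setAverage_eq, real_inner_smul_right, ← integral_inner (hpol.integrableOn hfin),
    inv_mul_eq_div, lt_div_iff₀ hpos] at hs
  have hdefect : (μ.real (Metric.ball y s) - ∫ x in Metric.ball y s, inner ℝ ν (σ x) ∂μ) / ε ≤
      ε / 2 * μ.real (Metric.ball y s) := by
    rw [div_le_iff₀ hε]
    linarith
  linarith [hpol.excess_le hn.norm_eq_one hfin hε]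

theorem exists_eventually_measureReal_le (hn : IsNormalAt μ σ y ν)
    (hpol : IsGaussGreenPolar Ω μ σ) (hΩ : MeasurableSet Ω) :
    ∃ C > 0, ∀ᶠ s in 𝓝[>] (0 : ℝ), μ.real (Metric.ball y s) ≤ C * s := by
  obtain ⟨r, hexcess, hr⟩ := ((eventually_nhdsGT_zero_forall_le
    (hn.eventually_excess_le hpol (ε := 1 / 8) (by norm_num))).and self_mem_nhdsWithin).exists
  obtain ⟨C, hC, hle⟩ := hpol.exists_measureReal_ball_le hΩ hn.norm_eq_one hr
    fun s hs hsr => (hexcess s hs hsr).trans_eq (by ring)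
  refine ⟨C, hC, ?_⟩
  filter_upwards [Ioc_mem_nhdsGT hr] with s hs using hle s hs.1 hs.2

theorem eventually_excess_le_mul (hn : IsNormalAt μ σ y ν) (hpol : IsGaussGreenPolar Ω μ σ)
    (hΩ : MeasurableSet Ω) {ε : ℝ} (hε : 0 < ε) :
    ∀ᶠ s in 𝓝[>] (0 : ℝ), excess μ σ ν (Metric.ball y s) ≤ ε * s := by
  obtain ⟨C, hC, hmass⟩ := hn.exists_eventually_measureReal_le hpol hΩ
  filter_upwards [hmass, hn.eventually_excess_le hpol (div_pos hε hC)] with s hs hexcess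
  calc excess μ σ ν (Metric.ball y s) ≤ ε / C * μ.real (Metric.ball y s) := hexcess
    _ ≤ ε / C * (C * s) := by gcongr
    _ = ε * s := by field_simp

theorem eventually_le_volume_real (hn : IsNormalAt μ σ y ν) (hpol : IsGaussGreenPolar Ω μ σ)
    (hΩ : MeasurableSet Ω) :
    ∀ᶠ s in 𝓝[>] (0 : ℝ), s ^ 2 / 1152 ≤ volume.real (Ω ∩ Metric.ball y s) := by
  obtain ⟨C, hC, hmass⟩ := hn.exists_eventually_measureReal_le hpol hΩ
  set ε : ℝ := min (1 / 6) (1 / (384 * C))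
  have hε : 0 < ε := by positivity
  have hε6 : ε ≤ 1 / 6 := min_le_left _ _
  have hεC : ε * (384 * C) ≤ 1 := (le_div_iff₀ (by positivity)).1 (min_le_right _ _)
  filter_upwards [hmass, eventually_nhdsGT_zero_forall_le (hn.eventually_excess_le hpol hε),
    self_mem_nhdsWithin] with s hs hexcess hs0
  exact hpol.volume_real_inter_ball_ge hΩ hn.norm_eq_one hs0 hε.le (by linarith) (by linarith)
    hn.measure_ball_pos hexcess hs

theorem eventually_volume_real_upper_le (hn : IsNormalAt μ σ y ν)
    (hpol : IsGaussGreenPolar Ω μ σ) (hΩ : MeasurableSet Ω) {κ : ℝ} (hκ : 0 < κ) (hκ1 : κ ≤ 1) :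
    ∀ᶠ s in 𝓝[>] (0 : ℝ),
      volume.real {x ∈ Ω ∩ Metric.ball y s | κ ^ 2 * s < inner ℝ (x - y) ν} ≤
        κ ^ 2 * s ^ 2 / 2 := by
  have hκ2 : 0 < κ ^ 2 := pow_pos hκ 2
  filter_upwards [self_mem_nhdsWithin,
    eventually_nhdsGT_zero_mul
      (hn.neg.eventually_le_volume_real (hpol.compl hΩ.nullMeasurableSet) hΩ.compl) hκ2,
    eventually_nhdsGT_zero_mul
      (hn.eventually_excess_le_mul hpol hΩ (ε := κ ^ 6 / 221184) (by positivity)) three_pos]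
    with s hs hlower hexcess
  rw [Set.mem_Ioi] at hs
  have hupper := hpol.volume_real_upper_mul_le (y := y) hΩ hn.norm_eq_one hs
    (pow_le_one₀ hκ.le hκ1 : κ ^ 2 ≤ 1)
  set g := volume.real {x ∈ Ω ∩ Metric.ball y s | κ ^ 2 * s < inner ℝ (x - y) ν}
  have hg : 0 ≤ g := measureReal_nonneg
  have hprod : (κ ^ 2 * s) ^ 2 / 1152 * g ≤ (κ ^ 2 * s) ^ 2 / 1152 * (κ ^ 2 * s ^ 2 / 2) :=
    calc (κ ^ 2 * s) ^ 2 / 1152 * g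
        ≤ (2 * s) ^ 2 * Real.pi * (2 * s * excess μ σ ν (Metric.ball y (3 * s))) :=
          (mul_le_mul_of_nonneg_right hlower hg).trans hupper
      _ ≤ (2 * s) ^ 2 * 4 * (2 * s * (κ ^ 6 / 221184 * (3 * s))) := by
          have := Real.pi_le_four
          have := excess_nonneg μ σ ν (Metric.ball y (3 * s))
          gcongr
      _ = _ := by ring
  exact le_of_mul_le_mul_left hprod (by positivity)

theorem eventually_le_measureReal_ball (hn : IsNormalAt μ σ y ν) (hpol : IsGaussGreenPolar Ω μ σ)
    (hΩ : MeasurableSet Ω) {η : ℝ} (hη : 0 < η) :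
    ∀ᶠ s in 𝓝[>] (0 : ℝ), (2 - η) * s ≤ μ.real (Metric.ball y s) := by
  set κ : ℝ := min (η / 9) (1 / 4)
  have hκ : 0 < κ := by positivity
  have hκ4 : κ ≤ 1 / 4 := min_le_right _ _
  have hκη : κ ≤ η / 9 := min_le_left _ _
  filter_upwards [self_mem_nhdsWithin,
    hn.eventually_volume_real_upper_le hpol hΩ hκ (by linarith),
    hn.neg.eventually_volume_real_upper_le (hpol.compl hΩ.nullMeasurableSet) hΩ.compl hκ
      (by linarith)] with s hs hupper hlower
  rw [Set.mem_Ioi] at hs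
  have hmass := hpol.measureReal_ball_ge (y := y) hΩ hn.norm_eq_one hs hκ (by linarith)
    (δ := κ ^ 2) (by positivity) (by nlinarith)
  have hη' : 2 - η ≤ 2 * (1 - 2 * κ) ^ 2 - κ := by nlinarith
  have hcoeff : κ * s * ((2 - η) * s) ≤ κ * s * μ.real (Metric.ball y s) :=
    calc κ * s * ((2 - η) * s) = κ * s ^ 2 * (2 - η) := by ring
      _ ≤ κ * s ^ 2 * (2 * (1 - 2 * κ) ^ 2 - κ) := by gcongr
      _ = 2 * (1 - 2 * κ) * (κ - 2 * κ ^ 2) * s ^ 2 - κ ^ 2 * s ^ 2 / 2 - κ ^ 2 * s ^ 2 / 2 := by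
        ring
      _ ≤ κ * s * μ.real (Metric.ball y s) := by linarith
  exact le_of_mul_le_mul_left hcoeff (by positivity)

theorem eventually_measure_le (hn : IsNormalAt μ σ y ν) (hpol : IsGaussGreenPolar Ω μ σ)
    (hΩ : MeasurableSet Ω) {η : ℝ} (hη : 0 < η) :
    ∀ᶠ d in 𝓝[>] (0 : ℝ), ∀ S : Set Plane, y ∈ S → (∀ x ∈ S, ∀ x' ∈ S, dist x x' ≤ d) →
      μ S ≤ ENNReal.ofReal ((1 + η) * d) := by
  have := hpol.isLocallyFiniteMeasure
  filter_upwards [self_mem_nhdsWithin, eventually_nhdsGT_zero_mul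
    (hn.eventually_excess_le_mul hpol hΩ (ε := η / 16) (by positivity)) (show (0 : ℝ) < 8 by simp)]
    with d hd hexcess S hy hS
  rw [Set.mem_Ioi] at hd
  obtain ⟨a, ha, hsub⟩ := exists_subset_rect hn.norm_eq_one hy hS
  have hfin := (isBounded_rect hn.norm_eq_one y (Metric.isBounded_Icc a (a + d))
    (Metric.isBounded_Icc (-d) d)).measure_lt_top (μ := μ)
  have hτ : 0 < min (η / 4) 1 * d := by positivity
  have hrect := hpol.measureReal_rect_le (y := y) hΩ hn.norm_eq_one hd hτ
    (mul_le_of_le_one_left hd.le (min_le_right _ _)) ha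
  have hτη : min (η / 4) 1 * d ≤ η / 4 * d := by
    gcongr
    exact min_le_left _ _
  refine (measure_mono hsub).trans ?_
  rw [← ofReal_measureReal hfin.ne]
  exact ENNReal.ofReal_le_ofReal (by linarith)

end IsNormalAt

section Compactness

open scoped CompactlySupported

variable {X : Type*} [TopologicalSpace X] [T2Space X] [LocallyCompactSpace X] [MeasurableSpace X]
  [BorelSpace X] {m : Measure X} {ι : Type*} {B : ℝ}

theorem exists_measure_tendsto_integral_of_nonneg (𝒰 : Ultrafilter ι) {w : ι → X → ℝ}
    (hw : ∀ i x, 0 ≤ w i x) (hint : ∀ i, Integrable (w i) m) (hB : ∀ i, ∫ x, w i x ∂m ≤ B) :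
    ∃ μ : Measure X, IsLocallyFiniteMeasure μ ∧ ∀ f : C_c(X, ℝ),
      Tendsto (fun i => ∫ x, f x * w i x ∂m) 𝒰 (𝓝 (∫ x, f x ∂μ)) := by
  have hbound : ∀ f : C_c(X, ℝ), ∃ M, ∀ x, ‖f x‖ ≤ M := fun f =>
    f.continuous.bounded_above_of_compact_support f.hasCompactSupport
  have hfw : ∀ i (f : C_c(X, ℝ)), Integrable (fun x => f x * w i x) m := fun i f =>
    (hint i).bdd_mul f.continuous.aestronglyMeasurable (Eventually.of_forall (hbound f).choose_spec)
  have hlim : ∀ f : C_c(X, ℝ), ∃ a, Tendsto (fun i => ∫ x, f x * w i x ∂m) 𝒰 (𝓝 a) := fun f => by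
    obtain ⟨M, hM⟩ := hbound f
    have hmem : ∀ i, ∫ x, f x * w i x ∂m ∈ Set.Icc (-(|M| * B)) (|M| * B) := fun i => by
      refine abs_le.1 ((abs_integral_le_integral_abs).trans ?_)
      calc ∫ x, |f x * w i x| ∂m ≤ ∫ x, |M| * w i x ∂m := by
            refine integral_mono (hfw i f).abs ((hint i).const_mul _) fun x => ?_
            simp only [abs_mul, abs_of_nonneg (hw i x)]
            exact mul_le_mul_of_nonneg_right ((hM x).trans (le_abs_self M)) (hw i x)
        _ ≤ |M| * B := by
            rw [integral_const_mul]
            exact mul_le_mul_of_nonneg_left (hB i) (abs_nonneg M)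
    obtain ⟨a, -, ha⟩ := isCompact_Icc.ultrafilter_le_nhds (𝒰.map fun i => ∫ x, f x * w i x ∂m)
      (le_principal_iff.2 (mem_map.2 (Eventually.of_forall hmem)))
    exact ⟨a, ha⟩
  choose L hL using hlim
  let Λ : C_c(X, ℝ) →ₚ[ℝ] ℝ := PositiveLinearMap.mk₀
    { toFun := L
      map_add' := fun f g => tendsto_nhds_unique (hL (f + g)) <|
        ((hL f).add (hL g)).congr fun i => by
          simp only [CompactlySupportedContinuousMap.add_apply, add_mul]
          exact (integral_add (hfw i f) (hfw i g)).symm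
      map_smul' := fun c f => tendsto_nhds_unique (hL (c • f)) <|
        ((hL f).const_mul c).congr fun i => by
          simp only [CompactlySupportedContinuousMap.smul_apply, smul_eq_mul, mul_assoc]
          exact (integral_const_mul c _).symm }
    fun f hf => ge_of_tendsto' (hL f) fun i => integral_nonneg fun x => mul_nonneg (hf x) (hw i x)
  refine ⟨RealRMK.rieszMeasure Λ, inferInstance, fun f => ?_⟩
  rw [RealRMK.integral_rieszMeasure]
  exact hL f

theorem exists_measures_tendsto_integral (𝒰 : Ultrafilter ι) {u : ι → X → ℝ}
    (hint : ∀ i, Integrable (u i) m) (hB : ∀ i, ∫ x, |u i x| ∂m ≤ B) :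
    ∃ μp μn : Measure X, IsLocallyFiniteMeasure μp ∧ IsLocallyFiniteMeasure μn ∧
      ∀ f : C_c(X, ℝ),
        Tendsto (fun i => ∫ x, f x * u i x ∂m) 𝒰 (𝓝 (∫ x, f x ∂μp - ∫ x, f x ∂μn)) := by
  have hpart : ∀ {v : ι → X → ℝ}, (∀ i, Integrable (v i) m) → (∀ i x, |v i x| = |u i x|) →
      ∃ μ : Measure X, IsLocallyFiniteMeasure μ ∧ ∀ f : C_c(X, ℝ),
        Tendsto (fun i => ∫ x, f x * max (v i x) 0 ∂m) 𝒰 (𝓝 (∫ x, f x ∂μ)) := fun hv hvu =>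
    exists_measure_tendsto_integral_of_nonneg 𝒰 (fun i x => le_max_right _ _)
      (fun i => (hv i).pos_part) fun i => (integral_mono (hv i).pos_part (hint i).abs fun x =>
        (max_le (le_abs_self _) (abs_nonneg _)).trans_eq (hvu i x)).trans (hB i)
  obtain ⟨μp, hμp, hp⟩ := hpart hint fun _ _ => rfl
  obtain ⟨μn, hμn, hn⟩ := hpart (fun i => (hint i).neg) fun i x => abs_neg (u i x)
  refine ⟨μp, μn, hμp, hμn, fun f => ((hp f).sub (hn f)).congr fun i => ?_⟩
  obtain ⟨M, hM⟩ := f.continuous.bounded_above_of_compact_support f.hasCompactSupport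
  have hmul : ∀ {v : X → ℝ}, Integrable v m → Integrable (fun x => f x * v x) m := fun hv =>
    hv.bdd_mul f.continuous.aestronglyMeasurable (Eventually.of_forall hM)
  rw [← integral_sub (hmul (hint i).pos_part) (hmul (hint i).neg.pos_part)]
  refine integral_congr_ae (Eventually.of_forall fun x => ?_)
  simp only [Pi.neg_apply, ← mul_sub]
  rw [max_zero_sub_eq_self]

end Compactness

theorem integral_abs_chi_sub_chi_le {Ω : Set Plane} (hΩ : MeasurableSet Ω) (hfin : volume Ω < ∞)
    (hP : perimeter Ω < ∞) (h : Plane) :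
    ∫ x, |chi Ω (x + h) - chi Ω x| ≤ ‖h‖ * (perimeter Ω).toReal := by
  have hsq : ∀ x, |chi Ω (x + h) - chi Ω x| =
      (chi Ω (x + h) - chi Ω x) * (chi Ω (x + h) - chi Ω x) := fun x => by
    by_cases h₁ : x + h ∈ Ω <;> by_cases h₂ : x ∈ Ω <;> simp [chi_of_mem, chi_of_notMem, h₁, h₂]
  have hle : ∀ x, |chi Ω (x + h) - chi Ω x| ≤ 1 := fun x =>
    abs_le.2 ⟨by linarith [chi_nonneg Ω (x + h), chi_le_one Ω x],
      by linarith [chi_nonneg Ω x, chi_le_one Ω (x + h)]⟩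
  have hmeas : Measurable fun x => chi Ω (x + h) - chi Ω x :=
    ((measurable_chi hΩ).comp (measurable_add_const h)).sub (measurable_chi hΩ)
  simp only [hsq]
  exact (le_abs_self _).trans
    ((abs_integral_mul_chi_sub_chi_le hΩ hfin hP hmeas hle h).trans_eq (by rw [one_mul]))

theorem IsTestFunction.hasDerivAt_setIntegral_translate {E : Type*} [NormedAddCommGroup E]
    [NormedSpace ℝ E] [MeasurableSpace E] [BorelSpace E] {m : Measure E}
    [IsFiniteMeasureOnCompacts m] {ψ : E → ℝ} (hψ : IsTestFunction ψ) {A : Set E} (hA : m A < ∞)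
    (h : E) :
    HasDerivAt (fun t : ℝ => ∫ x in A, ψ (x - t • h) ∂m) (-∫ x in A, fderiv ℝ ψ x h ∂m) 0 := by
  have : IsFiniteMeasure (m.restrict A) := ⟨by simpa using hA⟩
  have hcont : Continuous fun x => fderiv ℝ ψ x h := hψ.continuous_fderiv.clm_apply continuous_const
  obtain ⟨C, hC⟩ := hcont.bounded_above_of_compact_support
    (hψ.2.fderiv_apply (𝕜 := ℝ) h)
  have hderiv := (hasDerivAt_integral_of_dominated_loc_of_deriv_le (μ := m.restrict A)
    (F := fun (t : ℝ) x => ψ (x - t • h)) (F' := fun (t : ℝ) x => -fderiv ℝ ψ (x - t • h) h)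
    (x₀ := 0) (s := Set.univ) (bound := fun _ => C) univ_mem
    (Eventually.of_forall fun t =>
      (hψ.continuous.comp (continuous_sub_right (t • h))).aestronglyMeasurable)
    (by simpa only [zero_smul, sub_zero] using hψ.integrable.restrict)
    (hcont.comp (continuous_sub_right _)).neg.aestronglyMeasurable
    (Eventually.of_forall fun x t _ => by simpa using hC (x - t • h)) (integrable_const C)
    (Eventually.of_forall fun x t _ => hψ.hasDerivAt_translate x h t)).2
  simpa [integral_neg] using hderiv

theorem exists_measures_setIntegral_fderiv {Ω : Set Plane} (hΩ : MeasurableSet Ω)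
    (hfin : volume Ω < ∞) (hP : perimeter Ω < ∞) (e : Plane) :
    ∃ μp μn : Measure Plane, IsLocallyFiniteMeasure μp ∧ IsLocallyFiniteMeasure μn ∧
      ∀ ψ : Plane → ℝ, IsTestFunction ψ →
        ∫ x in Ω, fderiv ℝ ψ x e = ∫ x, ψ x ∂μp - ∫ x, ψ x ∂μn := by
  set 𝒰 : Ultrafilter ℝ := Ultrafilter.of (𝓝[≠] (0 : ℝ))
  set u : ℝ → Plane → ℝ := fun t x => t⁻¹ * (chi Ω (x + t • e) - chi Ω x)
  have hu : ∀ t, Integrable (u t) := fun t => (integrable_chi_sub_chi hΩ hfin _).const_mul _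
  have hB : ∀ t, ∫ x, |u t x| ≤ ‖e‖ * (perimeter Ω).toReal := fun t => by
    simp only [u, abs_mul, integral_const_mul]
    calc |t⁻¹| * ∫ x, |chi Ω (x + t • e) - chi Ω x|
        ≤ |t⁻¹| * (‖t • e‖ * (perimeter Ω).toReal) := by
          gcongr
          exact integral_abs_chi_sub_chi_le hΩ hfin hP _
      _ = |t⁻¹ * t| * (‖e‖ * (perimeter Ω).toReal) := by
          rw [norm_smul, Real.norm_eq_abs, abs_mul]
          ring
      _ ≤ ‖e‖ * (perimeter Ω).toReal := by
          refine mul_le_of_le_one_left (by positivity) ?_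
          rcases eq_or_ne t 0 with rfl | ht <;> simp [*]
  obtain ⟨μn, μp, hμn, hμp, htend⟩ := exists_measures_tendsto_integral 𝒰 hu hB
  refine ⟨μp, μn, hμp, hμn, fun ψ hψ => ?_⟩
  have hquot : ∀ t : ℝ, ∫ x, ψ x * u t x = t⁻¹ • ((∫ x in Ω, ψ (x - (0 + t) • e)) -
      ∫ x in Ω, ψ (x - (0 : ℝ) • e)) := fun t => by
    have hint : ∀ v : Plane, IntegrableOn (fun x => ψ (x - v)) Ω := fun v =>
      (hψ.integrable.comp_sub_right v).integrableOn
    rw [← integral_sub (hint _) (hint _), zero_smul, zero_add]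
    simp only [sub_zero, u, mul_left_comm (ψ _), integral_const_mul, smul_eq_mul]
    rw [hψ.integral_mul_chi_sub_chi hΩ, hψ.setIntegral_sub_translate]
  have hslope := (hψ.hasDerivAt_setIntegral_translate hfin e).tendsto_slope_zero.mono_left
    (Ultrafilter.of_le (𝓝[≠] (0 : ℝ)))
  have hlim := tendsto_nhds_unique (hslope.congr fun t => (hquot t).symm)
    (htend ⟨⟨ψ, hψ.continuous⟩, hψ.2⟩)
  exact (neg_eq_iff_eq_neg.1 hlim).trans (neg_sub _ _)

theorem isLocallyFiniteMeasure_add {X : Type*} [TopologicalSpace X] [MeasurableSpace X]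
    {a b : Measure X} (ha : IsLocallyFiniteMeasure a) (hb : IsLocallyFiniteMeasure b) :
    IsLocallyFiniteMeasure (a + b) := ⟨fun x => by
  obtain ⟨U, hU, haU⟩ := a.finiteAt_nhds x
  obtain ⟨V, hV, hbV⟩ := b.finiteAt_nhds x
  refine ⟨U ∩ V, inter_mem hU hV, ?_⟩
  rw [Measure.add_apply, ENNReal.add_lt_top]
  exact ⟨(measure_mono Set.inter_subset_left).trans_lt haU,
    (measure_mono Set.inter_subset_right).trans_lt hbV⟩⟩

theorem norm_le_add_abs (x : Plane) : ‖x‖ ≤ |x 0| + |x 1| := by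
  rw [EuclideanSpace.norm_eq, Fin.sum_univ_two]
  refine Real.sqrt_le_iff.2 ⟨by positivity, ?_⟩
  rw [Real.norm_eq_abs, Real.norm_eq_abs]
  nlinarith [mul_nonneg (abs_nonneg (x 0)) (abs_nonneg (x 1))]

theorem exists_density_integral_sub {X : Type*} [MeasurableSpace X] {a b m : Measure X}
    [SigmaFinite m] (ha : a ≤ m) (hb : b ≤ m) :
    ∃ g : X → ℝ, Measurable g ∧ (∀ᵐ x ∂m, |g x| ≤ 1) ∧ ∀ f : X → ℝ, Integrable f m →
      ∫ x, f x ∂a - ∫ x, f x ∂b = ∫ x, f x * g x ∂m := by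
  have : SigmaFinite a := Measure.sigmaFinite_of_le m ha
  have : SigmaFinite b := Measure.sigmaFinite_of_le m hb
  have hmeas : ∀ k : Measure X, Measurable fun x => (k.rnDeriv m x).toReal := fun k =>
    (Measure.measurable_rnDeriv k m).ennreal_toReal
  have hmem : ∀ k ≤ m, ∀ᵐ x ∂m, (k.rnDeriv m x).toReal ∈ Set.Icc (0 : ℝ) 1 := fun k hk =>
    (Measure.rnDeriv_le_one_of_le hk).mono fun x hx =>
      ⟨ENNReal.toReal_nonneg, ENNReal.toReal_le_of_le_ofReal zero_le_one (by simpa using hx)⟩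
  have hint : ∀ k ≤ m, SigmaFinite k → ∀ f : X → ℝ, Integrable f m →
      Integrable (fun x => f x * (k.rnDeriv m x).toReal) m ∧
        ∫ x, f x * (k.rnDeriv m x).toReal ∂m = ∫ x, f x ∂k := fun k hk _ f hf => by
    refine ⟨hf.mul_bdd (c := 1) (hmeas k).aestronglyMeasurable ?_, ?_⟩
    · filter_upwards [hmem k hk] with x hx
      exact abs_le.2 ⟨by linarith [hx.1], hx.2⟩
    · rw [← integral_rnDeriv_smul (Measure.absolutelyContinuous_of_le hk)]
      simp only [smul_eq_mul, mul_comm]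
  refine ⟨fun x => (a.rnDeriv m x).toReal - (b.rnDeriv m x).toReal, (hmeas a).sub (hmeas b), ?_,
    fun f hf => ?_⟩
  · filter_upwards [hmem a ha, hmem b hb] with x hxa hxb
    exact abs_le.2 ⟨by linarith [hxa.1, hxb.2], by linarith [hxa.2, hxb.1]⟩
  · obtain ⟨hia, hea⟩ := hint a ha ‹_› f hf
    obtain ⟨hib, heb⟩ := hint b hb ‹_› f hf
    simp only [mul_sub, integral_sub hia hib, hea, heb]

theorem exists_density_setIntegral_divergence {Ω : Set Plane} (hΩ : MeasurableSet Ω)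
    (hfin : volume Ω < ∞) (hP : perimeter Ω < ∞) :
    ∃ (m : Measure Plane) (G : Plane → Plane), IsLocallyFiniteMeasure m ∧ Measurable G ∧
      (∀ᵐ x ∂m, ‖G x‖ ≤ 2) ∧ ∀ T : Plane → Plane, IsTestField T →
        ∫ x in Ω, divergence T x = ∫ x, inner ℝ (T x) (G x) ∂m := by
  obtain ⟨a, b, ha, hb, hab⟩ := exists_measures_setIntegral_fderiv hΩ hfin hP e₁
  obtain ⟨c, d, hc, hd, hcd⟩ := exists_measures_setIntegral_fderiv hΩ hfin hP e₂
  set m : Measure Plane := (a + b) + (c + d)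
  have hfinite : IsLocallyFiniteMeasure m :=
    have := isLocallyFiniteMeasure_add ha hb
    have := isLocallyFiniteMeasure_add hc hd
    isLocallyFiniteMeasure_add ‹_› ‹_›
  obtain ⟨g₁, hg₁, hg₁le, hint₁⟩ := exists_density_integral_sub (m := m)
    (Measure.le_add_right (Measure.le_add_right le_rfl) : a ≤ m)
    (Measure.le_add_right (Measure.le_add_left le_rfl) : b ≤ m)
  obtain ⟨g₂, hg₂, hg₂le, hint₂⟩ := exists_density_integral_sub (m := m)
    (Measure.le_add_left (Measure.le_add_right le_rfl) : c ≤ m)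
    (Measure.le_add_left (Measure.le_add_left le_rfl) : d ≤ m)
  refine ⟨m, fun x => !₂[g₁ x, g₂ x], hfinite, ?_, ?_, fun T hT => ?_⟩
  · refine (PiLp.volume_preserving_toLp (Fin 2)).measurable.comp (measurable_pi_iff.2 fun i => ?_)
    fin_cases i
    exacts [hg₁, hg₂]
  · filter_upwards [hg₁le, hg₂le] with x hx₁ hx₂
    exact (norm_le_add_abs _).trans ((add_le_add hx₁ hx₂).trans_eq one_add_one_eq_two)
  · have hcoord : ∀ i, Integrable (fun x => T x i) m := fun i =>
      (hT.coord i).continuous.integrable_of_hasCompactSupport (hT.coord i).2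
    have hmul : ∀ i (g : Plane → ℝ), Measurable g → (∀ᵐ x ∂m, |g x| ≤ 1) →
        Integrable (fun x => T x i * g x) m := fun i g hg hle =>
      (hcoord i).mul_bdd hg.aestronglyMeasurable hle
    simp only [hT.divergence_eq]
    rw [integral_add ((hT.coord 0).integrable_fderiv e₁).restrict
        ((hT.coord 1).integrable_fderiv e₂).restrict, hab _ (hT.coord 0), hcd _ (hT.coord 1),
      hint₁ _ (hcoord 0), hint₂ _ (hcoord 1),
      ← integral_add (hmul 0 g₁ hg₁ hg₁le) (hmul 1 g₂ hg₂ hg₂le)]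
    refine integral_congr_ae (Eventually.of_forall fun x => ?_)
    simp [PiLp.inner_apply, Fin.sum_univ_two, mul_comm]

theorem isGaussGreenPolar_withDensity {Ω : Set Plane} {m : Measure Plane}
    [IsLocallyFiniteMeasure m] {G : Plane → Plane} {C : ℝ} (hG : Measurable G)
    (hC : ∀ᵐ x ∂m, ‖G x‖ ≤ C) (hdiv : ∀ T : Plane → Plane, IsTestField T →
      ∫ x in Ω, divergence T x = ∫ x, inner ℝ (T x) (G x) ∂m) :
    IsGaussGreenPolar Ω (m.withDensity fun x => ENNReal.ofReal ‖G x‖) fun x => ‖G x‖⁻¹ • G x := by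
  have hw : Measurable fun x => ENNReal.ofReal ‖G x‖ := hG.norm.ennreal_ofReal
  refine ⟨⟨fun x => ⟨Metric.ball x 1, Metric.ball_mem_nhds x one_pos, ?_⟩⟩,
    hG.norm.inv.smul hG, (ae_withDensity_iff hw).2 (Eventually.of_forall fun x hx => ?_),
    fun T hT => ?_⟩
  · rw [withDensity_apply _ measurableSet_ball]
    calc ∫⁻ x in Metric.ball x 1, ENNReal.ofReal ‖G x‖ ∂m
        ≤ ∫⁻ _ in Metric.ball x 1, ENNReal.ofReal C ∂m :=
          lintegral_mono_ae (ae_restrict_of_ae (hC.mono fun _ => ENNReal.ofReal_le_ofReal))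
      _ < ∞ := by
          rw [setLIntegral_const]
          exact ENNReal.mul_lt_top ENNReal.ofReal_lt_top measure_ball_lt_top
  · have hne : ‖G x‖ ≠ 0 := fun h => hx (by rw [h, ENNReal.ofReal_zero])
    rw [norm_smul, norm_inv, norm_norm, inv_mul_cancel₀ hne]
  · rw [integral_withDensity_eq_integral_toReal_smul hw
      (Eventually.of_forall fun x => ENNReal.ofReal_lt_top), hdiv T hT]
    refine integral_congr_ae (Eventually.of_forall fun x => ?_)
    rcases eq_or_ne (G x) 0 with h | h
    · simp [h]
    · simp [real_inner_smul_right, mul_inv_cancel_left₀ (norm_ne_zero_iff.2 h)]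

theorem exists_isGaussGreenPolar {Ω : Set Plane} (hΩ : MeasurableSet Ω)
    (hfin : volume Ω < ∞) (hP : perimeter Ω < ∞) :
    ∃ (μ : Measure Plane) (σ : Plane → Plane), IsGaussGreenPolar Ω μ σ := by
  obtain ⟨m, G, hm, hG, hle, hdiv⟩ := exists_density_setIntegral_divergence hΩ hfin hP
  exact ⟨_, _, isGaussGreenPolar_withDensity hG hle hdiv⟩

theorem ae_rnDeriv_ne_zero_imp {X : Type*} [MeasurableSpace X] {μ m : Measure X} (hac : μ ≪ m)
    [SigmaFinite μ] [SigmaFinite m] {p : X → Prop} :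
    (∀ᵐ x ∂m, μ.rnDeriv m x ≠ 0 → p x) ↔ ∀ᵐ x ∂μ, p x := by
  rw [← ae_withDensity_iff (Measure.measurable_rnDeriv _ _), Measure.withDensity_rnDeriv_eq _ _ hac]

namespace IsGaussGreenPolar

variable {Ω : Set Plane} {μ μ' m : Measure Plane} {σ σ' : Plane → Plane}

theorem integrable_smul (hpol : IsGaussGreenPolar Ω μ σ) {ψ : Plane → ℝ} (hψ : Integrable ψ μ) :
    Integrable (fun x => ψ x • σ x) μ := by
  refine hψ.norm.mono' (hψ.1.smul hpol.measurable.aestronglyMeasurable) ?_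
  filter_upwards [hpol.ae_norm_eq_one] with x hx
  rw [norm_smul, hx, mul_one]

theorem integral_smul_eq (hpol : IsGaussGreenPolar Ω μ σ) (hpol' : IsGaussGreenPolar Ω μ' σ')
    {ψ : Plane → ℝ} (hψ : IsTestFunction ψ) :
    ∫ x, ψ x • σ x ∂μ = ∫ x, ψ x • σ' x ∂μ' := by
  have hinner : ∀ {μ : Measure Plane} {σ : Plane → Plane}, IsGaussGreenPolar Ω μ σ → ∀ h : Plane,
      inner ℝ h (∫ x, ψ x • σ x ∂μ) = ∫ x in Ω, fderiv ℝ ψ x h := fun {μ σ} hpol h => by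
    have := hpol.isLocallyFiniteMeasure
    simp only [← integral_inner (hpol.integrable_smul hψ.integrable), real_inner_smul_right,
      hpol.setIntegral_fderiv hψ]
  exact ext_inner_left ℝ fun h => (hinner hpol h).trans (hinner hpol' h).symm

theorem ae_norm_rnDeriv_smul (hpol : IsGaussGreenPolar Ω μ σ) (hac : μ ≪ m) [SigmaFinite m] :
    ∀ᵐ x ∂m, ‖(μ.rnDeriv m x).toReal • σ x‖ = (μ.rnDeriv m x).toReal := by
  have := hpol.isLocallyFiniteMeasure
  filter_upwards [(ae_rnDeriv_ne_zero_imp hac).2 hpol.ae_norm_eq_one] with x hx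
  rcases eq_or_ne (μ.rnDeriv m x) 0 with h0 | h0
  · simp [h0]
  · rw [norm_smul, hx h0, mul_one, Real.norm_of_nonneg ENNReal.toReal_nonneg]

theorem locallyIntegrable_rnDeriv_smul (hpol : IsGaussGreenPolar Ω μ σ) (hle : μ ≤ m)
    [IsLocallyFiniteMeasure m] :
    LocallyIntegrable (fun x => (μ.rnDeriv m x).toReal • σ x) m := by
  refine (locallyIntegrable_const (1 : ℝ)).mono
    ((Measure.measurable_rnDeriv _ _).ennreal_toReal.smul hpol.measurable).aestronglyMeasurable ?_
  filter_upwards [hpol.ae_norm_rnDeriv_smul (Measure.absolutelyContinuous_of_le hle),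
    Measure.rnDeriv_le_one_of_le hle] with x hx hx1
  rw [hx, norm_one]
  exact ENNReal.toReal_le_of_le_ofReal zero_le_one (by simpa using hx1)

theorem ae_rnDeriv_smul_eq (hpol : IsGaussGreenPolar Ω μ σ) (hpol' : IsGaussGreenPolar Ω μ' σ')
    (hle : μ ≤ m) (hle' : μ' ≤ m) [IsLocallyFiniteMeasure m] :
    ∀ᵐ x ∂m, (μ.rnDeriv m x).toReal • σ x = (μ'.rnDeriv m x).toReal • σ' x := by
  have := hpol.isLocallyFiniteMeasure
  have := hpol'.isLocallyFiniteMeasure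
  refine ae_eq_of_integral_contDiff_smul_eq (hpol.locallyIntegrable_rnDeriv_smul hle)
    (hpol'.locallyIntegrable_rnDeriv_smul hle') fun ψ hψ hψc => ?_
  simp only [smul_comm (ψ _), integral_rnDeriv_smul (Measure.absolutelyContinuous_of_le hle),
    integral_rnDeriv_smul (Measure.absolutelyContinuous_of_le hle')]
  exact hpol.integral_smul_eq hpol' ⟨hψ.of_le (by exact_mod_cast le_top), hψc⟩

theorem unique (hpol : IsGaussGreenPolar Ω μ σ) (hpol' : IsGaussGreenPolar Ω μ' σ') :
    μ = μ' ∧ σ =ᵐ[μ] σ' := by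
  have hμ := hpol.isLocallyFiniteMeasure
  have hμ' := hpol'.isLocallyFiniteMeasure
  set m := μ + μ'
  have hm : IsLocallyFiniteMeasure m := isLocallyFiniteMeasure_add hμ hμ'
  have hle : μ ≤ m := Measure.le_add_right le_rfl
  have hle' : μ' ≤ m := Measure.le_add_left le_rfl
  have hac := Measure.absolutelyContinuous_of_le hle
  have hac' := Measure.absolutelyContinuous_of_le hle'
  have hsmul := hpol.ae_rnDeriv_smul_eq hpol' hle hle'
  have hrn : μ.rnDeriv m =ᵐ[m] μ'.rnDeriv m := by
    filter_upwards [hsmul, hpol.ae_norm_rnDeriv_smul hac, hpol'.ae_norm_rnDeriv_smul hac',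
      μ.rnDeriv_lt_top m, μ'.rnDeriv_lt_top m] with x hx hnorm hnorm' hfin hfin'
    rw [← ENNReal.toReal_eq_toReal_iff' hfin.ne hfin'.ne, ← hnorm, ← hnorm', hx]
  refine ⟨by rw [← Measure.withDensity_rnDeriv_eq _ _ hac, withDensity_congr_ae hrn,
    Measure.withDensity_rnDeriv_eq _ _ hac'], (ae_rnDeriv_ne_zero_imp hac).1 ?_⟩
  filter_upwards [hsmul, hrn, μ.rnDeriv_lt_top m] with x hx hrnx hfin hne
  rw [← hrnx] at hx
  exact smul_right_injective _ (ENNReal.toReal_pos hne hfin.ne).ne' hx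

end IsGaussGreenPolar

section SmoothApproximation

variable {E : Type*} [NormedAddCommGroup E] [InnerProductSpace ℝ E] [FiniteDimensional ℝ E]

theorem exists_contDiff_truncation {c : ℝ} (hc : 0 < c) (hc1 : c < 1) :
    ∃ θ : E → E, θ 0 = 0 ∧ ContDiff ℝ 1 θ ∧ HasCompactSupport θ ∧ (∀ v, ‖θ v‖ ≤ 1) ∧
      ∀ v, ‖v‖ ≤ c → θ v = v := by
  let η : ContDiffBump (0 : E) := ⟨c, 1, hc, hc1⟩
  refine ⟨fun v => η v • v, smul_zero _, η.contDiff.smul contDiff_id,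
    η.hasCompactSupport.smul_right, fun v => ?_, fun v hv => ?_⟩
  · rcases le_total ‖v‖ 1 with hv | hv
    · rw [norm_smul, Real.norm_of_nonneg η.nonneg]
      exact mul_le_one₀ η.le_one (norm_nonneg _) hv
    · have hη : η v = 0 := η.zero_of_le_dist (by rwa [dist_zero_right])
      simp [hη]
  · have hη : η v = 1 := η.one_of_mem_closedBall (mem_closedBall_zero_iff.2 hv)
    simp only [hη, one_smul]

theorem exists_contDiff_integral_norm_sub_le [MeasurableSpace E] [BorelSpace E] {μ : Measure E}
    [IsLocallyFiniteMeasure μ] {f : E → E} (hf : Integrable f μ) {c : ℝ} (hc : 0 < c) (hc1 : c < 1)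
    (hfc : ∀ᵐ x ∂μ, ‖f x‖ ≤ c) {ε : ℝ} (hε : 0 < ε) :
    ∃ T : E → E, ContDiff ℝ 1 T ∧ HasCompactSupport T ∧ (∀ x, ‖T x‖ ≤ 1) ∧
      ∫ x, ‖f x - T x‖ ∂μ ≤ ε := by
  obtain ⟨θ, hθ0, hθ, hθc, hθ1, hθeq⟩ := exists_contDiff_truncation (E := E) hc hc1
  obtain ⟨L, hL⟩ := hθ.lipschitzWith_of_hasCompactSupport hθc one_ne_zero
  obtain ⟨g, hgc, hg, hfg⟩ := (memLp_one_iff_integrable.2 hf).exist_eLpNorm_sub_le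
    ENNReal.one_ne_top le_rfl (ε := ε / (L + 1)) (by positivity)
  have hgint : Integrable g μ := hg.continuous.integrable_of_hasCompactSupport hgc
  have hdiff : ∫ x, ‖f x - g x‖ ∂μ ≤ ε / (L + 1) := by
    have hfgm : AEStronglyMeasurable (fun x => f x - g x) μ := (hf.sub hgint).1
    rw [integral_norm_eq_lintegral_enorm hfgm]
    rw [eLpNorm_one_eq_lintegral_enorm] at hfg
    exact ENNReal.toReal_le_of_le_ofReal (by positivity) hfg
  refine ⟨θ ∘ g, hθ.comp (hg.of_le (by exact_mod_cast le_top)), hgc.comp_left hθ0,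
    fun x => hθ1 _, ?_⟩
  calc ∫ x, ‖f x - θ (g x)‖ ∂μ ≤ ∫ x, L * ‖f x - g x‖ ∂μ := by
        refine integral_mono_of_nonneg (Eventually.of_forall fun _ => norm_nonneg _)
          ((hf.sub hgint).norm.const_mul _) (hfc.mono fun x hx => ?_)
        simpa only [dist_eq_norm, hθeq _ hx] using hL.dist_le_mul (f x) (g x)
    _ ≤ L * (ε / (L + 1)) := by
        rw [integral_const_mul]
        exact mul_le_mul_of_nonneg_left hdiff L.coe_nonneg
    _ ≤ ε := by
        rw [mul_div_assoc', div_le_iff₀ (by positivity), mul_comm]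
        gcongr
        exact le_add_of_nonneg_right zero_le_one

end SmoothApproximation

namespace IsGaussGreenPolar

variable {Ω : Set Plane} {μ : Measure Plane} {σ f : Plane → Plane}

theorem integrable_inner (hpol : IsGaussGreenPolar Ω μ σ) (hf : Integrable f μ) :
    Integrable (fun x => inner ℝ (f x) (σ x)) μ := by
  refine hf.norm.mono' (hf.1.inner hpol.measurable.aestronglyMeasurable) ?_
  filter_upwards [hpol.ae_norm_eq_one] with x hx
  simpa only [hx, mul_one] using norm_inner_le_norm (𝕜 := ℝ) (f x) (σ x)

theorem integral_inner_le_of_norm_le_lt_one (hpol : IsGaussGreenPolar Ω μ σ)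
    (hP : perimeter Ω < ∞) (hf : Integrable f μ) {c : ℝ} (hc : 0 < c) (hc1 : c < 1)
    (hfc : ∀ᵐ x ∂μ, ‖f x‖ ≤ c) : ∫ x, inner ℝ (f x) (σ x) ∂μ ≤ (perimeter Ω).toReal := by
  have := hpol.isLocallyFiniteMeasure
  refine le_of_forall_pos_le_add fun ε hε => ?_
  obtain ⟨T, hT, hTc, hT1, hfT⟩ := exists_contDiff_integral_norm_sub_le hf hc hc1 hfc hε
  have hTint : Integrable T μ := hT.continuous.integrable_of_hasCompactSupport hTc
  have hdiv := IsTestField.setIntegral_divergence_le (T := T) ⟨hT, hTc⟩ hP hT1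
  rw [hpol.setIntegral_divergence ⟨hT, hTc⟩, one_mul] at hdiv
  have herr : ∫ x, inner ℝ (f x - T x) (σ x) ∂μ ≤ ∫ x, ‖f x - T x‖ ∂μ := by
    refine integral_mono_ae (hpol.integrable_inner (hf.sub hTint)) (hf.sub hTint).norm ?_
    filter_upwards [hpol.ae_norm_eq_one] with x hx
    simpa only [hx, mul_one] using real_inner_le_norm (f x - T x) (σ x)
  simp only [inner_sub_left] at herr
  rw [integral_sub (hpol.integrable_inner hf) (hpol.integrable_inner hTint)] at herr
  linarith

theorem measureReal_le_perimeter (hpol : IsGaussGreenPolar Ω μ σ) (hP : perimeter Ω < ∞)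
    {U : Set Plane} (hU : MeasurableSet U) (hfin : μ U < ∞) :
    μ.real U ≤ (perimeter Ω).toReal := by
  have hscaled : ∀ c : ℝ, 0 < c → c < 1 → c * μ.real U ≤ (perimeter Ω).toReal :=
      fun c hc hc1 => by
    refine le_of_eq_of_le ?_ (hpol.integral_inner_le_of_norm_le_lt_one hP
      (f := U.indicator fun x => c • σ x) ((integrable_indicator_iff hU).2
        ((hpol.integrableOn hfin).smul c)) hc hc1 ?_)
    · rw [mul_comm, ← smul_eq_mul, ← setIntegral_const, ← integral_indicator hU]
      refine integral_congr_ae (hpol.ae_norm_eq_one.mono fun x hx => ?_)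
      by_cases hxU : x ∈ U <;> simp [hxU, real_inner_smul_left, hx]
    · filter_upwards [hpol.ae_norm_eq_one] with x hx
      by_cases hxU : x ∈ U <;> simp [hxU, norm_smul, hx, abs_of_pos hc, hc.le]
  have hlim : Tendsto (fun c : ℝ => c * μ.real U) (𝓝[<] 1) (𝓝 (1 * μ.real U)) :=
    ((continuous_mul_const _).tendsto _).mono_left nhdsWithin_le_nhds
  rw [one_mul] at hlim
  exact le_of_tendsto hlim (mem_of_superset (Ioo_mem_nhdsLT zero_lt_one)
    fun c hc => hscaled c hc.1 hc.2)

theorem perimeter_le_measure_univ (hpol : IsGaussGreenPolar Ω μ σ) :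
    perimeter Ω ≤ μ Set.univ := by
  refine iSup₂_le fun T hT => ?_
  rw [hpol.setIntegral_divergence hT.1, ← lintegral_one]
  refine (Real.ofReal_le_enorm _).trans ((enorm_integral_le_lintegral_enorm _).trans
    (lintegral_mono_ae ?_))
  filter_upwards [hpol.ae_norm_eq_one] with x hx
  rw [← ofReal_norm, ← ENNReal.ofReal_one]
  refine ENNReal.ofReal_le_ofReal ((norm_inner_le_norm _ _).trans ?_)
  rw [hx, mul_one]
  exact hT.2 x

theorem perimeter_eq (hpol : IsGaussGreenPolar Ω μ σ) (hP : perimeter Ω < ∞) :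
    perimeter Ω = μ Set.univ := by
  refine le_antisymm hpol.perimeter_le_measure_univ ?_
  rw [← Metric.iUnion_ball_nat (0 : Plane), Monotone.measure_iUnion
    fun i j hij => Metric.ball_subset_ball (by exact_mod_cast hij)]
  refine iSup_le fun n => ?_
  have hfin := hpol.measure_ball_lt_top 0 (n : ℝ)
  rw [← ENNReal.toReal_le_toReal hfin.ne hP.ne]
  exact hpol.measureReal_le_perimeter hP measurableSet_ball hfin

end IsGaussGreenPolar

section HausdorffComparison

theorem ediam_closedBall_le {X : Type*} [PseudoMetricSpace X] (x : X) (s : ℝ) :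
    Metric.ediam (Metric.closedBall x s) ≤ ENNReal.ofReal (2 * s) := by
  refine Metric.ediam_le fun a ha b hb => ?_
  rw [edist_dist]
  refine ENNReal.ofReal_le_ofReal ?_
  rw [Metric.mem_closedBall] at ha hb
  linarith [dist_triangle_right a b x]

variable {X : Type*} [MetricSpace X] [MeasurableSpace X] {μ : Measure X} {A U : Set X}
  {C : ℝ≥0∞}

theorem le_mul_measure_of_forall_isOpen [μ.OuterRegular]
    {a : ℝ≥0∞} (hC : C ≠ ∞) (hA : μ A ≠ ∞)
    (h : ∀ U, IsOpen U → A ⊆ U → a ≤ C * μ U) : a ≤ C * μ A := by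
  have hlim : Tendsto (fun ε : ℝ≥0∞ => C * (μ A + ε)) (𝓝[>] 0) (𝓝 (C * μ A)) := by
    have hcont : Tendsto (fun ε : ℝ≥0∞ => C * (μ A + ε)) (𝓝 0) (𝓝 (C * (μ A + 0))) :=
      ENNReal.Tendsto.const_mul (tendsto_const_nhds.add tendsto_id) (Or.inr hC)
    rw [add_zero] at hcont
    exact hcont.mono_left nhdsWithin_le_nhds
  refine ge_of_tendsto hlim (eventually_mem_nhdsWithin.mono fun ε hε => ?_)
  obtain ⟨U, hAU, hU, hμU⟩ := A.exists_isOpen_lt_of_lt _ (ENNReal.lt_add_right hA hε.ne')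
  exact (h U hU hAU).trans (by gcongr)

theorem exists_radius_of_density (hAU : A ⊆ U) (hU : IsOpen U)
    (h : ∀ y ∈ A, ∀ᶠ s in 𝓝[>] (0 : ℝ),
      ENNReal.ofReal (2 * s) ≤ C * μ (Metric.closedBall y s)) {δ : ℝ} (hδ : 0 < δ) :
    ∃ R : X → ℝ, ∀ y ∈ A, 0 < R y ∧ R y ≤ δ ∧ ∀ s, 0 < s → s ≤ R y →
      Metric.closedBall y s ⊆ U ∧ ENNReal.ofReal (2 * s) ≤ C * μ (Metric.closedBall y s) := by
  have hex : ∀ y, ∃ R : ℝ, y ∈ A → 0 < R ∧ R ≤ δ ∧ ∀ s, 0 < s → s ≤ R →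
      Metric.closedBall y s ⊆ U ∧ ENNReal.ofReal (2 * s) ≤ C * μ (Metric.closedBall y s) := by
    intro y
    by_cases hy : y ∈ A
    · have hsub : ∀ᶠ s in 𝓝[>] (0 : ℝ), Metric.closedBall y s ⊆ U :=
        nhdsWithin_le_nhds (eventually_closedBall_subset (hU.mem_nhds (hAU hy)))
      obtain ⟨R, hR, hRδ⟩ := ((eventually_nhdsGT_zero_forall_le (hsub.and (h y hy))).and
        (Ioc_mem_nhdsGT hδ)).exists
      exact ⟨R, fun _ => ⟨hRδ.1, hRδ.2, hR⟩⟩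
    · exact ⟨0, fun hyA => absurd hyA hy⟩
  exact Classical.skolem.1 hex

variable [BorelSpace X]

theorem measure_le_mul_hausdorffMeasure_of_ediam_le {d : ℝ} {c δ : ℝ≥0∞} (hc0 : c ≠ 0)
    (hc : c ≠ ∞) (hδ : 0 < δ)
    (h : ∀ S, (S ∩ A).Nonempty → Metric.ediam S ≤ δ → μ S ≤ c * Metric.ediam S ^ d) :
    μ A ≤ c * Measure.hausdorffMeasure d A := by
  have hclosure : ∀ S, Metric.ediam S ≤ δ → μ.restrict A S ≤ c * Metric.ediam S ^ d := by
    intro S hS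
    refine (measure_mono subset_closure).trans ?_
    rw [Measure.restrict_apply isClosed_closure.measurableSet]
    rcases (closure S ∩ A).eq_empty_or_nonempty with hempty | hne
    · simp [hempty]
    · have hle := h _ hne ((Metric.ediam_closure S).trans_le hS)
      rw [Metric.ediam_closure] at hle
      exact (measure_mono Set.inter_subset_left).trans hle
  have hle : c⁻¹ • μ.restrict A ≤ Measure.hausdorffMeasure d := by
    refine Measure.le_hausdorffMeasure d _ δ hδ fun S hS => ?_
    rw [Measure.smul_apply, smul_eq_mul, ENNReal.inv_mul_le_iff hc0 hc]
    exact hclosure S hS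
  have hA := hle A
  rwa [Measure.smul_apply, smul_eq_mul, ENNReal.inv_mul_le_iff hc0 hc,
    Measure.restrict_apply_self] at hA

theorem measure_le_mul_hausdorffMeasure {c : ℝ} (hc : 0 < c)
    (h : ∀ y ∈ A, ∀ᶠ d in 𝓝[>] (0 : ℝ), ∀ S : Set X, y ∈ S →
      (∀ x ∈ S, ∀ x' ∈ S, dist x x' ≤ d) → μ S ≤ ENNReal.ofReal (c * d)) :
    μ A ≤ ENNReal.ofReal c * Measure.hausdorffMeasure 1 A := by
  let p : ℕ → X → Prop := fun k y => ∀ d : ℝ, 0 < d → d ≤ 1 / ((k : ℝ) + 1) → ∀ S : Set X, y ∈ S →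
      (∀ x ∈ S, ∀ x' ∈ S, dist x x' ≤ d) → μ S ≤ ENNReal.ofReal (c * d)
  have hA : A = ⋃ k : ℕ, {y ∈ A | p k y} := by
    ext y
    simp only [Set.mem_iUnion]
    refine ⟨fun hy => ?_, fun ⟨k, hk⟩ => hk.1⟩
    obtain ⟨r, hr, hsub⟩ := mem_nhdsGT_iff_exists_Ioc_subset.1 (h y hy)
    obtain ⟨k, hk⟩ := exists_nat_one_div_lt (Set.mem_Ioi.1 hr)
    exact ⟨k, hy, fun d hd hdk => hsub ⟨hd, hdk.trans hk.le⟩⟩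
  have hmono : Monotone fun k : ℕ => {y ∈ A | p k y} := by
    intro k l hkl y hy
    refine ⟨hy.1, fun d hd hdl => hy.2 d hd (hdl.trans ?_)⟩
    gcongr
  conv_lhs => rw [hA]
  rw [hmono.measure_iUnion]
  refine iSup_le fun k => ?_
  refine le_trans ?_ (mul_le_mul_right (measure_mono (Set.sep_subset A (p k))) _)
  have hk : 0 < 1 / (2 * ((k : ℝ) + 1)) := by positivity
  refine measure_le_mul_hausdorffMeasure_of_ediam_le (ENNReal.ofReal_pos.2 hc).ne'
    ENNReal.ofReal_ne_top (ENNReal.ofReal_pos.2 hk) ?_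
  rintro S ⟨y, hyS, hy⟩ hS
  have hfin : Metric.ediam S ≠ ∞ := (hS.trans_lt ENNReal.ofReal_lt_top).ne
  have hlt : (Metric.ediam S).toReal < 1 / ((k : ℝ) + 1) := by
    refine (ENNReal.toReal_le_of_le_ofReal hk.le hS).trans_lt ?_
    gcongr
    linarith [k.cast_nonneg (α := ℝ)]
  have hev : ∀ᶠ d in 𝓝[>] (Metric.ediam S).toReal, μ S ≤ ENNReal.ofReal (c * d) := by
    filter_upwards [Ioo_mem_nhdsGT hlt] with d hd
    refine hy.2 d (ENNReal.toReal_nonneg.trans_lt hd.1) hd.2.le _ hyS fun x hx x' hx' => ?_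
    rw [dist_edist]
    exact (ENNReal.toReal_mono hfin (Metric.edist_le_ediam_of_mem hx hx')).trans hd.1.le
  have hlim : Tendsto (fun d => ENNReal.ofReal (c * d)) (𝓝[>] (Metric.ediam S).toReal)
      (𝓝 (ENNReal.ofReal (c * (Metric.ediam S).toReal))) :=
    (ENNReal.continuous_ofReal.comp (continuous_const_mul c)).continuousWithinAt.tendsto
  refine (ge_of_tendsto hlim hev).trans_eq ?_
  rw [ENNReal.ofReal_mul hc.le, ENNReal.ofReal_toReal hfin, ENNReal.rpow_one]

theorem hausdorffMeasure_le_of_closedBall_covering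
    (h : ∀ n : ℕ, ∃ (u : Set X) (r : X → ℝ), u.Countable ∧ (∀ x ∈ u, r x ≤ 1 / ((n : ℝ) + 1)) ∧
      A ⊆ (⋃ x ∈ u, Metric.closedBall x (r x)) ∧ ∑' x : u, ENNReal.ofReal (2 * r x) ≤ C) :
    Measure.hausdorffMeasure 1 A ≤ C := by
  choose u r hu hr hA hC using h
  have := fun n => (hu n).to_subtype
  have hlim : Tendsto (fun n : ℕ => ENNReal.ofReal (2 * (1 / ((n : ℝ) + 1)))) atTop (𝓝 0) := by
    simpa using ENNReal.tendsto_ofReal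
      ((tendsto_one_div_add_atTop_nhds_zero_nat (𝕜 := ℝ)).const_mul 2)
  refine (Measure.hausdorffMeasure_le_liminf_tsum 1 A (l := atTop) _ hlim
    (fun n (x : u n) => Metric.closedBall (x : X) (r n x)) ?_ ?_).trans ?_
  · refine Eventually.of_forall fun n x =>
      (ediam_closedBall_le _ _).trans (ENNReal.ofReal_le_ofReal ?_)
    linarith [hr n x x.2]
  · refine Eventually.of_forall fun n => ?_
    rw [← Set.biUnion_eq_iUnion (u n) fun x _ => Metric.closedBall x (r n x)]
    exact hA n
  · refine liminf_le_of_le (by isBoundedDefault) fun b hb => ?_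
    obtain ⟨n, hn⟩ := hb.exists
    refine hn.trans (le_trans (ENNReal.tsum_le_tsum fun x => ?_) (hC n))
    rw [ENNReal.rpow_one]
    exact ediam_closedBall_le _ _

theorem tsum_ofReal_le_of_pairwiseDisjoint {u : Set X} {r : X → ℝ} (hu : u.Countable)
    (hd : u.PairwiseDisjoint fun x => Metric.closedBall x (r x))
    (h : ∀ x ∈ u, Metric.closedBall x (r x) ⊆ U ∧
      ENNReal.ofReal (2 * r x) ≤ C * μ (Metric.closedBall x (r x))) :
    ∑' x : u, ENNReal.ofReal (2 * r x) ≤ C * μ U := by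
  refine (ENNReal.tsum_le_tsum fun x : u => (h x x.2).2).trans ?_
  rw [ENNReal.tsum_mul_left,
    ← measure_biUnion hu hd fun x _ => Metric.isClosed_closedBall.measurableSet]
  exact mul_le_mul_right (measure_mono (Set.iUnion₂_subset fun x hx => (h x hx).1)) _

variable [SecondCountableTopology X]

theorem hausdorffMeasure_le_five_mul_of_density (hAU : A ⊆ U) (hU : IsOpen U)
    (h : ∀ y ∈ A, ∀ᶠ s in 𝓝[>] (0 : ℝ),
      ENNReal.ofReal (2 * s) ≤ C * μ (Metric.closedBall y s)) :
    Measure.hausdorffMeasure 1 A ≤ 5 * (C * μ U) := by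
  refine hausdorffMeasure_le_of_closedBall_covering fun n => ?_
  obtain ⟨R, hR⟩ := exists_radius_of_density hAU hU h
    (show 0 < 1 / (5 * ((n : ℝ) + 1)) by positivity)
  obtain ⟨u, huA, hdis, hcov⟩ := Vitali.exists_disjoint_subfamily_covering_enlargement_closedBall
    A id R _ (fun y hy => (hR y hy).2.1) 5 (by norm_num)
  have hcount : u.Countable := hdis.countable_of_nonempty_interior fun y hy =>
    ⟨y, Metric.ball_subset_interior_closedBall (Metric.mem_ball_self (hR y (huA hy)).1)⟩
  refine ⟨u, fun y => 5 * R y, hcount, fun y hy => ?_, fun y hy => ?_, ?_⟩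
  · have hle := (hR y (huA hy)).2.1
    rw [one_div, mul_inv, ← one_div ((n : ℝ) + 1)] at hle
    linarith
  · obtain ⟨b, hb, hsub⟩ := hcov y hy
    exact Set.mem_biUnion hb (hsub (Metric.mem_closedBall_self (hR y hy).1.le))
  · have hmul : ∀ x : u, ENNReal.ofReal (2 * (5 * R x)) = 5 * ENNReal.ofReal (2 * R x) := by
      intro x
      rw [mul_left_comm, ENNReal.ofReal_mul (by norm_num), ENNReal.ofReal_ofNat]
    simp_rw [hmul, ENNReal.tsum_mul_left]
    exact mul_le_mul_right (tsum_ofReal_le_of_pairwiseDisjoint hcount hdis fun x hx =>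
      (hR x (huA hx)).2.2 _ (hR x (huA hx)).1 le_rfl) _

theorem hausdorffMeasure_eq_zero_of_density [μ.OuterRegular] (hC : C ≠ ∞)
    (h : ∀ y ∈ A, ∀ᶠ s in 𝓝[>] (0 : ℝ),
      ENNReal.ofReal (2 * s) ≤ C * μ (Metric.closedBall y s)) (hA : μ A = 0) :
    Measure.hausdorffMeasure 1 A = 0 := by
  refine nonpos_iff_eq_zero.1 ?_
  have hle : Measure.hausdorffMeasure 1 A ≤ 5 * C * μ A :=
    le_mul_measure_of_forall_isOpen (ENNReal.mul_ne_top (by norm_num) hC) (by simp [hA])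
      fun U hU hAU => by
        rw [mul_assoc]
        exact hausdorffMeasure_le_five_mul_of_density hAU hU h
  simpa [hA] using hle

variable [HasBesicovitchCovering X] [SFinite μ]

theorem exists_closedBall_covering_ae_of_density (hAU : A ⊆ U) (hU : IsOpen U)
    (h : ∀ y ∈ A, ∀ᶠ s in 𝓝[>] (0 : ℝ),
      ENNReal.ofReal (2 * s) ≤ C * μ (Metric.closedBall y s)) {δ : ℝ} (hδ : 0 < δ) :
    ∃ (t : Set X) (r : X → ℝ), t.Countable ∧ (∀ x ∈ t, r x ≤ δ) ∧
      μ (A \ ⋃ x ∈ t, Metric.closedBall x (r x)) = 0 ∧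
      ∑' x : t, ENNReal.ofReal (2 * r x) ≤ C * μ U := by
  obtain ⟨R, hR⟩ := exists_radius_of_density hAU hU h hδ
  obtain ⟨t, r, ht, htA, hr, hnull, hdis⟩ := Besicovitch.exists_disjoint_closedBall_covering_ae μ
    (fun _ => Set.univ) A (fun x _ δ hδ => by simpa using Set.nonempty_Ioo.2 hδ) R
    (fun y hy => (hR y hy).1)
  exact ⟨t, r, ht, fun x hx => (hr x hx).2.2.le.trans (hR x (htA hx)).2.1, hnull,
    tsum_ofReal_le_of_pairwiseDisjoint ht hdis fun x hx =>
      (hR x (htA hx)).2.2 _ (hr x hx).2.1 (hr x hx).2.2.le⟩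

-- Besicovitch's covering misses a `μ`-null part of `A`; Vitali's covering, at the cost of a
-- factor `5`, shows that this part is also null for the Hausdorff measure.
theorem hausdorffMeasure_le_mul_measure [μ.OuterRegular] (hC : C ≠ ∞)
    (h : ∀ y ∈ A, ∀ᶠ s in 𝓝[>] (0 : ℝ),
      ENNReal.ofReal (2 * s) ≤ C * μ (Metric.closedBall y s)) (hA : μ A ≠ ∞) :
    Measure.hausdorffMeasure 1 A ≤ C * μ A := by
  refine le_mul_measure_of_forall_isOpen hC hA fun U hU hAU => ?_
  choose t r ht hr hnull hsum using fun n : ℕ => exists_closedBall_covering_ae_of_density hAU hU h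
    (Nat.one_div_pos_of_nat (α := ℝ) (n := n))
  let G : ℕ → Set X := fun n => ⋃ x ∈ t n, Metric.closedBall x (r n x)
  have hsub : A ⊆ (A ∩ ⋂ n, G n) ∪ ⋃ n, A \ G n := by
    rw [← Set.sdiff_iInter, Set.inter_union_sdiff]
  have hnull' : Measure.hausdorffMeasure 1 (⋃ n, A \ G n) = 0 :=
    measure_iUnion_null fun n => hausdorffMeasure_eq_zero_of_density hC
      (fun y hy => h y hy.1) (hnull n)
  refine (measure_mono hsub).trans ((measure_union_le _ _).trans ?_)
  rw [hnull', add_zero]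
  exact hausdorffMeasure_le_of_closedBall_covering fun n =>
    ⟨t n, r n, ht n, hr n, fun x hx => Set.mem_iInter.1 hx.2 n, hsum n⟩

end HausdorffComparison

section ReducedBoundary

variable {Ω : Set Plane} {μ : Measure Plane} {σ : Plane → Plane} {y ν : Plane}

theorem iUnion_closedBall_eq_ball {X : Type*} [PseudoMetricSpace X] (y : X) {r : ℝ} {s : ℕ → ℝ}
    (hs : ∀ n, s n < r) (hlim : Tendsto s atTop (𝓝 r)) :
    ⋃ n, Metric.closedBall y (s n) = Metric.ball y r := by
  ext x
  simp only [Set.mem_iUnion, Metric.mem_closedBall, Metric.mem_ball]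
  refine ⟨fun ⟨n, hn⟩ => hn.trans_lt (hs n), fun hx => ?_⟩
  obtain ⟨n, hn⟩ := (hlim.eventually (lt_mem_nhds hx)).exists
  exact ⟨n, hn.le⟩

theorem tendsto_setAverage_iUnion {X E : Type*} [MeasurableSpace X] [NormedAddCommGroup E]
    [NormedSpace ℝ E] {μ : Measure X} {f : X → E} {s : ℕ → Set X}
    (hs : ∀ n, MeasurableSet (s n)) (hmono : Monotone s) (hf : IntegrableOn f (⋃ n, s n) μ)
    (h0 : μ (⋃ n, s n) ≠ 0) (hfin : μ (⋃ n, s n) ≠ ∞) :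
    Tendsto (fun n => ⨍ x in s n, f x ∂μ) atTop (𝓝 (⨍ x in ⋃ n, s n, f x ∂μ)) := by
  have hreal : Tendsto (fun n => μ.real (s n)) atTop (𝓝 (μ.real (⋃ n, s n))) :=
    (ENNReal.tendsto_toReal hfin).comp (tendsto_measure_iUnion_atTop hmono)
  simp_rw [setAverage_eq]
  exact (hreal.inv₀ (ENNReal.toReal_pos h0 hfin).ne').smul
    (tendsto_setIntegral_of_monotone hs hmono hf)

namespace IsGaussGreenPolar

theorem tendsto_average_ball (hpol : IsGaussGreenPolar Ω μ σ)
    (hpos : ∀ r : ℝ, 0 < r → 0 < μ (Metric.ball y r))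
    (h : Tendsto (fun r : ℝ => ⨍ x in Metric.closedBall y r, σ x ∂μ) (𝓝[>] 0) (𝓝 ν)) :
    Tendsto (fun r : ℝ => ⨍ x in Metric.ball y r, σ x ∂μ) (𝓝[>] 0) (𝓝 ν) := by
  rw [Metric.nhds_basis_closedBall.tendsto_right_iff] at h ⊢
  intro ε hε
  filter_upwards [eventually_nhdsGT_zero_forall_le (h ε hε), self_mem_nhdsWithin] with r hr hr0
  obtain ⟨s, hsm, hs, hlim⟩ := exists_seq_strictMono_tendsto' (Set.mem_Ioi.1 hr0)
  have hball := iUnion_closedBall_eq_ball y (fun n => (hs n).2) hlim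
  have hfin := hpol.measure_ball_lt_top y r
  have hav := tendsto_setAverage_iUnion (μ := μ) (f := σ)
    (s := fun n => Metric.closedBall y (s n)) (fun n => measurableSet_closedBall)
    (fun m n hmn => Metric.closedBall_subset_closedBall (hsm.monotone hmn))
    (by rw [hball]; exact hpol.integrableOn hfin) (by rw [hball]; exact (hpos r hr0).ne')
    (by rw [hball]; exact hfin.ne)
  rw [hball] at hav
  exact Metric.isClosed_closedBall.mem_of_tendsto hav
    (Eventually.of_forall fun n => hr _ (hs n).1 (hs n).2.le)

theorem ae_isNormalAt (hpol : IsGaussGreenPolar Ω μ σ) : ∀ᵐ y ∂μ, IsNormalAt μ σ y (σ y) := by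
  have := hpol.isLocallyFiniteMeasure
  have hloc : LocallyIntegrable σ μ := fun x =>
    ⟨Metric.ball x 1, Metric.ball_mem_nhds x one_pos,
      hpol.integrableOn (hpol.measure_ball_lt_top x 1)⟩
  filter_upwards [(Besicovitch.vitaliFamily μ).ae_tendsto_average hloc, hpol.ae_norm_eq_one,
    Measure.support_mem_ae (μ := μ)] with y hav hnorm hsupp
  have hpos : ∀ r : ℝ, 0 < r → 0 < μ (Metric.ball y r) := fun r hr =>
    (Measure.mem_support_iff_forall y).1 hsupp _ (Metric.ball_mem_nhds y hr)
  exact ⟨hpos, hpol.tendsto_average_ball hpos (hav.comp (Besicovitch.tendsto_filterAt μ y)), hnorm⟩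

theorem isOutwardNormal_iff (hpol : IsGaussGreenPolar Ω μ σ) :
    IsOutwardNormal Ω y ν ↔ IsNormalAt μ σ y ν := by
  refine ⟨fun ⟨μ', σ', hpol', hpos, hav, hnorm⟩ => ?_,
    fun h => ⟨μ, σ, hpol, h.measure_ball_pos, h.tendsto_average, h.norm_eq_one⟩⟩
  obtain ⟨rfl, hσ⟩ := hpol.unique hpol'
  exact ⟨hpos, hav.congr fun r => average_congr (ae_restrict_of_ae hσ.symm), hnorm⟩

theorem outwardNormal_eq (hpol : IsGaussGreenPolar Ω μ σ) (hn : IsNormalAt μ σ y ν) :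
    outwardNormal Ω y = ν := by
  have hex : ∃ ν, IsOutwardNormal Ω y ν := ⟨ν, hpol.isOutwardNormal_iff.2 hn⟩
  rw [outwardNormal, dif_pos hex]
  exact tendsto_nhds_unique (hpol.isOutwardNormal_iff.1 hex.choose_spec).tendsto_average
    hn.tendsto_average

theorem ae_mem_reducedBoundary (hpol : IsGaussGreenPolar Ω μ σ) :
    ∀ᵐ y ∂μ, y ∈ reducedBoundary Ω ∧ outwardNormal Ω y = σ y ∧ ‖σ y‖ = 1 := by
  filter_upwards [hpol.ae_isNormalAt] with y hy
  exact ⟨⟨_, hpol.isOutwardNormal_iff.2 hy⟩, hpol.outwardNormal_eq hy, hy.norm_eq_one⟩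

theorem hausdorffMeasure_le (hpol : IsGaussGreenPolar Ω μ σ) (hΩ : MeasurableSet Ω)
    {A : Set Plane} (hA : A ⊆ reducedBoundary Ω) (hfin : μ A ≠ ∞) :
    Measure.hausdorffMeasure 1 A ≤ μ A := by
  have := hpol.isLocallyFiniteMeasure
  have hlim : Tendsto (fun η : ℝ => ENNReal.ofReal (2 / (2 - η)) * μ A) (𝓝[>] 0) (𝓝 (μ A)) := by
    have hcont : ContinuousAt (fun η : ℝ => 2 / (2 - η)) 0 :=
      continuousAt_const.div (by fun_prop) (by norm_num)
    simpa using ENNReal.Tendsto.mul_const (b := μ A) (ENNReal.tendsto_ofReal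
      (hcont.tendsto.mono_left (nhdsWithin_le_nhds (s := Set.Ioi 0)))) (Or.inr hfin)
  refine ge_of_tendsto hlim ?_
  filter_upwards [Ioo_mem_nhdsGT (zero_lt_one (α := ℝ))] with η hη
  have hη2 : 0 < 2 - η := by linarith [hη.2]
  refine hausdorffMeasure_le_mul_measure ENNReal.ofReal_ne_top (fun y hy => ?_) hfin
  obtain ⟨ν, hν⟩ := hA hy
  filter_upwards [(hpol.isOutwardNormal_iff.1 hν).eventually_le_measureReal_ball hpol hΩ hη.1]
    with s hs
  calc ENNReal.ofReal (2 * s)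
      ≤ ENNReal.ofReal (2 / (2 - η) * μ.real (Metric.ball y s)) := by
        refine ENNReal.ofReal_le_ofReal ?_
        rw [div_mul_eq_mul_div, le_div_iff₀ hη2]
        linarith
    _ = ENNReal.ofReal (2 / (2 - η)) * μ (Metric.ball y s) := by
        rw [ENNReal.ofReal_mul (by positivity),
          ofReal_measureReal (hpol.measure_ball_lt_top y s).ne]
    _ ≤ ENNReal.ofReal (2 / (2 - η)) * μ (Metric.closedBall y s) := by
        gcongr
        exact Metric.ball_subset_closedBall

theorem le_hausdorffMeasure (hpol : IsGaussGreenPolar Ω μ σ) (hΩ : MeasurableSet Ω)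
    {A : Set Plane} (hA : A ⊆ reducedBoundary Ω) : μ A ≤ Measure.hausdorffMeasure 1 A := by
  by_cases htop : Measure.hausdorffMeasure 1 A = ∞
  · exact htop ▸ le_top
  have hlim : Tendsto (fun η : ℝ => ENNReal.ofReal (1 + η) * Measure.hausdorffMeasure 1 A)
      (𝓝[>] 0) (𝓝 (Measure.hausdorffMeasure 1 A)) := by
    have hcont : ContinuousAt (fun η : ℝ => 1 + η) 0 := by fun_prop
    simpa using ENNReal.Tendsto.mul_const (b := Measure.hausdorffMeasure 1 A)
      (ENNReal.tendsto_ofReal (hcont.tendsto.mono_left (nhdsWithin_le_nhds (s := Set.Ioi 0))))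
      (Or.inr htop)
  refine ge_of_tendsto hlim (eventually_mem_nhdsWithin.mono fun η (hη : 0 < η) => ?_)
  refine measure_le_mul_hausdorffMeasure (by linarith) fun y hy => ?_
  obtain ⟨ν, hν⟩ := hA hy
  exact (hpol.isOutwardNormal_iff.1 hν).eventually_measure_le hpol hΩ hη

/-- De Giorgi's structure theorem. Near every point of `∂*Ω` the measures `μ` and `ℋ¹` agree up to
factors arbitrarily close to `1` in both directions, by the rectangle and ball estimates. -/
theorem restrict_hausdorffMeasure (hpol : IsGaussGreenPolar Ω μ σ) (hΩ : MeasurableSet Ω)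
    (hfin : μ Set.univ ≠ ∞) :
    (Measure.hausdorffMeasure 1).restrict (reducedBoundary Ω) = μ := by
  refine Measure.ext fun B hB => ?_
  have hsub : B ∩ reducedBoundary Ω ⊆ reducedBoundary Ω := Set.inter_subset_right
  rw [Measure.restrict_apply hB, le_antisymm (hpol.hausdorffMeasure_le hΩ hsub
    (measure_ne_top_of_subset (Set.subset_univ _) hfin)) (hpol.le_hausdorffMeasure hΩ hsub)]
  refine measure_congr ?_
  filter_upwards [hpol.ae_mem_reducedBoundary] with y hy
  exact propext ⟨fun h => h.1, fun h => ⟨h, hy.1⟩⟩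

end IsGaussGreenPolar

end ReducedBoundary

section Kernel

variable {κ : ℝ} {s : Plane}

theorem integrable_exp_neg_norm (hκ : 0 < κ) :
    Integrable (fun z : Plane => Real.exp (-(κ * ‖z‖))) := by
  refine (integrable_fun_norm_addHaar (volume : Measure Plane)
    (f := fun r => Real.exp (-(κ * r)))).2 ?_
  simpa [finrank_euclideanSpace] using
    integrableOn_rpow_mul_exp_neg_mul_rpow (s := 1) (p := 1) (by norm_num) one_pos hκ

/-- The screened Coulomb kernel `e^{-κ|z|} / |z|`, with the junk value `0` at `z = 0`. -/
def screenedKernel (κ : ℝ) (z : Plane) : ℝ := Real.exp (-(κ * ‖z‖)) / ‖z‖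

theorem screenedKernel_nonneg (κ : ℝ) (z : Plane) : 0 ≤ screenedKernel κ z := by
  unfold screenedKernel
  positivity

theorem screenedKernel_neg (κ : ℝ) (z : Plane) : screenedKernel κ (-z) = screenedKernel κ z := by
  simp only [screenedKernel, norm_neg]

theorem measurable_screenedKernel (κ : ℝ) : Measurable (screenedKernel κ) := by
  unfold screenedKernel
  fun_prop

theorem norm_mul_screenedKernel_le (κ : ℝ) (z : Plane) :
    ‖z‖ * screenedKernel κ z ≤ Real.exp (-(κ * ‖z‖)) := by
  rcases eq_or_ne z 0 with rfl | hz
  · simp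
  · exact (mul_div_cancel₀ _ (norm_ne_zero_iff.2 hz)).le

theorem integrable_screenedKernel (hκ : 0 < κ) : Integrable (screenedKernel κ) := by
  refine (integrable_fun_norm_addHaar (volume : Measure Plane)
    (f := fun r => Real.exp (-(κ * r)) / r)).2 ?_
  refine (exp_neg_integrableOn_Ioi 0 hκ).congr_fun (fun r hr => ?_) measurableSet_Ioi
  have hr0 : r ≠ 0 := (Set.mem_Ioi.1 hr).ne'
  simp [finrank_euclideanSpace, mul_div_cancel₀ _ hr0]

/-- The kernel `(s ⋅ z) e^{-κ|z|} / (κ|z|²)`, a radial average of the first moment of the screened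
Coulomb kernel. It has the junk value `0` at `z = 0`. -/
def flux (κ : ℝ) (s z : Plane) : ℝ :=
  inner ℝ s z * (Real.exp (-(κ * ‖z‖)) / (κ * ‖z‖ ^ 2))

theorem measurable_flux (κ : ℝ) {X : Type*} [MeasurableSpace X] {s z : X → Plane}
    (hs : Measurable s) (hz : Measurable z) : Measurable fun x => flux κ (s x) (z x) := by
  unfold flux
  fun_prop

theorem flux_neg (κ : ℝ) (s z : Plane) : flux κ s (-z) = -flux κ s z := by
  simp [flux]

theorem inner_e₂ (z : Plane) : inner ℝ e₂ z = z 1 := by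
  simp [e₂, PiLp.inner_apply, Fin.sum_univ_two]

theorem flux_rotate (κ : ℝ) (hs : ‖s‖ = 1) (z : Plane) : flux κ e₂ (rotate s z) = flux κ s z := by
  rw [flux, flux, norm_rotate hs, inner_e₂, rotate_apply_one]

theorem abs_flux (hκ : 0 < κ) (s z : Plane) :
    |flux κ s z| = |inner ℝ s z| * (Real.exp (-(κ * ‖z‖)) / (κ * ‖z‖ ^ 2)) := by
  rw [flux, abs_mul, abs_of_nonneg (a := Real.exp (-(κ * ‖z‖)) / (κ * ‖z‖ ^ 2)) (by positivity)]

theorem abs_flux_le (hκ : 0 < κ) (hs : ‖s‖ = 1) (z : Plane) :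
    |flux κ s z| ≤ κ⁻¹ * screenedKernel κ z := by
  have hinner := abs_real_inner_le_norm s z
  rw [hs, one_mul] at hinner
  rcases eq_or_ne z 0 with rfl | hz
  · simp [flux, screenedKernel]
  calc |flux κ s z| ≤ ‖z‖ * (Real.exp (-(κ * ‖z‖)) / (κ * ‖z‖ ^ 2)) := by
        rw [abs_flux hκ]
        gcongr
    _ = κ⁻¹ * screenedKernel κ z := by
        unfold screenedKernel
        field_simp [norm_ne_zero_iff.2 hz]

theorem integrable_flux (hκ : 0 < κ) (hs : ‖s‖ = 1) : Integrable (flux κ s) :=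
  ((integrable_screenedKernel hκ).const_mul κ⁻¹).mono'
    (measurable_flux κ measurable_const measurable_id).aestronglyMeasurable
    (Eventually.of_forall (abs_flux_le hκ hs))

theorem integral_flux (κ : ℝ) (s : Plane) : ∫ z, flux κ s z = 0 := by
  have h := integral_neg_eq_self (flux κ s) volume
  simp_rw [flux_neg, integral_neg] at h
  linarith

theorem integral_abs_sin : ∫ θ in Set.Ioo (-Real.pi) Real.pi, |Real.sin θ| = 4 := by
  have hπ := Real.pi_pos
  rw [← integral_Ioc_eq_integral_Ioo, ← intervalIntegral.integral_of_le (by linarith),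
    ← intervalIntegral.integral_add_adjacent_intervals (b := 0)
      (Real.continuous_sin.abs.intervalIntegrable _ _)
      (Real.continuous_sin.abs.intervalIntegrable _ _)]
  have hleft : ∫ θ in (-Real.pi)..0, |Real.sin θ| = ∫ θ in (-Real.pi)..0, -Real.sin θ := by
    refine intervalIntegral.integral_congr fun θ hθ => ?_
    rw [Set.uIcc_of_le (by linarith)] at hθ
    exact abs_of_nonpos (Real.sin_nonpos_of_nonpos_of_neg_pi_le hθ.2 hθ.1)
  have hright : ∫ θ in (0 : ℝ)..Real.pi, |Real.sin θ| = ∫ θ in (0 : ℝ)..Real.pi, Real.sin θ := by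
    refine intervalIntegral.integral_congr fun θ hθ => ?_
    rw [Set.uIcc_of_le hπ.le] at hθ
    exact abs_of_nonneg (Real.sin_nonneg_of_nonneg_of_le_pi hθ.1 hθ.2)
  rw [hleft, hright, intervalIntegral.integral_neg, integral_sin, integral_sin]
  norm_num

theorem integral_eq_integral_polarCoord (f : Plane → ℝ) :
    ∫ z, f z = ∫ p in Set.Ioi (0 : ℝ) ×ˢ Set.Ioo (-Real.pi) Real.pi,
      p.1 * f !₂[p.1 * Real.cos p.2, p.1 * Real.sin p.2] := by
  have hprod := ((volume_preserving_finTwoArrow ℝ).comp (PiLp.volume_preserving_ofLp (Fin 2)))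
    |>.integral_comp ((MeasurableEquiv.toLp 2 (Fin 2 → ℝ)).symm.trans
      MeasurableEquiv.finTwoArrow).measurableEmbedding (fun p : ℝ × ℝ => f !₂[p.1, p.2])
  have heta : ∀ z : Plane, f z = f !₂[z 0, z 1] := fun z => by
    congr 1
    ext i
    fin_cases i <;> rfl
  rw [integral_congr_ae (Eventually.of_forall heta), ← polarCoord_target]
  exact hprod.trans (integral_comp_polarCoord_symm _).symm

theorem integral_abs_flux (hκ : 0 < κ) (hs : ‖s‖ = 1) : ∫ z, |flux κ s z| = 4 / κ ^ 2 := by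
  have hpolar : ∀ p ∈ Set.Ioi (0 : ℝ) ×ˢ Set.Ioo (-Real.pi) Real.pi,
      p.1 * |flux κ e₂ !₂[p.1 * Real.cos p.2, p.1 * Real.sin p.2]| =
        (κ⁻¹ * Real.exp (-κ * p.1)) * |Real.sin p.2| := by
    rintro ⟨r, θ⟩ ⟨hr, -⟩
    have hr : 0 < r := hr
    have hnorm : ‖!₂[r * Real.cos θ, r * Real.sin θ]‖ = r := by
      rw [← sq_eq_sq₀ (norm_nonneg _) hr.le, norm_sq_eq]
      simp only [Matrix.cons_val_zero, Matrix.cons_val_one, mul_pow, ← mul_add,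
        Real.cos_sq_add_sin_sq, mul_one]
    simp only [abs_flux hκ, hnorm, inner_e₂, Matrix.cons_val_one, Matrix.cons_val_fin_one,
      abs_mul, abs_of_pos hr, neg_mul]
    field_simp
  have hrot : ∫ z, |flux κ s z| = ∫ z, |flux κ e₂ z| := by
    simp_rw [← flux_rotate κ hs]
    exact (rotateEquiv s hs).measurePreserving.integral_comp
      (rotateEquiv s hs).toHomeomorph.measurableEmbedding (fun z => |flux κ e₂ z|)
  rw [hrot, integral_eq_integral_polarCoord,
    setIntegral_congr_fun (measurableSet_Ioi.prod measurableSet_Ioo) hpolar,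
    Measure.volume_eq_prod,
    setIntegral_prod_mul (fun r => κ⁻¹ * Real.exp (-κ * r)) (fun θ => |Real.sin θ|),
    integral_abs_sin, integral_const_mul, integral_exp_mul_Ioi (by linarith), mul_zero,
    Real.exp_zero]
  field_simp

theorem hasDerivAt_exp_neg_div {a t : ℝ} (ha : a ≠ 0) (ht : t ≠ 0) :
    HasDerivAt (fun t => Real.exp (-(a / t)) / a) (Real.exp (-(a / t)) / t ^ 2) t := by
  have h : HasDerivAt (fun t => Real.exp (-(a / t)) / a)
      (Real.exp (-(a / t)) * (-(a * -(t ^ 2)⁻¹)) / a) t := by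
    simp_rw [div_eq_mul_inv a]
    exact (((hasDerivAt_inv ht).const_mul a).neg.exp).div_const a
  convert h using 1
  field_simp

theorem hasIntegral_exp_neg_div {a : ℝ} (ha : 0 < a) :
    IntegrableOn (fun t : ℝ => Real.exp (-(a / t)) / t ^ 2) (Set.Ioc 0 1) ∧
      ∫ t in Set.Ioc (0 : ℝ) 1, Real.exp (-(a / t)) / t ^ 2 = Real.exp (-a) / a := by
  -- the smooth extension of `e^{-a/t} / a` by zero to `t ≤ 0`
  let g : ℝ → ℝ := fun t => expNegInvGlue (t / a) / a
  have hcont : Continuous g :=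
    ((expNegInvGlue.contDiff (n := 0)).continuous.comp (continuous_id.div_const a)).div_const a
  have hpos : ∀ t, 0 < t → g t = Real.exp (-(a / t)) / a := fun t ht => by
    simp only [g, expNegInvGlue, not_le.2 (div_pos ht ha), if_false, inv_div]
  have hderiv : ∀ t ∈ Set.Ioo (0 : ℝ) 1, HasDerivAt g (Real.exp (-(a / t)) / t ^ 2) t := by
    intro t ht
    refine (hasDerivAt_exp_neg_div ha.ne' ht.1.ne').congr_of_eventuallyEq ?_
    filter_upwards [lt_mem_nhds ht.1] with u hu using hpos u hu
  have hint := intervalIntegral.integrableOn_deriv_of_nonneg hcont.continuousOn hderiv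
    (fun t _ => by positivity)
  refine ⟨hint, ?_⟩
  rw [← intervalIntegral.integral_of_le zero_le_one,
    intervalIntegral.integral_eq_sub_of_hasDerivAt_of_le zero_le_one hcont.continuousOn hderiv
      ((intervalIntegrable_iff_integrableOn_Ioc_of_le zero_le_one).2 hint), hpos 1 one_pos]
  simp [g, expNegInvGlue]

/-- The integrand `(s ⋅ z) e^{-κ|z|/t} / (|z| t²)`: the first moment of the screened Coulomb
kernel dilated by `t`. Its integral over `t ∈ (0, 1]` is `flux κ s z`. -/
def dilatedMoment (κ : ℝ) (s : Plane) (t : ℝ) (z : Plane) : ℝ :=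
  inner ℝ s z / ‖z‖ * (Real.exp (-(κ * ‖z‖ / t)) / t ^ 2)

theorem integrableOn_dilatedMoment (hκ : 0 < κ) (s z : Plane) :
    IntegrableOn (fun t => dilatedMoment κ s t z) (Set.Ioc 0 1) := by
  rcases eq_or_ne z 0 with rfl | hz
  · simp [dilatedMoment]
  · exact (hasIntegral_exp_neg_div (mul_pos hκ (norm_pos_iff.2 hz))).1.const_mul _

theorem setIntegral_dilatedMoment (hκ : 0 < κ) (s z : Plane) :
    ∫ t in Set.Ioc (0 : ℝ) 1, dilatedMoment κ s t z = flux κ s z := by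
  rcases eq_or_ne z 0 with rfl | hz
  · simp [dilatedMoment, flux]
  · have hz' := norm_pos_iff.2 hz
    simp only [dilatedMoment, flux]
    rw [integral_const_mul, (hasIntegral_exp_neg_div (mul_pos hκ hz')).2]
    field_simp

theorem setIntegral_norm_dilatedMoment (hκ : 0 < κ) (s z : Plane) :
    ∫ t in Set.Ioc (0 : ℝ) 1, ‖dilatedMoment κ s t z‖ = |flux κ s z| := by
  have hsign : ∀ t, ‖dilatedMoment κ s t z‖ =
      SignType.sign (inner ℝ s z) * dilatedMoment κ s t z := by
    intro t
    rw [dilatedMoment, norm_mul, Real.norm_of_nonneg (r := _ / t ^ 2) (by positivity), norm_div,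
      norm_norm, Real.norm_eq_abs, ← sign_mul_self (inner ℝ s z)]
    ring
  simp_rw [hsign]
  rw [integral_const_mul, setIntegral_dilatedMoment hκ, abs_flux hκ, flux, ← mul_assoc,
    sign_mul_self]

theorem integral_comp_smul_mul_inner {t : ℝ} (ht : 0 < t) (κ : ℝ) (s : Plane) (φ : Plane → ℝ) :
    ∫ h, φ (t • h) * inner ℝ s h * screenedKernel κ h =
      ∫ z, φ z * dilatedMoment κ s t z := by
  have hscale := Measure.integral_comp_smul (volume : Measure Plane)
    (fun z => φ z * dilatedMoment κ s t z) t
  rw [finrank_euclideanSpace, Fintype.card_fin, abs_of_nonneg (by positivity), smul_eq_mul,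
    eq_inv_mul_iff_mul_eq₀ (by positivity), ← integral_const_mul] at hscale
  rw [← hscale]
  congr 1 with h
  have hexp : κ * (t * ‖h‖) / t = κ * ‖h‖ := by field_simp
  simp only [dilatedMoment, screenedKernel, norm_smul, Real.norm_of_nonneg ht.le,
    real_inner_smul_right, hexp]
  rcases eq_or_ne h 0 with rfl | hh
  · simp
  · field_simp [norm_ne_zero_iff.2 hh]

theorem setIntegral_integral_comp_smul (hκ : 0 < κ) (hs : ‖s‖ = 1) {φ : Plane → ℝ}
    (hφ : Measurable φ) {M : ℝ} (hM : ∀ z, |φ z| ≤ M) :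
    ∫ t in Set.Ioc (0 : ℝ) 1, ∫ h, φ (t • h) * inner ℝ s h * screenedKernel κ h =
      ∫ z, φ z * flux κ s z := by
  let F : ℝ → Plane → ℝ := fun t z => φ z * dilatedMoment κ s t z
  have hmeas : Measurable (Function.uncurry F) := by
    simp only [Function.uncurry_def, F, dilatedMoment]
    exact (hφ.comp measurable_snd).mul (by fun_prop)
  have hint : Integrable (Function.uncurry F)
      ((volume.restrict (Set.Ioc 0 1)).prod volume) := by
    rw [integrable_prod_iff' hmeas.aestronglyMeasurable]
    refine ⟨Eventually.of_forall fun z =>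
      Integrable.const_mul (integrableOn_dilatedMoment hκ s z) (φ z), ?_⟩
    have hbdd : Integrable (fun z => φ z * flux κ s z) :=
      (integrable_flux hκ hs).bdd_mul hφ.aestronglyMeasurable (Eventually.of_forall hM)
    refine hbdd.norm.congr (Eventually.of_forall fun z => ?_)
    simp only [Function.uncurry_apply_pair, F, norm_mul, integral_const_mul,
      setIntegral_norm_dilatedMoment hκ]
    rfl
  rw [setIntegral_congr_fun measurableSet_Ioc fun t ht =>
    integral_comp_smul_mul_inner ht.1 κ s φ, integral_integral_swap hint]
  simp_rw [F, integral_const_mul, setIntegral_dilatedMoment hκ]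

end Kernel

section Nonlocal

variable {Ω : Set Plane} {μ : Measure Plane} {σ : Plane → Plane} {κ M : ℝ} {g ψ : Plane → ℝ}

/-- The amount of the mass `∫_Ω g` that the translation by `h` moves out of `Ω`, minus the amount
of `∫_{Ωᶜ} g` that it moves into `Ω`. For `g = χ_Ω` this is `|Ω \ (Ω - h)|`. -/
def translationDefect (Ω : Set Plane) (g : Plane → ℝ) (h : Plane) : ℝ :=
  ∫ x, g x * (chi Ω x - chi Ω (x + h))

theorem translationDefect_eq_neg (Ω : Set Plane) (g : Plane → ℝ) (h : Plane) :
    translationDefect Ω g h = -∫ x, g x * (chi Ω (x + h) - chi Ω x) := by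
  simp only [translationDefect, ← integral_neg, ← mul_neg, neg_sub]

theorem chi_mul_chi_sub_nonneg (Ω : Set Plane) (x x' : Plane) :
    0 ≤ chi Ω x * (chi Ω x - chi Ω x') := by
  by_cases hx : x ∈ Ω
  · simp only [chi_of_mem hx, one_mul, sub_nonneg, chi_le_one]
  · simp only [chi_of_notMem hx, zero_mul, le_refl]

theorem translationDefect_chi_nonneg (Ω : Set Plane) (h : Plane) :
    0 ≤ translationDefect Ω (chi Ω) h :=
  integral_nonneg fun x => chi_mul_chi_sub_nonneg Ω x (x + h)

theorem measurable_translationDefect (hΩ : MeasurableSet Ω) (hg : Measurable g) :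
    Measurable (translationDefect Ω g) := by
  have hmeas : Measurable fun p : Plane × Plane => g p.2 * (chi Ω p.2 - chi Ω (p.2 + p.1)) :=
    (hg.comp measurable_snd).mul (((measurable_chi hΩ).comp measurable_snd).sub
      ((measurable_chi hΩ).comp (measurable_snd.add measurable_fst)))
  exact (hmeas.stronglyMeasurable.integral_prod_right' (ν := volume)).measurable

theorem norm_screenedKernel_mul_translationDefect_le (hΩ : MeasurableSet Ω)
    (hfin : volume Ω < ∞) (hP : perimeter Ω < ∞) (hg : Measurable g) (hM : ∀ x, |g x| ≤ M)
    (κ : ℝ) (h : Plane) :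
    ‖screenedKernel κ h * translationDefect Ω g h‖ ≤
      M * (perimeter Ω).toReal * Real.exp (-(κ * ‖h‖)) := by
  have hM0 : 0 ≤ M := (abs_nonneg _).trans (hM 0)
  have hdefect := abs_integral_mul_chi_sub_chi_le hΩ hfin hP hg hM h
  rw [← abs_neg, ← translationDefect_eq_neg] at hdefect
  rw [norm_mul, Real.norm_of_nonneg (screenedKernel_nonneg κ h), Real.norm_eq_abs]
  calc _ ≤ screenedKernel κ h * (M * ‖h‖ * (perimeter Ω).toReal) := by
        gcongr
        exact screenedKernel_nonneg κ h
    _ = M * (perimeter Ω).toReal * (‖h‖ * screenedKernel κ h) := by ring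
    _ ≤ _ := by
        gcongr
        exact norm_mul_screenedKernel_le κ h

theorem aestronglyMeasurable_screenedKernel_mul_translationDefect (hΩ : MeasurableSet Ω)
    (hg : Measurable g) (κ : ℝ) :
    AEStronglyMeasurable (fun h => screenedKernel κ h * translationDefect Ω g h) :=
  ((measurable_screenedKernel κ).mul (measurable_translationDefect hΩ hg)).aestronglyMeasurable

theorem integrable_screenedKernel_mul_translationDefect (hκ : 0 < κ) (hΩ : MeasurableSet Ω)
    (hfin : volume Ω < ∞) (hP : perimeter Ω < ∞) (hg : Measurable g) (hM : ∀ x, |g x| ≤ M) :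
    Integrable fun h => screenedKernel κ h * translationDefect Ω g h :=
  ((integrable_exp_neg_norm hκ).const_mul _).mono'
    (aestronglyMeasurable_screenedKernel_mul_translationDefect hΩ hg κ)
    (Eventually.of_forall
      (norm_screenedKernel_mul_translationDefect_le hΩ hfin hP hg hM κ))

theorem tendsto_integral_screenedKernel_mul_translationDefect (hκ : 0 < κ)
    (hΩ : MeasurableSet Ω) (hfin : volume Ω < ∞) (hP : perimeter Ω < ∞) (hg : Measurable g)
    (hM : ∀ x, |g x| ≤ M) :
    Tendsto (fun n => ∫ h, screenedKernel κ h * translationDefect Ω (mollification g n) h) atTop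
      (𝓝 (∫ h, screenedKernel κ h * translationDefect Ω g h)) := by
  have hmoll : ∀ n, Measurable (mollification g n) := fun n =>
    (isTestFunction_mollification hg hM n).continuous.measurable
  refine tendsto_integral_of_dominated_convergence _
    (fun n => aestronglyMeasurable_screenedKernel_mul_translationDefect hΩ (hmoll n) κ)
    ((integrable_exp_neg_norm hκ).const_mul _)
    (fun n => Eventually.of_forall (norm_screenedKernel_mul_translationDefect_le hΩ hfin hP
      (hmoll n) (abs_mollification_le hg hM n) κ)) (Eventually.of_forall fun h => ?_)
  simp only [translationDefect_eq_neg]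
  exact (tendsto_integral_mollification_mul hg hM
    (integrable_chi_sub_chi hΩ hfin h)).neg.const_mul _

/-- The convolution of `g` with `flux κ s`. -/
def fluxConvolution (κ : ℝ) (g : Plane → ℝ) (s y : Plane) : ℝ :=
  ∫ z, g (y - z) * flux κ s z

theorem measurable_fluxConvolution (κ : ℝ) (hg : Measurable g) (hσ : Measurable σ) :
    Measurable fun y => fluxConvolution κ g (σ y) y := by
  have hmeas : Measurable fun p : Plane × Plane => g (p.1 - p.2) * flux κ (σ p.1) p.2 :=
    (hg.comp (measurable_fst.sub measurable_snd)).mul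
      (measurable_flux κ (hσ.comp measurable_fst) measurable_snd)
  exact (hmeas.stronglyMeasurable.integral_prod_right' (ν := volume)).measurable

theorem abs_fluxConvolution_le (hκ : 0 < κ) {s : Plane} (hs : ‖s‖ = 1) (hM : ∀ x, |g x| ≤ M)
    (y : Plane) : |fluxConvolution κ g s y| ≤ M * (4 / κ ^ 2) := by
  rw [← integral_abs_flux hκ hs, ← integral_const_mul, ← Real.norm_eq_abs]
  refine norm_integral_le_of_norm_le ((integrable_flux hκ hs).abs.const_mul M)
    (Eventually.of_forall fun z => ?_)
  rw [norm_mul]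
  exact mul_le_mul_of_nonneg_right (hM _) (abs_nonneg _)

theorem tendsto_fluxConvolution_mollification (hκ : 0 < κ) {s : Plane} (hs : ‖s‖ = 1)
    (hg : Measurable g) (hM : ∀ x, |g x| ≤ M) (y : Plane) :
    Tendsto (fun n => fluxConvolution κ (mollification g n) s y) atTop
      (𝓝 (fluxConvolution κ g s y)) := by
  have hsub : ∀ f : Plane → ℝ, fluxConvolution κ f s y = ∫ x, f x * flux κ s (y - x) := fun f => by
    rw [fluxConvolution, ← integral_sub_left_eq_self _ volume y]
    simp only [sub_sub_cancel]
  simp only [hsub]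
  exact tendsto_integral_mollification_mul hg hM ((integrable_flux hκ hs).comp_sub_left y)

namespace IsGaussGreenPolar

theorem isFiniteMeasure (hpol : IsGaussGreenPolar Ω μ σ) (hP : perimeter Ω < ∞) :
    IsFiniteMeasure μ :=
  ⟨hpol.perimeter_eq hP ▸ hP⟩

theorem integrable_fluxConvolution (hpol : IsGaussGreenPolar Ω μ σ) [IsFiniteMeasure μ]
    (hκ : 0 < κ) (hg : Measurable g) (hM : ∀ x, |g x| ≤ M) :
    Integrable (fun y => fluxConvolution κ g (σ y) y) μ :=
  Integrable.of_bound (measurable_fluxConvolution κ hg hpol.measurable).aestronglyMeasurable _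
    (hpol.ae_norm_eq_one.mono fun y hy => abs_fluxConvolution_le hκ hy hM y)

theorem tendsto_integral_fluxConvolution_mollification (hpol : IsGaussGreenPolar Ω μ σ)
    [IsFiniteMeasure μ] (hκ : 0 < κ) (hg : Measurable g) (hM : ∀ x, |g x| ≤ M) :
    Tendsto (fun n => ∫ y, fluxConvolution κ (mollification g n) (σ y) y ∂μ) atTop
      (𝓝 (∫ y, fluxConvolution κ g (σ y) y ∂μ)) :=
  tendsto_integral_of_dominated_convergence (fun _ => M * (4 / κ ^ 2))
    (fun n => (measurable_fluxConvolution κ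
      (isTestFunction_mollification hg hM n).continuous.measurable
      hpol.measurable).aestronglyMeasurable)
    (integrable_const _)
    (fun n => hpol.ae_norm_eq_one.mono fun y hy =>
      abs_fluxConvolution_le hκ hy (abs_mollification_le hg hM n) y)
    (hpol.ae_norm_eq_one.mono fun y hy => tendsto_fluxConvolution_mollification hκ hy hg hM y)

theorem integrable_mul_inner_mul_screenedKernel (hpol : IsGaussGreenPolar Ω μ σ)
    [IsFiniteMeasure μ] (hκ : 0 < κ) (hψ : Measurable ψ) (hM : ∀ x, |ψ x| ≤ M) :
    Integrable (fun p : Plane × ℝ × Plane =>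
      ψ (p.2.2 - p.2.1 • p.1) * inner ℝ (σ p.2.2) p.1 * screenedKernel κ p.1)
      (volume.prod ((volume.restrict (Set.Ioc 0 1)).prod μ)) := by
  have hM0 : 0 ≤ M := (abs_nonneg _).trans (hM 0)
  have hσ : ∀ᵐ p ∂((volume : Measure Plane).prod ((volume.restrict (Set.Ioc (0 : ℝ) 1)).prod μ)),
      ‖σ p.2.2‖ = 1 :=
    (Measure.quasiMeasurePreserving_snd.comp Measure.quasiMeasurePreserving_snd).ae
      hpol.ae_norm_eq_one
  refine (((integrable_exp_neg_norm hκ).const_mul M).comp_fst _).mono'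
    (Measurable.aestronglyMeasurable ?_) ?_
  · have hσ : Measurable fun p : Plane × ℝ × Plane => σ p.2.2 := hpol.measurable.comp (by fun_prop)
    exact ((hψ.comp (by fun_prop)).mul (hσ.inner measurable_fst)).mul
      ((measurable_screenedKernel κ).comp measurable_fst)
  · filter_upwards [hσ] with p hp
    have hinner := abs_real_inner_le_norm (σ p.2.2) p.1
    rw [hp, one_mul] at hinner
    rw [norm_mul, norm_mul, Real.norm_of_nonneg (screenedKernel_nonneg κ _)]
    calc _ ≤ M * ‖p.1‖ * screenedKernel κ p.1 := by
          gcongr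
          exacts [screenedKernel_nonneg κ _, hM _, hinner]
      _ = M * (‖p.1‖ * screenedKernel κ p.1) := mul_assoc ..
      _ ≤ _ := by
          gcongr
          exact norm_mul_screenedKernel_le κ _

theorem translationDefect_eq (hpol : IsGaussGreenPolar Ω μ σ) (hΩ : MeasurableSet Ω)
    (hψ : IsTestFunction ψ) (h : Plane) :
    translationDefect Ω ψ h =
      ∫ t in Set.Ioc (0 : ℝ) 1, ∫ y, ψ (y - t • h) * inner ℝ (σ y) h ∂μ := by
  simp only [translationDefect_eq_neg, hpol.integral_mul_chi_sub_chi hΩ hψ, neg_neg,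
    intervalIntegral.integral_of_le zero_le_one, real_inner_comm h]

theorem integral_screenedKernel_mul_translationDefect_of_isTestFunction
    (hpol : IsGaussGreenPolar Ω μ σ) (hΩ : MeasurableSet Ω) [IsFiniteMeasure μ] (hκ : 0 < κ)
    (hψ : IsTestFunction ψ) (hM : ∀ x, |ψ x| ≤ M) :
    ∫ h, screenedKernel κ h * translationDefect Ω ψ h = ∫ y, fluxConvolution κ ψ (σ y) y ∂μ := by
  let f : Plane → ℝ × Plane → ℝ := fun h q =>
    ψ (q.2 - q.1 • h) * inner ℝ (σ q.2) h * screenedKernel κ h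
  have hf : Integrable (Function.uncurry f)
      (volume.prod ((volume.restrict (Set.Ioc 0 1)).prod μ)) :=
    hpol.integrable_mul_inner_mul_screenedKernel hκ hψ.continuous.measurable hM
  have hfubini : ∀ᵐ h : Plane, screenedKernel κ h * translationDefect Ω ψ h =
      ∫ q, f h q ∂((volume.restrict (Set.Ioc (0 : ℝ) 1)).prod μ) := by
    filter_upwards [hf.prod_right_ae] with h hh
    rw [hpol.translationDefect_eq hΩ hψ, mul_comm]
    simp only [← integral_mul_const]
    exact (integral_prod _ hh).symm
  rw [integral_congr_ae hfubini, integral_integral_swap hf]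
  refine (integral_prod_symm _ hf.integral_prod_right).trans (integral_congr_ae ?_)
  filter_upwards [hpol.ae_norm_eq_one] with y hy
  exact setIntegral_integral_comp_smul hκ hy (φ := fun z => ψ (y - z))
    (hψ.continuous.measurable.comp (measurable_const.sub measurable_id)) fun z => hM _

theorem integral_screenedKernel_mul_translationDefect (hpol : IsGaussGreenPolar Ω μ σ)
    (hΩ : MeasurableSet Ω) (hfin : volume Ω < ∞) (hP : perimeter Ω < ∞) (hκ : 0 < κ)
    (hg : Measurable g) (hM : ∀ x, |g x| ≤ M) :
    ∫ h, screenedKernel κ h * translationDefect Ω g h = ∫ y, fluxConvolution κ g (σ y) y ∂μ := by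
  have := hpol.isFiniteMeasure hP
  refine tendsto_nhds_unique
    (tendsto_integral_screenedKernel_mul_translationDefect hκ hΩ hfin hP hg hM) ?_
  simp_rw [fun n => hpol.integral_screenedKernel_mul_translationDefect_of_isTestFunction hΩ hκ
    (isTestFunction_mollification hg hM n) (abs_mollification_le hg hM n)]
  exact hpol.tendsto_integral_fluxConvolution_mollification hκ hg hM

end IsGaussGreenPolar

theorem nonlocalTerm_eq_lintegral_chi (hΩ : MeasurableSet Ω) (lam α : ℝ) :
    nonlocalTerm lam α Ω = ∫⁻ x, ∫⁻ h,
      ENNReal.ofReal (screenedKernel (lam * α) h * (chi Ω x * (chi Ω x - chi Ω (x + h)))) := by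
  change ∫⁻ x in Ω, ∫⁻ y in Ωᶜ, ENNReal.ofReal (screenedKernel (lam * α) (x - y)) = _
  rw [← lintegral_indicator hΩ]
  refine lintegral_congr fun x => ?_
  by_cases hx : x ∈ Ω
  · rw [Set.indicator_of_mem hx, ← lintegral_indicator hΩ.compl,
      ← lintegral_add_left_eq_self _ x]
    refine lintegral_congr fun h => ?_
    rw [chi_of_mem hx, one_mul]
    by_cases hh : x + h ∈ Ω
    · rw [Set.indicator_of_notMem (Set.notMem_compl_iff.2 hh), chi_of_mem hh, sub_self, mul_zero,
        ENNReal.ofReal_zero]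
    · rw [Set.indicator_of_mem (Set.mem_compl hh), chi_of_notMem hh, sub_zero, mul_one,
        sub_add_cancel_left, screenedKernel_neg]
  · simp only [Set.indicator_of_notMem hx, chi_of_notMem hx, zero_mul, mul_zero,
      ENNReal.ofReal_zero, lintegral_zero]

theorem nonlocalTerm_eq_lintegral (hΩ : MeasurableSet Ω) (hfin : volume Ω < ∞) (lam α : ℝ) :
    nonlocalTerm lam α Ω = ∫⁻ h,
      ENNReal.ofReal (screenedKernel (lam * α) h * translationDefect Ω (chi Ω) h) := by
  have hmeas : Measurable fun p : Plane × Plane =>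
      screenedKernel (lam * α) p.2 * (chi Ω p.1 * (chi Ω p.1 - chi Ω (p.1 + p.2))) := by
    have hchi := measurable_chi hΩ
    exact ((measurable_screenedKernel _).comp measurable_snd).mul
      ((hchi.comp measurable_fst).mul ((hchi.comp measurable_fst).sub
        (hchi.comp (measurable_fst.add measurable_snd))))
  rw [nonlocalTerm_eq_lintegral_chi hΩ, lintegral_lintegral_swap hmeas.ennreal_ofReal.aemeasurable]
  refine lintegral_congr fun h => ?_
  have hint : Integrable fun x => chi Ω x - chi Ω (x + h) := by
    simpa only [neg_sub] using (integrable_chi_sub_chi hΩ hfin h).fun_neg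
  rw [translationDefect, ← integral_const_mul, ofReal_integral_eq_lintegral_ofReal]
  · exact (hint.bdd_mul (measurable_chi hΩ).aestronglyMeasurable
      (Eventually.of_forall (abs_chi_le_one Ω))).const_mul _
  · exact Eventually.of_forall fun x =>
      mul_nonneg (screenedKernel_nonneg _ h) (chi_mul_chi_sub_nonneg Ω x (x + h))

theorem nonlocalTerm_eq_ofReal (hΩ : MeasurableSet Ω) (hfin : volume Ω < ∞)
    (hP : perimeter Ω < ∞) {lam α : ℝ} (hκ : 0 < lam * α) :
    nonlocalTerm lam α Ω = ENNReal.ofReal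
      (∫ h, screenedKernel (lam * α) h * translationDefect Ω (chi Ω) h) := by
  rw [nonlocalTerm_eq_lintegral hΩ hfin, ofReal_integral_eq_lintegral_ofReal
    (integrable_screenedKernel_mul_translationDefect hκ hΩ hfin hP (measurable_chi hΩ)
      (abs_chi_le_one Ω))
    (Eventually.of_forall fun h =>
      mul_nonneg (screenedKernel_nonneg _ h) (translationDefect_chi_nonneg Ω h))]

theorem IsGaussGreenPolar.toReal_nonlocalTerm (hpol : IsGaussGreenPolar Ω μ σ)
    (hΩ : MeasurableSet Ω) (hfin : volume Ω < ∞) (hP : perimeter Ω < ∞) {lam α : ℝ}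
    (hκ : 0 < lam * α) :
    (nonlocalTerm lam α Ω).toReal = ∫ y, fluxConvolution (lam * α) (chi Ω) (σ y) y ∂μ := by
  rw [nonlocalTerm_eq_ofReal hΩ hfin hP hκ, ENNReal.toReal_ofReal (integral_nonneg fun h =>
      mul_nonneg (screenedKernel_nonneg _ h) (translationDefect_chi_nonneg Ω h)),
    hpol.integral_screenedKernel_mul_translationDefect hΩ hfin hP hκ (measurable_chi hΩ)
      (abs_chi_le_one Ω)]

end Nonlocal

section Bulk

variable {Ω : Set Plane} {μ : Measure Plane} {σ : Plane → Plane} {κ : ℝ} {s y : Plane}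

theorem measurableSet_halfPlane (s : Plane) : MeasurableSet (halfPlane s) :=
  measurableSet_lt (f := fun x => inner ℝ s x) (g := fun _ => 0) (by fun_prop) (by fun_prop)

theorem measurableSet_halfPlane_symmDiff_translate (hΩ : MeasurableSet Ω) (s y : Plane) :
    MeasurableSet (halfPlane s ∆ {z | y + z ∈ Ω}) :=
  (measurableSet_halfPlane s).symmDiff (measurable_const_add y hΩ)

/-- The integral of `|s ⋅ z| e^{-κ|z|} / (κ|z|²)` over `H₋⁰(s) Δ (Ω - y)`, the inner integral of
both boundary representations up to a factor and a change of variables. -/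
def bulk (κ : ℝ) (Ω : Set Plane) (s y : Plane) : ℝ≥0∞ :=
  ∫⁻ z in halfPlane s ∆ {z | y + z ∈ Ω}, ENNReal.ofReal |flux κ s z|

theorem abs_flux_of_mem_halfPlane (hκ : 0 < κ) {z : Plane} (hz : z ∈ halfPlane s) :
    |flux κ s z| = -flux κ s z :=
  abs_of_nonpos (mul_nonpos_of_nonpos_of_nonneg (le_of_lt hz) (by positivity))

theorem abs_flux_of_notMem_halfPlane (hκ : 0 < κ) {z : Plane} (hz : z ∉ halfPlane s) :
    |flux κ s z| = flux κ s z :=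
  abs_of_nonneg (mul_nonneg (not_lt.1 hz) (by positivity))

theorem indicator_abs_flux (hκ : 0 < κ) (z : Plane) :
    (halfPlane s ∆ {z | y + z ∈ Ω}).indicator (fun z => |flux κ s z|) z =
      (|flux κ s z| - flux κ s z) / 2 + chi Ω (y + z) * flux κ s z := by
  by_cases hz : z ∈ halfPlane s
  · by_cases hyz : y + z ∈ Ω <;>
      simp only [Set.indicator, Set.mem_symmDiff, Set.mem_ofPred_eq, hz, hyz, chi_of_mem,
        chi_of_notMem, abs_flux_of_mem_halfPlane hκ, not_true, not_false_eq_true, and_true,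
        and_false, or_false, if_true, if_false] <;> ring
  · by_cases hyz : y + z ∈ Ω <;>
      simp only [Set.indicator, Set.mem_symmDiff, Set.mem_ofPred_eq, hz, hyz, chi_of_mem,
        chi_of_notMem, abs_flux_of_notMem_halfPlane hκ, not_true, not_false_eq_true, and_true,
        and_false, or_false, or_true, if_true, if_false] <;> ring

theorem fluxConvolution_eq_neg (κ : ℝ) (g : Plane → ℝ) (s y : Plane) :
    fluxConvolution κ g s y = -∫ z, g (y + z) * flux κ s z := by
  rw [fluxConvolution, ← integral_neg_eq_self]
  simp only [sub_neg_eq_add, flux_neg, mul_neg, integral_neg]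

theorem setIntegral_abs_flux (hΩ : MeasurableSet Ω) (hκ : 0 < κ) (hs : ‖s‖ = 1) (y : Plane) :
    ∫ z in halfPlane s ∆ {z | y + z ∈ Ω}, |flux κ s z| =
      2 / κ ^ 2 - fluxConvolution κ (chi Ω) s y := by
  have hflux := integrable_flux hκ hs
  have hchi : Integrable fun z => chi Ω (y + z) * flux κ s z :=
    hflux.bdd_mul ((measurable_chi hΩ).comp (measurable_const_add y)).aestronglyMeasurable
      (Eventually.of_forall fun _ => abs_chi_le_one Ω _)
  rw [← integral_indicator (measurableSet_halfPlane_symmDiff_translate hΩ s y)]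
  simp_rw [indicator_abs_flux hκ]
  rw [integral_add (f := fun z => (|flux κ s z| - flux κ s z) / 2)
      ((hflux.abs.sub hflux).div_const 2) hchi, integral_div,
    integral_sub hflux.abs hflux, integral_abs_flux hκ hs, integral_flux, fluxConvolution_eq_neg]
  ring

theorem fluxConvolution_chi_le (hΩ : MeasurableSet Ω) (hκ : 0 < κ) (hs : ‖s‖ = 1) (y : Plane) :
    fluxConvolution κ (chi Ω) s y ≤ 2 / κ ^ 2 := by
  rw [← sub_nonneg, ← setIntegral_abs_flux hΩ hκ hs]
  exact integral_nonneg fun z => abs_nonneg _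

theorem bulk_eq (hΩ : MeasurableSet Ω) (hκ : 0 < κ) (hs : ‖s‖ = 1) (y : Plane) :
    bulk κ Ω s y = ENNReal.ofReal (2 / κ ^ 2 - fluxConvolution κ (chi Ω) s y) := by
  rw [← setIntegral_abs_flux hΩ hκ hs, bulk, ofReal_integral_eq_lintegral_ofReal
    (integrable_flux hκ hs).abs.integrableOn (Eventually.of_forall fun z => abs_nonneg _)]

namespace IsGaussGreenPolar

variable {lam α : ℝ}

theorem integral_sub_fluxConvolution (hpol : IsGaussGreenPolar Ω μ σ)
    (hΩ : MeasurableSet Ω) (hfin : volume Ω < ∞) (hP : perimeter Ω < ∞) (hκ : 0 < lam * α) :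
    ∫ y, (2 / (lam * α) ^ 2 - fluxConvolution (lam * α) (chi Ω) (σ y) y) ∂μ =
      2 / (lam * α) ^ 2 * (perimeter Ω).toReal - (nonlocalTerm lam α Ω).toReal := by
  have := hpol.isFiniteMeasure hP
  rw [integral_sub (integrable_const _)
      (hpol.integrable_fluxConvolution hκ (measurable_chi hΩ) (abs_chi_le_one Ω)),
    integral_const, hpol.toReal_nonlocalTerm hΩ hfin hP hκ, hpol.perimeter_eq hP, smul_eq_mul,
    mul_comm, measureReal_def]

theorem toReal_nonlocalTerm_le (hpol : IsGaussGreenPolar Ω μ σ)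
    (hΩ : MeasurableSet Ω) (hfin : volume Ω < ∞) (hP : perimeter Ω < ∞) (hκ : 0 < lam * α) :
    (nonlocalTerm lam α Ω).toReal ≤ 2 / (lam * α) ^ 2 * (perimeter Ω).toReal := by
  rw [← sub_nonneg, ← hpol.integral_sub_fluxConvolution hΩ hfin hP hκ]
  exact integral_nonneg_of_ae <| hpol.ae_norm_eq_one.mono fun y hy =>
    sub_nonneg.2 (fluxConvolution_chi_le hΩ hκ hy y)

theorem lintegral_bulk (hpol : IsGaussGreenPolar Ω μ σ) (hΩ : MeasurableSet Ω)
    (hfin : volume Ω < ∞) (hP : perimeter Ω < ∞) (hκ : 0 < lam * α) :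
    ∫⁻ y, bulk (lam * α) Ω (σ y) y ∂μ = ENNReal.ofReal
      (2 / (lam * α) ^ 2 * (perimeter Ω).toReal - (nonlocalTerm lam α Ω).toReal) := by
  have := hpol.isFiniteMeasure hP
  rw [← hpol.integral_sub_fluxConvolution hΩ hfin hP hκ, ofReal_integral_eq_lintegral_ofReal]
  · exact lintegral_congr_ae (hpol.ae_norm_eq_one.mono fun y hy => bulk_eq hΩ hκ hy y)
  · exact (integrable_const _).sub
      (hpol.integrable_fluxConvolution hκ (measurable_chi hΩ) (abs_chi_le_one Ω))
  · exact hpol.ae_norm_eq_one.mono fun y hy =>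
      sub_nonneg.2 (fluxConvolution_chi_le hΩ hκ hy y)

end IsGaussGreenPolar

end Bulk

section ChangeOfVariables

theorem setLIntegral_linearMap_image {E : Type*} [NormedAddCommGroup E] [NormedSpace ℝ E]
    [FiniteDimensional ℝ E] [MeasurableSpace E] [BorelSpace E] (m : Measure E)
    [m.IsAddHaarMeasure] {L : E →ₗ[ℝ] E} (hL : Function.Injective L) {S : Set E}
    (hS : MeasurableSet S) (g : E → ℝ≥0∞) :
    ∫⁻ w in L '' S, g w ∂m = ENNReal.ofReal |LinearMap.det L| * ∫⁻ z in S, g (L z) ∂m := by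
  rw [lintegral_image_eq_lintegral_abs_det_fderiv_mul m hS
      (f := L)
      (f' := fun _ => LinearMap.toContinuousLinearMap L)
      (fun x _ => (LinearMap.toContinuousLinearMap L).hasFDerivWithinAt) hL.injOn,
    lintegral_const_mul' _ _ ENNReal.ofReal_ne_top, LinearMap.det_toContinuousLinearMap]

variable {Ω : Set Plane} {κ lam α : ℝ} {s : Plane}

theorem setLIntegral_symmDiff_image (hΩ : MeasurableSet Ω) {L : Plane →ₗ[ℝ] Plane}
    (hL : 0 < LinearMap.det L) {s' : Plane} (hH : ∀ z, L z ∈ halfPlane s' ↔ z ∈ halfPlane s)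
    {c : ℝ} (hc : 0 ≤ c) {g : Plane → ℝ} (hg : ∀ z, g (L z) = c * |flux κ s z|) (y : Plane) :
    ∫⁻ w in halfPlane s' ∆ ((fun x => L (x - y)) '' Ω), ENNReal.ofReal (g w) =
      ENNReal.ofReal (LinearMap.det L * c) * bulk κ Ω s y := by
  have hbij : Function.Bijective L := (Module.End.isUnit_iff _).1 <|
    L.isUnit_iff_isUnit_det.2 hL.ne'.isUnit
  have hhalf : halfPlane s' = L '' halfPlane s := by
    rw [← (Set.ext hH : L ⁻¹' halfPlane s' = halfPlane s),
      Set.image_preimage_eq _ hbij.surjective]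
  have htranslate : (fun x => L (x - y)) '' Ω = L '' {z | y + z ∈ Ω} := by
    refine Set.Subset.antisymm ?_ ?_
    · rintro _ ⟨x, hx, rfl⟩
      exact ⟨x - y, by simpa using hx, rfl⟩
    · rintro _ ⟨z, hz, rfl⟩
      exact ⟨y + z, hz, by simp only [add_sub_cancel_left]⟩
  rw [hhalf, htranslate, ← Set.image_symmDiff hbij.injective,
    setLIntegral_linearMap_image volume hbij.injective
      (measurableSet_halfPlane_symmDiff_translate hΩ s y)]
  simp_rw [hg, ENNReal.ofReal_mul hc]
  rw [lintegral_const_mul' _ _ ENNReal.ofReal_ne_top, abs_of_pos hL, ← mul_assoc,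
    ENNReal.ofReal_mul hL.le, bulk]

theorem setLIntegral_dilation (hΩ : MeasurableSet Ω) (hlam : 0 < lam) (hα : 0 < α) (s y : Plane) :
    ∫⁻ z in halfPlane s ∆ ((fun x => lam • (x - y)) '' Ω),
      ENNReal.ofReal (|inner ℝ s (‖z‖⁻¹ • z)| * (Real.exp (-(α * ‖z‖)) / ‖z‖)) =
      ENNReal.ofReal (lam ^ 2 * α) * bulk (lam * α) Ω s y := by
  have hdet : LinearMap.det (lam • LinearMap.id : Plane →ₗ[ℝ] Plane) = lam ^ 2 := by simp
  rw [← hdet]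
  refine setLIntegral_symmDiff_image hΩ (by rw [hdet]; positivity) (fun z => ?_) hα.le
    (fun z => ?_) y
  · change inner ℝ s (lam • z) < 0 ↔ inner ℝ s z < 0
    rw [real_inner_smul_right]
    exact smul_neg_iff_of_pos_left hlam
  · rcases eq_or_ne z 0 with rfl | hz
    · simp [flux]
    have hexp : α * (lam * ‖z‖) = lam * α * ‖z‖ := by ring
    rw [abs_flux (mul_pos hlam hα), LinearMap.smul_apply, LinearMap.id_apply, norm_smul,
      Real.norm_of_nonneg hlam.le, smul_smul, real_inner_smul_right, abs_mul,
      abs_of_nonneg (a := (lam * ‖z‖)⁻¹ * lam) (by positivity), hexp]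
    field_simp [norm_ne_zero_iff.2 hz]

/-- The linear map `A_λ R_s`. -/
def anisotropicDilation (lam : ℝ) (s : Plane) : Plane →ₗ[ℝ] Plane :=
  Matrix.toEuclideanLin !![lam * s 1, -(lam * s 0); lam ^ 2 * s 0, lam ^ 2 * s 1]

theorem dilate_apply_zero (lam : ℝ) (x : Plane) : dilate lam x 0 = lam * x 0 := by
  simp [dilate, e₁, e₂, PiLp.inner_apply, Fin.sum_univ_two]

theorem dilate_apply_one (lam : ℝ) (x : Plane) : dilate lam x 1 = lam ^ 2 * x 1 := by
  simp [dilate, e₁, e₂, PiLp.inner_apply, Fin.sum_univ_two]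

theorem anisotropicDilation_apply (lam : ℝ) (s z : Plane) :
    anisotropicDilation lam s z = dilate lam (rotate s z) := by
  ext i
  fin_cases i
  · simp only [anisotropicDilation, Matrix.toLpLin_apply, Fin.zero_eta, dilate_apply_zero,
      rotate_apply_zero, Matrix.mulVec, dotProduct, Fin.sum_univ_two, Matrix.of_apply,
      Matrix.cons_val',
      Matrix.cons_val_zero, Matrix.cons_val_fin_one, Matrix.cons_val_one]
    ring
  · simp only [anisotropicDilation, Matrix.toLpLin_apply, Fin.mk_one, dilate_apply_one,
      rotate_apply_one, Matrix.mulVec, dotProduct, Fin.sum_univ_two, Matrix.of_apply,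
      Matrix.cons_val',
      Matrix.cons_val_zero, Matrix.cons_val_fin_one, Matrix.cons_val_one, PiLp.inner_apply,
      RCLike.inner_apply, Real.ringHom_apply]
    ring

theorem det_anisotropicDilation (lam : ℝ) (hs : ‖s‖ = 1) :
    LinearMap.det (anisotropicDilation lam s) = lam ^ 3 := by
  have hsq : s 0 ^ 2 + s 1 ^ 2 = 1 := by rw [← norm_sq_eq, hs, one_pow]
  simp only [anisotropicDilation, Matrix.toLpLin_eq_toLin, LinearMap.det_toLin,
    Matrix.det_fin_two_of]
  linear_combination lam ^ 3 * hsq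

theorem setLIntegral_anisotropicDilation (hΩ : MeasurableSet Ω) (hlam : 0 < lam) (hα : 0 < α)
    (hs : ‖s‖ = 1) (y : Plane) :
    ∫⁻ z in halfPlane e₂ ∆ ((fun x => dilate lam (rotate s (x - y))) '' Ω),
      ENNReal.ofReal (|z 1| * (Real.exp (-(α * √((z 0) ^ 2 + (z 1) ^ 2 / lam ^ 2))) /
          ((z 0) ^ 2 + (z 1) ^ 2 / lam ^ 2))) =
      ENNReal.ofReal (lam ^ 4 * α) * bulk (lam * α) Ω s y := by
  have hκ : 0 < lam * α := mul_pos hlam hα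
  have hdet := det_anisotropicDilation lam hs
  have hfactor : lam ^ 4 * α = LinearMap.det (anisotropicDilation lam s) * (lam * α) := by
    rw [hdet]
    ring
  simp only [← anisotropicDilation_apply]
  rw [hfactor]
  refine setLIntegral_symmDiff_image hΩ (by rw [hdet]; positivity) (fun z => ?_) hκ.le
    (fun z => ?_) y
  · rw [anisotropicDilation_apply]
    change inner ℝ e₂ (dilate lam (rotate s z)) < 0 ↔ inner ℝ s z < 0
    rw [inner_e₂, dilate_apply_one, rotate_apply_one]
    exact smul_neg_iff_of_pos_left (pow_pos hlam 2)
  · have hnorm : (lam * rotate s z 0) ^ 2 + (lam ^ 2 * rotate s z 1) ^ 2 / lam ^ 2 =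
        (lam * ‖z‖) ^ 2 := by
      rw [mul_pow lam ‖z‖, ← norm_rotate hs z, norm_sq_eq]
      field_simp
    have hexp : α * (lam * ‖z‖) = lam * α * ‖z‖ := by ring
    rw [anisotropicDilation_apply, dilate_apply_zero, dilate_apply_one, hnorm,
      Real.sqrt_sq (by positivity), hexp, rotate_apply_one, abs_flux hκ, abs_mul,
      abs_of_nonneg (a := lam ^ 2) (by positivity)]
    field_simp

end ChangeOfVariables

section NullSets

theorem image_ae_eq {E : Type*} [NormedAddCommGroup E] [NormedSpace ℝ E] [FiniteDimensional ℝ E]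
    [MeasurableSpace E] [BorelSpace E] {m : Measure E} [m.IsAddHaarMeasure] {f : E → E}
    (hf : Differentiable ℝ f) {S T : Set E} (h : S =ᵐ[m] T) : f '' S =ᵐ[m] f '' T := by
  have image_diff_null {A B : Set E} (hAB : m (A \ B) = 0) : m (f '' A \ f '' B) = 0 := by
    refine measure_mono_null ?_
      (addHaar_image_eq_zero_of_differentiableOn_of_addHaar_eq_zero m hf.differentiableOn hAB)
    rintro _ ⟨⟨x, hxA, rfl⟩, hxB⟩
    exact ⟨x, ⟨hxA, fun hx => hxB ⟨x, hx, rfl⟩⟩, rfl⟩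
  rw [ae_eq_set] at h ⊢
  exact ⟨image_diff_null h.1, image_diff_null h.2⟩

variable {Ω Ω' : Set Plane}

theorem perimeter_congr (h : Ω =ᵐ[volume] Ω') : perimeter Ω = perimeter Ω' := by
  simp only [perimeter, setIntegral_congr_set h]

theorem isOutwardNormal_congr (h : Ω =ᵐ[volume] Ω') :
    IsOutwardNormal Ω = IsOutwardNormal Ω' := by
  unfold IsOutwardNormal IsGaussGreenPolar
  simp only [setIntegral_congr_set h]

theorem reducedBoundary_congr (h : Ω =ᵐ[volume] Ω') :
    reducedBoundary Ω = reducedBoundary Ω' := by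
  simp only [reducedBoundary, isOutwardNormal_congr h]

theorem outwardNormal_congr (h : Ω =ᵐ[volume] Ω') : outwardNormal Ω = outwardNormal Ω' := by
  unfold outwardNormal
  rw [isOutwardNormal_congr h]

theorem nonlocalTerm_congr (h : Ω =ᵐ[volume] Ω') (lam α : ℝ) :
    nonlocalTerm lam α Ω = nonlocalTerm lam α Ω' := by
  simp only [nonlocalTerm, Measure.restrict_congr_set h, Measure.restrict_congr_set h.compl]

theorem boundaryBulk_congr (h : Ω =ᵐ[volume] Ω') (lam α : ℝ) :
    boundaryBulk lam α Ω = boundaryBulk lam α Ω' := by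
  have hdomain (s y : Plane) : (halfPlane s ∆ ((fun x => lam • (x - y)) '' Ω) : Set Plane)
      =ᵐ[volume] (halfPlane s ∆ ((fun x => lam • (x - y)) '' Ω') : Set Plane) :=
    ae_eq_set_symmDiff (ae_eq_refl _) (image_ae_eq (by fun_prop) h)
  simp only [boundaryBulk, reducedBoundary_congr h, outwardNormal_congr h,
    Measure.restrict_congr_set (hdomain _ _)]

theorem anisotropicBoundaryBulk_congr (h : Ω =ᵐ[volume] Ω') (lam α : ℝ) :
    anisotropicBoundaryBulk lam α Ω = anisotropicBoundaryBulk lam α Ω' := by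
  have hdiff (s y : Plane) : Differentiable ℝ fun x => dilate lam (rotate s (x - y)) := by
    simp only [dilate, rotate, ← innerSL_apply_apply ℝ]
    fun_prop
  have hdomain (s y : Plane) :
      (halfPlane e₂ ∆ ((fun x => dilate lam (rotate s (x - y))) '' Ω) : Set Plane) =ᵐ[volume]
        (halfPlane e₂ ∆ ((fun x => dilate lam (rotate s (x - y))) '' Ω') : Set Plane) :=
    ae_eq_set_symmDiff (ae_eq_refl _) (image_ae_eq (hdiff s y) h)
  simp only [anisotropicBoundaryBulk, reducedBoundary_congr h, outwardNormal_congr h,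
    Measure.restrict_congr_set (hdomain _ _)]

end NullSets

section Representation

variable {Ω : Set Plane} {lam α : ℝ}

theorem nonlocalTerm_lt_top (hΩ : NullMeasurableSet Ω) (hfin : volume Ω < ∞)
    (hP : perimeter Ω < ∞) (hκ : 0 < lam * α) : nonlocalTerm lam α Ω < ∞ := by
  obtain ⟨Ω', -, hΩ', hae⟩ := hΩ.exists_measurable_superset_ae_eq
  rw [← measure_congr hae] at hfin
  rw [← perimeter_congr hae] at hP
  rw [← nonlocalTerm_congr hae, nonlocalTerm_eq_ofReal hΩ' hfin hP hκ]
  exact ENNReal.ofReal_lt_top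

theorem toReal_nonlocalTerm_le (hΩ : NullMeasurableSet Ω) (hfin : volume Ω < ∞)
    (hP : perimeter Ω < ∞) (hκ : 0 < lam * α) :
    (nonlocalTerm lam α Ω).toReal ≤ 2 / (lam * α) ^ 2 * (perimeter Ω).toReal := by
  obtain ⟨Ω', -, hΩ', hae⟩ := hΩ.exists_measurable_superset_ae_eq
  rw [← measure_congr hae] at hfin
  rw [← perimeter_congr hae] at hP ⊢
  rw [← nonlocalTerm_congr hae]
  obtain ⟨μ, σ, hpol⟩ := exists_isGaussGreenPolar hΩ' hfin hP
  exact hpol.toReal_nonlocalTerm_le hΩ' hfin hP hκ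

theorem lintegral_reducedBoundary_bulk (hΩ : MeasurableSet Ω) (hfin : volume Ω < ∞)
    (hP : perimeter Ω < ∞) (hκ : 0 < lam * α) {f : Plane → ℝ≥0∞} {c : ℝ} (hc : 0 ≤ c)
    (hf : ∀ y, ‖outwardNormal Ω y‖ = 1 →
      f y = ENNReal.ofReal c * bulk (lam * α) Ω (outwardNormal Ω y) y) :
    ∫⁻ y in reducedBoundary Ω, f y ∂Measure.hausdorffMeasure 1 = ENNReal.ofReal (c *
      (2 / (lam * α) ^ 2 * (perimeter Ω).toReal - (nonlocalTerm lam α Ω).toReal)) := by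
  obtain ⟨μ, σ, hpol⟩ := exists_isGaussGreenPolar hΩ hfin hP
  have := hpol.isFiniteMeasure hP
  rw [ENNReal.ofReal_mul hc, ← hpol.lintegral_bulk hΩ hfin hP hκ,
    ← lintegral_const_mul' _ _ ENNReal.ofReal_ne_top,
    hpol.restrict_hausdorffMeasure hΩ (measure_ne_top μ _)]
  refine lintegral_congr_ae ?_
  filter_upwards [hpol.ae_mem_reducedBoundary] with y hy
  obtain ⟨-, hnormal, hunit⟩ := hy
  rw [hf y (hnormal ▸ hunit), hnormal]

theorem boundaryBulk_eq (hΩ : NullMeasurableSet Ω) (hfin : volume Ω < ∞) (hP : perimeter Ω < ∞)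
    (hlam : 0 < lam) (hα : 0 < α) :
    boundaryBulk lam α Ω = ENNReal.ofReal (lam ^ 2 * α *
      (2 / (lam * α) ^ 2 * (perimeter Ω).toReal - (nonlocalTerm lam α Ω).toReal)) := by
  obtain ⟨Ω', -, hΩ', hae⟩ := hΩ.exists_measurable_superset_ae_eq
  rw [← measure_congr hae] at hfin
  rw [← perimeter_congr hae] at hP ⊢
  rw [← boundaryBulk_congr hae, ← nonlocalTerm_congr hae]
  exact lintegral_reducedBoundary_bulk hΩ' hfin hP (mul_pos hlam hα) (by positivity)
    fun y _ => setLIntegral_dilation hΩ' hlam hα _ y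

theorem anisotropicBoundaryBulk_eq (hΩ : NullMeasurableSet Ω) (hfin : volume Ω < ∞)
    (hP : perimeter Ω < ∞) (hlam : 0 < lam) (hα : 0 < α) :
    anisotropicBoundaryBulk lam α Ω = ENNReal.ofReal (lam ^ 4 * α *
      (2 / (lam * α) ^ 2 * (perimeter Ω).toReal - (nonlocalTerm lam α Ω).toReal)) := by
  obtain ⟨Ω', -, hΩ', hae⟩ := hΩ.exists_measurable_superset_ae_eq
  rw [← measure_congr hae] at hfin
  rw [← perimeter_congr hae] at hP ⊢
  rw [← anisotropicBoundaryBulk_congr hae, ← nonlocalTerm_congr hae]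
  exact lintegral_reducedBoundary_bulk hΩ' hfin hP (mul_pos hlam hα) (by positivity)
    fun y hy => setLIntegral_anisotropicDilation hΩ' hlam hα hy y

theorem energy_eq_add_boundaryBulk (hΩ : NullMeasurableSet Ω) (hfin : volume Ω < ∞)
    (hP : perimeter Ω < ∞) (hlam : 0 < lam) (hα : 0 < α) :
    energy lam α Ω = (1 - 1 / (2 * Real.pi * α ^ 2)) * (perimeter Ω).toReal +
      1 / (4 * Real.pi * α) * (boundaryBulk lam α Ω).toReal := by
  have hdefect := sub_nonneg.2 (toReal_nonlocalTerm_le hΩ hfin hP (mul_pos hlam hα))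
  rw [boundaryBulk_eq hΩ hfin hP hlam hα, ENNReal.toReal_ofReal (by positivity), energy]
  field_simp
  ring

theorem energy_eq_add_anisotropicBoundaryBulk (hΩ : NullMeasurableSet Ω) (hfin : volume Ω < ∞)
    (hP : perimeter Ω < ∞) (hlam : 0 < lam) (hα : 0 < α) :
    energy lam α Ω = (1 - 1 / (2 * Real.pi * α ^ 2)) * (perimeter Ω).toReal +
      1 / (4 * Real.pi * α * lam ^ 2) * (anisotropicBoundaryBulk lam α Ω).toReal := by
  have hdefect := sub_nonneg.2 (toReal_nonlocalTerm_le hΩ hfin hP (mul_pos hlam hα))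
  rw [anisotropicBoundaryBulk_eq hΩ hfin hP hlam hα, ENNReal.toReal_ofReal (by positivity), energy]
  field_simp
  ring

end Representation

end ScreenedPerimeter

end

theorem lemma3p1_general (lam α : ℝ) (hlam : 0 < lam) (hα : 0 < α)
    (Ω : Set ScreenedPerimeter.Plane) (hΩ : NullMeasurableSet Ω) (hfin : volume Ω < ∞)
    (hP : ScreenedPerimeter.perimeter Ω < ∞) :
    ScreenedPerimeter.nonlocalTerm lam α Ω < ∞ ∧
    ScreenedPerimeter.boundaryBulk lam α Ω < ∞ ∧
    ScreenedPerimeter.anisotropicBoundaryBulk lam α Ω < ∞ ∧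
    ScreenedPerimeter.energy lam α Ω =
      (1 - 1 / (2 * Real.pi * α ^ 2)) * (ScreenedPerimeter.perimeter Ω).toReal +
        1 / (4 * Real.pi * α) * (ScreenedPerimeter.boundaryBulk lam α Ω).toReal ∧
    ScreenedPerimeter.energy lam α Ω =
      (1 - 1 / (2 * Real.pi * α ^ 2)) * (ScreenedPerimeter.perimeter Ω).toReal +
        1 / (4 * Real.pi * α * lam ^ 2) *
          (ScreenedPerimeter.anisotropicBoundaryBulk lam α Ω).toReal ∧
    (1 - 1 / (2 * Real.pi * α ^ 2)) * (ScreenedPerimeter.perimeter Ω).toReal ≤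
      ScreenedPerimeter.energy lam α Ω := by
  have hrepr := ScreenedPerimeter.energy_eq_add_boundaryBulk hΩ hfin hP hlam hα
  refine ⟨ScreenedPerimeter.nonlocalTerm_lt_top hΩ hfin hP (mul_pos hlam hα), ?_, ?_, hrepr,
    ScreenedPerimeter.energy_eq_add_anisotropicBoundaryBulk hΩ hfin hP hlam hα, ?_⟩
  · exact ScreenedPerimeter.boundaryBulk_eq hΩ hfin hP hlam hα ▸ ENNReal.ofReal_lt_top
  · exact ScreenedPerimeter.anisotropicBoundaryBulk_eq hΩ hfin hP hlam hα ▸ ENNReal.ofReal_lt_top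
  · rw [hrepr, le_add_iff_nonneg_right]
    positivity

theorem lemma3p1 (lam α : ℝ) (hlam : 0 < lam) (hα : 0 < α)
    (Ω : Set ScreenedPerimeter.Plane) (hΩ : Ω ∈ ScreenedPerimeter.admissible Real.pi) :
    -- all the integrals involved are finite
    ScreenedPerimeter.nonlocalTerm lam α Ω < ∞ ∧
    ScreenedPerimeter.boundaryBulk lam α Ω < ∞ ∧
    ScreenedPerimeter.anisotropicBoundaryBulk lam α Ω < ∞ ∧
    -- the first representation
    ScreenedPerimeter.energy lam α Ω =
      (1 - 1 / (2 * Real.pi * α ^ 2)) * (ScreenedPerimeter.perimeter Ω).toReal +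
        1 / (4 * Real.pi * α) * (ScreenedPerimeter.boundaryBulk lam α Ω).toReal ∧
    -- the anisotropically rescaled representation
    ScreenedPerimeter.energy lam α Ω =
      (1 - 1 / (2 * Real.pi * α ^ 2)) * (ScreenedPerimeter.perimeter Ω).toReal +
        1 / (4 * Real.pi * α * lam ^ 2) *
          (ScreenedPerimeter.anisotropicBoundaryBulk lam α Ω).toReal ∧
    -- the lower bound
    (1 - 1 / (2 * Real.pi * α ^ 2)) * (ScreenedPerimeter.perimeter Ω).toReal ≤
      ScreenedPerimeter.energy lam α Ω := by
  obtain ⟨hmeas, hvol, hP⟩ := hΩ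
  exact lemma3p1_general lam α hlam hα Ω hmeas (hvol ▸ ENNReal.ofReal_lt_top) hP
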